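/- A (simple) weighted graph $G=(V,E,J)$ is a simple graph $(V,E)$ with countable vertex set together with positive weights $(J_e)_{e\in E}$ such that $\sum_{e\ni v}J_e<\infty$ for every $v\in V$; it need not be locally finite or connected. An automorphism of $G$ is a weight-preserving graph automorphism of $(V,E)$. $G$ is transitive if for all $x,y\in V$ some automorphism sends $x$ to $y$, and a transitive $G$ is unimodular if $|\mathrm{Stab}_x y|=|\mathrm{Stab}_y x|$ in $\mathbb N\cup\{\infty\}$ for all $x,y\in V$, where $\mathrm{Stab}_x y$ is the orbit of $y$ under the group of automorphisms that fix $x$. For $\beta\ge 0$, $\mathbf P_\beta$ is the law of the random subgraph of $G$ in which each edge $e$ is retained independently with probability $1-e^{-\beta J_e}$; its connected components are called clusters, $K_v$ is the vertex set of the cluster of $v$, and $\beta_c=\sup\{\beta\ge 0:\ \mathbf P_\beta\text{-almost surely there is no infinite cluster}\}\in[0,\infty]$. **Theorem 1.2.** Let $G=(V,E,J)$ be an infinite, simple, unimodular transitive weighted graph, let $o\in V$, and suppose that there exist constants $1/2<a<1$, $c>0$ and $\varepsilon_0>0$ such that $$|\{e\in E:\ e\ni o,\ J_e\ge\varepsilon\}|\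 \ge\ c\,\varepsilon^{-a}\qquad\text{for every }0<\varepsilon\le\varepsilon_0 .$$ Then $\beta_c<\infty$, and there exists a constant $C$ such that $$\mathbf P_\beta(|K_o|\ge n)\ \le\ C\,n^{-(2a-1)/(a+1)}\qquad\text{for every }0\le\beta\le\beta_c\text{ and every integer }n\ge 1 .$$ In particular, $\mathbf P_{\beta_c}$-almost surely there is no infinite cluster. -/

import Mathlib

open MeasureTheory ProbabilityTheory
open scoped NNReal ENNReal

/-- A simple weighted graph `(V, E, J)` on the vertex set `V`: a simple graph `(V, E)` with positive
edge weights `J e`, `e ∈ E`, whose sum over the edges incident to any given vertex converges.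
The graph may have infinite degrees and is not assumed to be connected. -/
structure WeightedGraph (V : Type*) where
  /-- the underlying simple graph `(V, E)` -/
  graph : SimpleGraph V
  /-- the weights, defined on the edges only -/
  J : graph.edgeSet → ℝ
  J_pos : ∀ e, 0 < J e
  summable_J : ∀ v : V, Summable fun e : {e : graph.edgeSet // v ∈ (e : Sym2 V)} => J e

namespace WeightedGraph

/-- A graph automorphism is an automorphism of the weighted graph if it preserves the weights. -/
def IsAut {V : Type*} (G : WeightedGraph V) (φ : G.graph ≃g G.graph) : Prop :=
  ∀ e : G.graph.edgeSet, G.J (φ.mapEdgeSet e) = G.J e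

/-- A weighted graph is transitive if any vertex can be sent to any other by an automorphism. -/
def IsTransitive {V : Type*} (G : WeightedGraph V) : Prop :=
  ∀ x y : V, ∃ φ : G.graph ≃g G.graph, G.IsAut φ ∧ φ x = y

/-- `Stab_x y`, the orbit of `y` under the stabilizer of `x` in the automorphism group. -/
def stabOrbit {V : Type*} (G : WeightedGraph V) (x y : V) : Set V :=
  {z | ∃ φ : G.graph ≃g G.graph, G.IsAut φ ∧ φ x = x ∧ φ y = z}

/-- Unimodularity of a transitive weighted graph: `|Stab_x y| = |Stab_y x|` for all `x` and `y`.
For `x` and `y` in the same connected component of a transitive weighted graph both cardinalities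
are finite, and for `x` and `y` in different components of an infinite one both are infinite. -/
def IsUnimodular {V : Type*} (G : WeightedGraph V) : Prop :=
  ∀ x y : V, (G.stabOrbit x y).encard = (G.stabOrbit y x).encard

/-- The retention probability `1 - exp (-β J_e)` of the edge `e`. -/
noncomputable def retentionProb {V : Type*} (G : WeightedGraph V) (β : ℝ≥0)
    (e : G.graph.edgeSet) : unitInterval :=
  ⟨1 - Real.exp (-((β : ℝ) * G.J e)),
    sub_nonneg.mpr (Real.exp_le_one_iff.mpr
      (neg_nonpos.mpr (mul_nonneg β.coe_nonneg (G.J_pos e).le))),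
    sub_le_self _ (Real.exp_pos _).le⟩

/-- The law of Bernoulli-`β` bond percolation on `G`, on configurations `ω : E → {true, false}`
(`true` for retained, `false` for deleted): each edge `e` is retained independently with probability
`1 - exp (-β J_e)`. -/
noncomputable def percolation {V : Type*} (G : WeightedGraph V) (β : ℝ≥0) :
    Measure (G.graph.edgeSet → Bool) :=
  Measure.infinitePi fun e => bernoulliMeasure true false (G.retentionProb β e)

/-- The random subgraph formed by all vertices and the retained edges. -/
def openSubgraph {V : Type*} (G : WeightedGraph V) (ω : G.graph.edgeSet → Bool) : SimpleGraph V :=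
  SimpleGraph.fromEdgeSet {e | ∃ h : e ∈ G.graph.edgeSet, ω ⟨e, h⟩ = true}

/-- The cluster `K_v` of `v`: its connected component in the random subgraph. -/
def cluster {V : Type*} (G : WeightedGraph V) (ω : G.graph.edgeSet → Bool) (v : V) : Set V :=
  {w | (G.openSubgraph ω).Reachable v w}

/-- Under the percolation measure of parameter `β` there are almost surely no infinite clusters. -/
def NoInfiniteCluster {V : Type*} (G : WeightedGraph V) (β : ℝ≥0) : Prop :=
  ∀ᵐ ω ∂(G.percolation β), ∀ v : V, (G.cluster ω v).Finite

/-- The critical parameter, in `[0, ∞]`: the supremum of all `β ≥ 0` for which there are almost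
surely no infinite clusters. -/
noncomputable def criticalParam {V : Type*} (G : WeightedGraph V) : ℝ≥0∞ :=
  sSup {b | ∃ β : ℝ≥0, b = (β : ℝ≥0∞) ∧ G.NoInfiniteCluster β}

end WeightedGraph

/-!
The proof compares two estimates on the probability that two heavy neighbours (vertices joined by an
edge of weight at least `ε`) both have large clusters; write `q n` for the probability that the
cluster of `o` has at least `n` vertices and `θ = (2a - 1) / (a + 1)`.

*Distinct clusters.* For an edge of weight at least `ε` let the closed state count `1` and the open
state `-(1 - p) / p`, a variable of mean zero. Exploring the cluster of `o` turns the sum `Z` of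
these variables over the heavy edges touching the cluster into a martingale with variance at most
`D = N / (β ε)` per vertex, where `N` is the number of heavy neighbours. Hence the expectation of
`|Z| / max n |K_o|` is at most `√D ∑ j, q j / (√j max n j)` (`Ex_abs_K_le`). Conversely, resampling
one heavy edge shows that it contributes at least the probability that its ends lie in distinct
clusters with at least `n` vertices (`mul_Pr_le_Ex_edgeMass`), and the mass-transport principle
(`tsum_mass_eq`), the one place where unimodularity enters, moves these contributions to `o`. This
is the two-ghost inequality `sum_two_ghost_le`; it requires all clusters to be finite.

*Equal clusters.* The number of points of a cluster in a set of `N` vertices is at most of the order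
of its typical maximum over clusters: a cluster with `3m` points in the set contains disjoint
witnesses for two clusters with `m` points (`disjOcc_of_three_mul_le`), so that the van den
Berg–Kesten inequality (`Pr_disjOcc_le`) gives exponential decay beyond that scale
(`Ex_ncard_inter_le`). The resulting bound on the mean is `sum_Pr_conn_le`.

By Harris' inequality the two estimates bound `q n ^ 2` (`sq_tail_le`). If `q n ≤ A n ^ (-θ)` for
all `n ≥ 1`, the choice of `ε` proportional to `n ^ (-3 / (a + 1))` makes both of them of order
`n ^ (-2θ)`, with a total constant of order `A ^ (2 / (1 + θ))`. As `2 / (1 + θ) < 2`, the optimal `A`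
is bounded in terms of a lower bound on `β` as soon as it is finite (`tail_le_of_exists`).

Finiteness of `A` below the critical parameter is sharpness of the phase transition, by the
argument of Duminil-Copin and Tassion. If some finite set `S ∋ o` has expected outgoing flow less
than `1`, the mean cluster size is finite (`Ex_ncard_le`); otherwise raising the parameter by any
amount creates an infinite cluster (`Pr_subset_le_exp`, `exists_outflow_le`). The critical
parameter is finite since `q n` tends to `1` as `β → ∞` for fixed `n`, which the uniform bound
forbids, and the bound passes to the critical parameter because `q n` is a supremum of continuous
increasing functions of `β`.

All correlation inequalities and explorations take place on finite edge sets, where expectations are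
the finite sums `Ex` and the proofs are inductions on the number of edges; `tendsto_Pr` and
`tendsto_Ex` transfer the results to the percolation measure.
-/

set_option linter.unusedSectionVars false

namespace Percolation

/-! ### Finite Bernoulli product expectations -/

section FiniteProduct

variable {E : Type*} [DecidableEq E]

/-- The expectation of `f T`, where the random set `T ⊆ F` contains each `e ∈ F` independently with
probability `p e`, written as a finite sum. No bounds on `p` are built in. -/
noncomputable def Ex (F : Finset E) (p : E → ℝ) (f : Finset E → ℝ) : ℝ :=
  ∑ T ∈ F.powerset, (∏ e ∈ T, p e) * (∏ e ∈ F \ T, (1 - p e)) * f T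

open scoped Classical in
/-- The probability of the event `A` under the product law of `Ex`. -/
noncomputable def Pr (F : Finset E) (p : E → ℝ) (A : Finset E → Prop) : ℝ :=
  Ex F p fun T => if A T then 1 else 0

variable {F F' : Finset E} {p p' : E → ℝ} {f g : Finset E → ℝ} {A B : Finset E → Prop}

@[simp] lemma Ex_empty : Ex ∅ p f = f ∅ := by simp [Ex]

lemma Ex_insert {e : E} (he : e ∉ F) :
    Ex (insert e F) p f = (1 - p e) * Ex F p f + p e * Ex F p (fun T => f (insert e T)) := by
  unfold Ex
  rw [Finset.sum_powerset_insert he, Finset.mul_sum, Finset.mul_sum]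
  congr 1
  · refine Finset.sum_congr rfl fun T hT => ?_
    have hT' : e ∉ T := fun h => he (Finset.mem_powerset.1 hT h)
    have : insert e F \ T = insert e (F \ T) := Finset.insert_sdiff_of_notMem _ hT'
    rw [this, Finset.prod_insert (by simp [he])]
    ring
  · refine Finset.sum_congr rfl fun T hT => ?_
    have hT' : e ∉ T := fun h => he (Finset.mem_powerset.1 hT h)
    have : insert e F \ insert e T = F \ T := by
      ext x
      simp only [Finset.mem_sdiff, Finset.mem_insert]
      constructor
      · rintro ⟨rfl | h, h2⟩
        · simp at h2
        · exact ⟨h, fun h3 => h2 (Or.inr h3)⟩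
      · rintro ⟨h, h2⟩
        refine ⟨Or.inr h, ?_⟩
        rintro (rfl | h3)
        · exact he h
        · exact h2 h3
    rw [this, Finset.prod_insert hT']
    ring

lemma Ex_congr (h : ∀ T ⊆ F, f T = g T) : Ex F p f = Ex F p g :=
  Finset.sum_congr rfl fun T hT => by rw [h T (Finset.mem_powerset.1 hT)]

lemma Ex_congr_p (h : ∀ e ∈ F, p e = p' e) : Ex F p f = Ex F p' f := by
  refine Finset.sum_congr rfl fun T hT => ?_
  have h1 : ∏ e ∈ T, p e = ∏ e ∈ T, p' e :=
    Finset.prod_congr rfl fun e he => h e (Finset.mem_powerset.1 hT he)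
  have h2 : ∏ e ∈ F \ T, (1 - p e) = ∏ e ∈ F \ T, (1 - p' e) :=
    Finset.prod_congr rfl fun e he => by rw [h e (Finset.mem_sdiff.1 he).1]
  rw [h1, h2]

lemma Ex_add : Ex F p (fun T => f T + g T) = Ex F p f + Ex F p g := by
  simp only [Ex, ← Finset.sum_add_distrib]
  exact Finset.sum_congr rfl fun T _ => by ring

lemma Ex_sub : Ex F p (fun T => f T - g T) = Ex F p f - Ex F p g := by
  simp only [Ex, ← Finset.sum_sub_distrib]
  exact Finset.sum_congr rfl fun T _ => by ring

lemma Ex_const_mul (c : ℝ) : Ex F p (fun T => c * f T) = c * Ex F p f := by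
  simp only [Ex, Finset.mul_sum]
  exact Finset.sum_congr rfl fun T _ => by ring

lemma Ex_mul_const (c : ℝ) : Ex F p (fun T => f T * c) = Ex F p f * c := by
  simp only [Ex, Finset.sum_mul]
  exact Finset.sum_congr rfl fun T _ => by ring

lemma Ex_sum {ι : Type*} (s : Finset ι) (f : ι → Finset E → ℝ) :
    Ex F p (fun T => ∑ i ∈ s, f i T) = ∑ i ∈ s, Ex F p (f i) := by
  simp only [Ex, Finset.mul_sum]
  exact Finset.sum_comm

@[simp] lemma Ex_const (c : ℝ) : Ex F p (fun _ => c) = c := by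
  induction F using Finset.induction_on with
  | empty => simp
  | insert e F he ih => rw [Ex_insert he, ih]; ring

lemma Ex_mono (hp : ∀ e ∈ F, 0 ≤ p e ∧ p e ≤ 1) (h : ∀ T ⊆ F, f T ≤ g T) :
    Ex F p f ≤ Ex F p g := by
  refine Finset.sum_le_sum fun T hT => ?_
  have hT := Finset.mem_powerset.1 hT
  refine mul_le_mul_of_nonneg_left (h T hT) (mul_nonneg ?_ ?_)
  · exact Finset.prod_nonneg fun e he => (hp e (hT he)).1
  · exact Finset.prod_nonneg fun e he => by linarith [(hp e (Finset.mem_sdiff.1 he).1).2]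

lemma Ex_nonneg (hp : ∀ e ∈ F, 0 ≤ p e ∧ p e ≤ 1) (h : ∀ T ⊆ F, 0 ≤ f T) : 0 ≤ Ex F p f := by
  simpa using Ex_mono (f := fun _ => 0) hp h

lemma Ex_union (h : Disjoint F F') :
    Ex (F ∪ F') p f = Ex F p fun S => Ex F' p fun T => f (S ∪ T) := by
  induction F using Finset.induction_on generalizing f with
  | empty => simp
  | insert e F he ih =>
    rw [Finset.disjoint_insert_left] at h
    rw [Finset.insert_union, Ex_insert (by simp [he, h.1]), ih h.2, ih h.2, Ex_insert he]
    simp only [Finset.insert_union]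

/-- Enlarging the ground set does not change the law of the trace on the smaller one. -/
lemma Ex_inter (h : F ⊆ F') : Ex F' p (fun T => f (T ∩ F)) = Ex F p f := by
  have h1 : F' = F ∪ F' \ F := (Finset.union_sdiff_of_subset h).symm
  rw [h1, Ex_union Finset.disjoint_sdiff]
  refine Ex_congr fun S hS => ?_
  rw [Ex_congr (g := fun _ => f S)]
  · simp
  · intro T hT
    congr 1
    ext x
    simp only [Finset.mem_inter, Finset.mem_union]
    constructor
    · rintro ⟨h1 | h1, h2⟩
      · exact h1
      · exact absurd h2 (Finset.mem_sdiff.1 (hT h1)).2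
    · exact fun hx => ⟨Or.inl hx, hS hx⟩

lemma Ex_erase {e : E} (he : e ∈ F) :
    Ex F p f = (1 - p e) * Ex (F.erase e) p f
      + p e * Ex (F.erase e) p (fun T => f (insert e T)) := by
  rw [← Ex_insert (by simp), Finset.insert_erase he]

lemma Ex_mono_set (hp : ∀ e ∈ F', 0 ≤ p e ∧ p e ≤ 1) (h : F ⊆ F') (hf : Monotone f) :
    Ex F p f ≤ Ex F' p f := by
  rw [← Ex_inter (p := p) h]
  exact Ex_mono hp fun T _ => hf Finset.inter_subset_left

lemma monotone_insert (hf : Monotone f) (e : E) : Monotone fun T => f (insert e T) :=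
  fun _ _ h => hf (Finset.insert_subset_insert e h)

/-- **Harris' inequality**: increasing functions of independent bits are positively correlated. -/
lemma Ex_mul_le_Ex_mul (hp : ∀ e ∈ F, 0 ≤ p e ∧ p e ≤ 1) (hf : Monotone f) (hg : Monotone g) :
    Ex F p f * Ex F p g ≤ Ex F p fun T => f T * g T := by
  induction F using Finset.induction_on generalizing f g with
  | empty => simp
  | insert e F he ih =>
    have hp' : ∀ e ∈ F, 0 ≤ p e ∧ p e ≤ 1 := fun e he => hp e (Finset.mem_insert_of_mem he)
    have h0 := ih hp' hf hg
    have h1 := ih hp' (monotone_insert hf e) (monotone_insert hg e)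
    have hf' : Ex F p f ≤ Ex F p (fun T => f (insert e T)) :=
      Ex_mono hp' fun T _ => hf (Finset.subset_insert e T)
    have hg' : Ex F p g ≤ Ex F p (fun T => g (insert e T)) :=
      Ex_mono hp' fun T _ => hg (Finset.subset_insert e T)
    obtain ⟨hp0, hp1⟩ := hp e (Finset.mem_insert_self e F)
    rw [Ex_insert he, Ex_insert he, Ex_insert he]
    have hq : 0 ≤ p e * (1 - p e) := mul_nonneg hp0 (by linarith)
    nlinarith [mul_nonneg hq (mul_nonneg (sub_nonneg.2 hf') (sub_nonneg.2 hg')),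
      mul_le_mul_of_nonneg_left h0 (sub_nonneg.2 hp1), mul_le_mul_of_nonneg_left h1 hp0]

lemma Ex_mono_p (hp : ∀ e ∈ F, 0 ≤ p e ∧ p e ≤ 1) (hp' : ∀ e ∈ F, 0 ≤ p' e ∧ p' e ≤ 1)
    (hpp : ∀ e ∈ F, p e ≤ p' e) (hf : Monotone f) : Ex F p f ≤ Ex F p' f := by
  induction F using Finset.induction_on generalizing f with
  | empty => simp
  | insert e F he ih =>
    simp only [Finset.forall_mem_insert] at hp hp' hpp
    have h0 := ih hp.2 hp'.2 hpp.2 hf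
    have h1 := ih hp.2 hp'.2 hpp.2 (monotone_insert hf e)
    have hf' : Ex F p f ≤ Ex F p (fun T => f (insert e T)) :=
      Ex_mono hp.2 fun T _ => hf (Finset.subset_insert e T)
    rw [Ex_insert he, Ex_insert he]
    nlinarith [mul_le_mul_of_nonneg_left h0 (sub_nonneg.2 hp'.1.2),
      mul_le_mul_of_nonneg_left h1 hp'.1.1, mul_nonneg (sub_nonneg.2 hpp.1) (sub_nonneg.2 hf')]

/-- Sprinkling: the union of two independent random sets is again a product random set. -/
lemma Ex_sprinkle :
    Ex F (fun e => 1 - (1 - p e) * (1 - p' e)) f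
      = Ex F p fun S => Ex F p' fun T => f (S ∪ T) := by
  induction F using Finset.induction_on generalizing f with
  | empty => simp
  | insert e F he ih =>
    have key : ∀ h : Finset E → ℝ, Ex F p (fun S => Ex (insert e F) p' fun T => h (S ∪ T)) =
        (1 - p' e) * Ex F p (fun S => Ex F p' fun T => h (S ∪ T)) +
        p' e * Ex F p (fun S => Ex F p' fun T => h (insert e (S ∪ T))) := by
      intro h
      rw [← Ex_const_mul, ← Ex_const_mul, ← Ex_add]
      refine Ex_congr fun S _ => ?_
      rw [Ex_insert he]
      simp only [Finset.union_insert]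
    rw [Ex_insert he, ih, ih, Ex_insert he, key]
    simp only [Finset.insert_union]
    rw [key (fun T => f (insert e T))]
    simp only [Finset.insert_idem]
    ring

lemma continuous_Ex {X : Type*} [TopologicalSpace X] (F : Finset E) (f : Finset E → ℝ)
    {q : X → E → ℝ} (hq : ∀ e, Continuous fun x => q x e) :
    Continuous fun x => Ex F (q x) f := by
  unfold Ex
  fun_prop

lemma Pr_mono (hp : ∀ e ∈ F, 0 ≤ p e ∧ p e ≤ 1) (h : ∀ T ⊆ F, A T → B T) :
    Pr F p A ≤ Pr F p B := by
  refine Ex_mono hp fun T hT => ?_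
  have := h T hT
  split_ifs <;> first | (norm_num; done) | tauto

lemma Pr_erase {e : E} (he : e ∈ F) :
    Pr F p A = (1 - p e) * Pr (F.erase e) p A
      + p e * Pr (F.erase e) p (fun T => A (insert e T)) := by
  unfold Pr
  rw [Ex_erase he]

lemma Pr_eq_Ex [DecidablePred A] : Pr F p A = Ex F p fun T => if A T then (1 : ℝ) else 0 :=
  Ex_congr fun T _ => by congr

lemma Pr_eq_zero (h : ∀ T ⊆ F, ¬ A T) : Pr F p A = 0 := by
  unfold Pr
  rw [Ex_congr (g := fun _ => 0) fun T hT => if_neg (h T hT), Ex_const]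

lemma Pr_nonneg (hp : ∀ e ∈ F, 0 ≤ p e ∧ p e ≤ 1) : 0 ≤ Pr F p A :=
  Ex_nonneg hp fun T _ => by split_ifs <;> norm_num

open scoped Classical in
lemma Pr_le_one (hp : ∀ e ∈ F, 0 ≤ p e ∧ p e ≤ 1) : Pr F p A ≤ 1 := by
  have := Ex_mono (f := fun T => if A T then (1 : ℝ) else 0) (g := fun _ => 1) hp
    fun T _ => by split_ifs <;> norm_num
  simpa [Pr] using this

open scoped Classical in
lemma monotone_ite (hA : ∀ S T : Finset E, S ⊆ T → A S → A T) :
    Monotone fun T => if A T then (1 : ℝ) else 0 := by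
  intro S T hST
  have := hA S T hST
  simp only
  split_ifs <;> first | (norm_num; done) | tauto

/-- Disjoint occurrence of two events: `T` contains disjoint witnesses of `A` and of `B`. This is
the usual notion when both events are increasing. -/
def DisjOcc (A B : Finset E → Prop) (T : Finset E) : Prop :=
  ∃ I ⊆ T, ∃ J ⊆ T, Disjoint I J ∧ A I ∧ B J

lemma DisjOcc.mono {A' B' : Finset E → Prop} (hA : ∀ T, A T → A' T) (hB : ∀ T, B T → B' T)
    {T : Finset E} (h : DisjOcc A B T) : DisjOcc A' B' T := by
  obtain ⟨I, hI, J, hJ, hd, h1, h2⟩ := h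
  exact ⟨I, hI, J, hJ, hd, hA _ h1, hB _ h2⟩

lemma disjOcc_insert {e : E} {T : Finset E} (h : DisjOcc A B (insert e T))
    (hA : ∀ S T : Finset E, S ⊆ T → A S → A T) (hB : ∀ S T : Finset E, S ⊆ T → B S → B T) :
    DisjOcc (fun T => A (insert e T)) B T ∨ DisjOcc A (fun T => B (insert e T)) T := by
  obtain ⟨I, hI, J, hJ, hd, h1, h2⟩ := h
  by_cases he : e ∈ I
  · left
    refine ⟨I.erase e, ?_, J, ?_, ?_, ?_, h2⟩
    · rw [← Finset.subset_insert_iff]; exact hI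
    · have heJ : e ∉ J := Finset.disjoint_left.1 hd he
      exact (Finset.subset_insert_iff_of_notMem heJ).1 hJ
    · exact Finset.disjoint_of_subset_left (Finset.erase_subset _ _) hd
    · exact hA _ _ (Finset.insert_erase he).ge h1
  · right
    refine ⟨I, (Finset.subset_insert_iff_of_notMem he).1 hI, J.erase e, ?_, ?_, h1, ?_⟩
    · rw [← Finset.subset_insert_iff]; exact hJ
    · exact Finset.disjoint_of_subset_right (Finset.erase_subset _ _) hd
    · exact hB _ _ (Finset.subset_insert_iff.2 subset_rfl) h2

/-- The **van den Berg–Kesten inequality** for increasing events, by induction on the number of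
coordinates. -/
lemma Pr_disjOcc_le (hp : ∀ e ∈ F, 0 ≤ p e ∧ p e ≤ 1)
    (hA : ∀ S T : Finset E, S ⊆ T → A S → A T) (hB : ∀ S T : Finset E, S ⊆ T → B S → B T) :
    Pr F p (DisjOcc A B) ≤ Pr F p A * Pr F p B := by
  classical
  induction F using Finset.induction_on generalizing A B with
  | empty =>
    simp only [Pr, Ex_empty]
    have : DisjOcc A B ∅ → A ∅ ∧ B ∅ := by
      rintro ⟨I, hI, J, hJ, -, h1, h2⟩
      exact ⟨hA _ _ hI h1, hB _ _ hJ h2⟩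
    split_ifs <;> first | (norm_num; done) | tauto
  | insert e F he ih =>
    have hp' : ∀ e ∈ F, 0 ≤ p e ∧ p e ≤ 1 := fun e he => hp e (Finset.mem_insert_of_mem he)
    obtain ⟨hp0, hp1⟩ := hp e (Finset.mem_insert_self e F)
    have hA1 : ∀ S T : Finset E, S ⊆ T → A (insert e S) → A (insert e T) :=
      fun S T h => hA _ _ (Finset.insert_subset_insert e h)
    have hB1 : ∀ S T : Finset E, S ⊆ T → B (insert e S) → B (insert e T) :=
      fun S T h => hB _ _ (Finset.insert_subset_insert e h)
    have hAA : ∀ T, A T → A (insert e T) := fun T => hA _ _ (Finset.subset_insert e T)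
    have hBB : ∀ T, B T → B (insert e T) := fun T => hB _ _ (Finset.subset_insert e T)
    have i00 := ih hp' hA hB
    have i10 := ih hp' hA1 hB
    have i01 := ih hp' hA hB1
    have i11 := ih hp' hA1 hB1
    have rec_ : ∀ C : Finset E → Prop, Pr (insert e F) p C =
        (1 - p e) * Pr F p C + p e * Pr F p (fun T => C (insert e T)) := by
      intro C
      simp only [Pr]
      rw [Ex_insert he]
    rw [rec_, rec_ A, rec_ B]
    -- an open edge `e` is used by at most one of the two witnesses
    have c1 : Pr F p (fun T => DisjOcc A B (insert e T)) ≤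
        Pr F p (DisjOcc (fun T => A (insert e T)) (fun T => B (insert e T))) := by
      refine Pr_mono hp' fun T _ h => ?_
      rcases disjOcc_insert h hA hB with h | h
      · exact h.mono (fun _ => id) hBB
      · exact h.mono hAA (fun _ => id)
    have c01 : Pr F p (DisjOcc A B) + Pr F p (fun T => DisjOcc A B (insert e T)) ≤
        Pr F p (DisjOcc (fun T => A (insert e T)) B)
          + Pr F p (DisjOcc A (fun T => B (insert e T))) := by
      simp only [Pr]
      rw [← Ex_add, ← Ex_add]
      refine Ex_mono hp' fun T _ => ?_
      have h1 := fun h => disjOcc_insert (A := A) (B := B) (e := e) (T := T) h hA hB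
      have h2 : DisjOcc A B T → DisjOcc (fun T => A (insert e T)) B T :=
        fun h => h.mono hAA (fun _ => id)
      have h3 : DisjOcc A B T → DisjOcc A (fun T => B (insert e T)) T :=
        fun h => h.mono (fun _ => id) hBB
      split_ifs <;> first | (norm_num; done) | tauto
    set a0 := Pr F p A
    set b0 := Pr F p B
    set a1 := Pr F p (fun T => A (insert e T))
    set b1 := Pr F p (fun T => B (insert e T))
    set q := p e
    have hq : 0 ≤ 1 - q := by linarith
    have e1 := mul_le_mul_of_nonneg_left i00 (mul_nonneg hq hq)
    have e2 := mul_le_mul_of_nonneg_left (c01.trans (add_le_add i10 i01)) (mul_nonneg hq hp0)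
    have e3 := mul_le_mul_of_nonneg_left (c1.trans i11) (mul_nonneg hp0 hp0)
    nlinarith

end FiniteProduct

/-! ### Clusters of edge sets -/

section Clusters

open scoped Classical

variable {V : Type*} {T T' : Set (Sym2 V)} {x y z o : V}

/-- `x` and `y` are joined by a path of edges in `T`. Diagonal elements of `T` are harmless. -/
def Conn (T : Set (Sym2 V)) : V → V → Prop :=
  Relation.ReflTransGen fun a b => s(a, b) ∈ T

/-- The cluster of `x` for the set `T` of open edges. -/
def K (T : Set (Sym2 V)) (x : V) : Set V := {y | Conn T x y}

/-- The set of vertices joined to the set `S` by open edges in `T`. -/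
def Cl (T : Set (Sym2 V)) (S : Set V) : Set V := {y | ∃ x ∈ S, Conn T x y}

/-- The edge `e` has an endpoint in `C`. -/
def Touches (C : Set V) (e : Sym2 V) : Prop := ∃ x ∈ C, x ∈ e

lemma Conn.refl : Conn T x x := Relation.ReflTransGen.refl

lemma Conn.trans (h : Conn T x y) (h' : Conn T y z) : Conn T x z :=
  Relation.ReflTransGen.trans h h'

lemma Conn.symm (h : Conn T x y) : Conn T y x := by
  induction h with
  | refl => exact .refl
  | tail _ hbc ih => exact Conn.trans (.single (by rwa [Sym2.eq_swap])) ih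

lemma Conn.mono (hT : T ⊆ T') (h : Conn T x y) : Conn T' x y :=
  Relation.ReflTransGen.mono (fun _ _ h => hT h) _ _ h

lemma Conn.edge (h : s(x, y) ∈ T) : Conn T x y := .single h

lemma conn_comm : Conn T x y ↔ Conn T y x := ⟨.symm, .symm⟩

lemma mem_K_self : x ∈ K T x := Conn.refl

lemma K_mono (hT : T ⊆ T') : K T x ⊆ K T' x := fun _ h => Conn.mono hT h

lemma K_eq (h : Conn T x y) : K T x = K T y :=
  Set.ext fun _ => ⟨fun h' => h.symm.trans h', fun h' => h.trans h'⟩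

lemma mem_K_comm : y ∈ K T x ↔ x ∈ K T y := conn_comm

lemma K_subset_of_closed {C : Set V} (hx : x ∈ C)
    (hC : ∀ a b, a ∈ C → s(a, b) ∈ T → b ∈ C) : K T x ⊆ C := by
  intro y hy
  induction hy with
  | refl => exact hx
  | tail _ hbc ih => exact hC _ _ ih hbc

lemma K_finite (hT : T.Finite) : (K T x).Finite := by
  have hfin : (⋃ e ∈ T, {v | v ∈ e}).Finite := hT.biUnion fun e _ => by
    induction e with
    | h a b => exact (Set.toFinite {a, b}).subset fun v hv => by simpa using hv
  refine (hfin.insert x).subset (K_subset_of_closed (by simp) fun a b _ hab => ?_)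
  exact Or.inr (Set.mem_biUnion hab (Sym2.mem_mk_right a b))

lemma Cl_singleton : Cl T {x} = K T x := by simp [Cl, K]

lemma subset_Cl {S : Set V} : S ⊆ Cl T S := fun x hx => ⟨x, hx, .refl⟩

lemma Cl_eq_biUnion {S : Set V} : Cl T S = ⋃ x ∈ S, K T x := by
  ext; simp [Cl, K]

lemma Cl_finite {S : Set V} (hS : S.Finite) (hT : T.Finite) : (Cl T S).Finite := by
  rw [Cl_eq_biUnion]
  exact hS.biUnion fun _ _ => K_finite hT

lemma Cl_subset_of_closed {S C : Set V} (hS : S ⊆ C)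
    (hC : ∀ a b, a ∈ C → s(a, b) ∈ T → b ∈ C) : Cl T S ⊆ C := by
  rintro y ⟨x, hx, hy⟩
  exact K_subset_of_closed (hS hx) hC hy

lemma Cl_closed {S : Set V} {a b : V} (ha : a ∈ Cl T S) (hab : s(a, b) ∈ T) : b ∈ Cl T S := by
  obtain ⟨x, hx, h⟩ := ha
  exact ⟨x, hx, h.trans (.edge hab)⟩

/-- Opening an edge from `S` to `y` amounts to adding `y` to `S`. -/
lemma Cl_insert {S : Set V} (hx : x ∈ S) :
    Cl (insert s(x, y) T) S = Cl T (insert y S) := by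
  apply subset_antisymm
  · refine Cl_subset_of_closed ((Set.subset_insert y S).trans subset_Cl) ?_
    rintro a b ha (h | h)
    · rcases Sym2.eq_iff.1 h with ⟨rfl, rfl⟩ | ⟨rfl, rfl⟩
      · exact subset_Cl (Set.mem_insert _ _)
      · exact subset_Cl (Set.mem_insert_of_mem _ hx)
    · exact Cl_closed ha h
  · refine Cl_subset_of_closed (Set.insert_subset ?_ subset_Cl) ?_
    · exact ⟨x, hx, .edge (Set.mem_insert _ _)⟩
    · exact fun a b ha h => Cl_closed ha (Set.mem_insert_of_mem _ h)

lemma K_insert : K (insert s(x, y) T) x = K T x ∪ K T y := by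
  rw [← Cl_singleton, Cl_insert (Set.mem_singleton x), Cl_eq_biUnion]
  simp [Set.union_comm]

/-- A path from `C` to its complement leaves `C` for the last time through an open edge, after
which it uses no edge touching `C`. -/
lemma Conn.exists_last_exit {C : Set V} (h : Conn T x z) (hx : x ∈ C) (hz : z ∉ C) :
    ∃ a ∈ C, ∃ b ∉ C, s(a, b) ∈ T ∧ Conn {e ∈ T | ¬ Touches C e} b z := by
  have key : (x ∉ C ∧ Conn {e ∈ T | ¬ Touches C e} x z) ∨
      ∃ a ∈ C, ∃ b ∉ C, s(a, b) ∈ T ∧ Conn {e ∈ T | ¬ Touches C e} b z := by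
    clear hx
    induction h using Relation.ReflTransGen.head_induction_on with
    | refl => exact Or.inl ⟨hz, .refl⟩
    | @head u v huv _ ih =>
      rcases ih with ⟨hv, h⟩ | h
      · by_cases hu : u ∈ C
        · exact Or.inr ⟨u, hu, v, hv, huv, h⟩
        · refine Or.inl ⟨hu, .head ⟨huv, ?_⟩ h⟩
          rintro ⟨w, hw, hwe⟩
          rcases Sym2.mem_iff.1 hwe with rfl | rfl
          · exact hu hw
          · exact hv hw
      · exact Or.inr h
  rcases key with h | h
  · exact absurd hx h.1
  · exact h

/-! ### Splitting a large cluster into two disjoint pieces -/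

lemma K_filter_touches {C : Set V} (hC : K T x = C) : K {e ∈ T | Touches C e} x = C := by
  apply subset_antisymm
  · rw [← hC]
    exact K_mono fun e he => he.1
  · refine hC.ge.trans (K_subset_of_closed mem_K_self fun a b ha hab => ?_)
    have haC : a ∈ C := hC ▸ K_mono (fun e he => he.1) ha
    exact Conn.trans ha (.edge ⟨hab, a, haC, Sym2.mem_mk_left a b⟩)

/-- A cluster of `o` containing at least `3m` points of `L` splits into two edge-disjoint pieces,
each with `m` points of `L`, the first of which still contains `o`. The second piece is cut out as a
minimal cluster hanging off the cluster of `o`. -/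
lemma disjOcc_of_three_mul_le {L : Set V} {m : ℕ} {T : Finset (Sym2 V)} (hm : 1 ≤ m)
    (h : 3 * m ≤ (K (T : Set (Sym2 V)) o ∩ L).ncard) :
    DisjOcc (fun I : Finset (Sym2 V) => m ≤ (K (I : Set (Sym2 V)) o ∩ L).ncard)
      (fun J => ∃ v, m ≤ (K (J : Set (Sym2 V)) v ∩ L).ncard) T := by
  have hfin : ∀ (T : Finset (Sym2 V)) (v : V), (K (T : Set (Sym2 V)) v ∩ L).Finite :=
    fun T v => (K_finite T.finite_toSet).inter_of_left L
  -- descend on the second piece, keeping it attached to the first one at `v`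
  have key : ∀ (n : ℕ) (T₁ T₂ : Finset (Sym2 V)) (v : V), T₂.card = n → T₁ ⊆ T → T₂ ⊆ T →
      Disjoint T₁ T₂ → v ∈ K (T₁ : Set (Sym2 V)) o →
      K (T : Set (Sym2 V)) o ∩ L ⊆ (K (T₁ : Set (Sym2 V)) o ∩ L) ∪ (K (T₂ : Set (Sym2 V)) v ∩ L) →
      m ≤ (K (T₂ : Set (Sym2 V)) v ∩ L).ncard →
      DisjOcc (fun I : Finset (Sym2 V) => m ≤ (K (I : Set (Sym2 V)) o ∩ L).ncard)
        (fun J => ∃ v, m ≤ (K (J : Set (Sym2 V)) v ∩ L).ncard) T := by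
    intro n
    induction n using Nat.strong_induction_on with
    | _ n ih =>
    intro T₁ T₂ v hn h1 h2 hd hv hcov hmT
    by_cases hbig : m ≤ (K (T₁ : Set (Sym2 V)) o ∩ L).ncard
    · exact ⟨T₁, h1, T₂, h2, hd, hbig, v, hmT⟩
    have hcard : 2 * m < (K (T₂ : Set (Sym2 V)) v ∩ L).ncard := by
      have e1 := Set.ncard_le_ncard hcov ((hfin _ _).union (hfin _ _))
      have e2 := Set.ncard_union_le (K (T₁ : Set (Sym2 V)) o ∩ L) (K (T₂ : Set (Sym2 V)) v ∩ L)
      omega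
    obtain ⟨u, hu⟩ : ∃ u, s(v, u) ∈ T₂ := by
      by_contra hno
      push Not at hno
      have : K (T₂ : Set (Sym2 V)) v ⊆ {v} :=
        K_subset_of_closed (Set.mem_singleton v) fun a b ha hab => by
          obtain rfl : a = v := ha
          exact absurd hab (hno b)
      have := Set.ncard_le_ncard (Set.inter_subset_left.trans this : K (T₂ : Set (Sym2 V)) v ∩ L ⊆ {v})
      rw [Set.ncard_singleton] at this
      omega
    set e := s(v, u) with he
    set T₃ := T₂.erase e with hT₃
    have hT₂ : (T₂ : Set (Sym2 V)) = insert s(v, u) (T₃ : Set (Sym2 V)) := by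
      rw [← Finset.coe_insert, hT₃, Finset.insert_erase hu]
    have hT₃₂ : T₃ ⊆ T₂ := Finset.erase_subset _ _
    have hK : K (T₂ : Set (Sym2 V)) v = K (T₃ : Set (Sym2 V)) v ∪ K (T₃ : Set (Sym2 V)) u := by
      rw [hT₂, K_insert]
    have hlt : ∀ S ⊆ T₃, S.card < n := fun S hS =>
      (Finset.card_le_card hS).trans_lt (hn ▸ Finset.card_erase_lt_of_mem hu)
    by_cases hvu : u ∈ K (T₃ : Set (Sym2 V)) v
    · rw [← K_eq hvu, Set.union_self] at hK
      refine ih _ (hlt T₃ subset_rfl) T₁ T₃ v rfl h1 (hT₃₂.trans h2)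
        (Finset.disjoint_of_subset_right hT₃₂ hd) hv (hK ▸ hcov) (hK ▸ hmT)
    -- `v u` is a bridge of the second piece; one of its two sides has at least `m` points of `L`
    set A := K (T₃ : Set (Sym2 V)) v with hA
    set B := K (T₃ : Set (Sym2 V)) u with hB
    set TA := T₃.filter (Touches A) with hTA
    set TB := T₃.filter (Touches B) with hTB
    have hTA₃ : TA ⊆ T₃ := Finset.filter_subset _ _
    have hTB₃ : TB ⊆ T₃ := Finset.filter_subset _ _
    have hKA : K (TA : Set (Sym2 V)) v = A := by
      have := K_filter_touches (T := (T₃ : Set (Sym2 V))) (x := v) hA.symm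
      rw [← this, hTA, Finset.coe_filter]
      rfl
    have hKB : K (TB : Set (Sym2 V)) u = B := by
      have := K_filter_touches (T := (T₃ : Set (Sym2 V))) (x := u) hB.symm
      rw [← this, hTB, Finset.coe_filter]
      rfl
    have hdAB : Disjoint TA TB := by
      rw [Finset.disjoint_left]
      intro f hfA hfB
      obtain ⟨hf, a, ha, haf⟩ := Finset.mem_filter.1 hfA
      obtain ⟨-, b, hb, hbf⟩ := Finset.mem_filter.1 hfB
      apply hvu
      have hab : Conn (T₃ : Set (Sym2 V)) a b := by
        rcases eq_or_ne a b with rfl | hab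
        · exact .refl
        · rw [(Sym2.mem_and_mem_iff hab).1 ⟨haf, hbf⟩] at hf
          exact .edge hf
      exact (Conn.trans ha hab).trans (Conn.symm hb)
    have heT₃ : e ∉ T₃ := Finset.notMem_erase _ _
    -- moving everything but `TN` from the second piece to the first
    have move : ∀ (TN : Finset (Sym2 V)) (w : V) (TO : Finset (Sym2 V)) (w' : V), TN ⊆ T₃ →
        TO ⊆ T₃ → Disjoint TO TN → w ∈ ({v, u} : Set V) → w' ∈ ({v, u} : Set V) →
        K (T₂ : Set (Sym2 V)) v = K (TN : Set (Sym2 V)) w ∪ K (TO : Set (Sym2 V)) w' →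
        m ≤ (K (TN : Set (Sym2 V)) w ∩ L).ncard →
        DisjOcc (fun I : Finset (Sym2 V) => m ≤ (K (I : Set (Sym2 V)) o ∩ L).ncard)
          (fun J => ∃ v, m ≤ (K (J : Set (Sym2 V)) v ∩ L).ncard) T := by
      intro TN w TO w' hTN hTO hdd hw hw' hKu hmN
      have h1' : T₁ ⊆ T₁ ∪ insert e TO := Finset.subset_union_left
      have hmem : ∀ a ∈ ({v, u} : Set V), a ∈ K ((T₁ ∪ insert e TO : Finset _) : Set (Sym2 V)) o := by
        rintro a (rfl | rfl)
        · exact K_mono (Finset.coe_subset.2 h1') hv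
        · refine Conn.trans (K_mono (Finset.coe_subset.2 h1') hv) (.edge ?_)
          simp [he]
      refine ih _ (hlt TN hTN) (T₁ ∪ insert e TO) TN w rfl ?_ (hTN.trans (hT₃₂.trans h2)) ?_
        (hmem w hw) ?_ hmN
      · exact Finset.union_subset h1 (Finset.insert_subset (h2 hu) (hTO.trans (hT₃₂.trans h2)))
      · rw [Finset.disjoint_union_left, Finset.disjoint_insert_left]
        exact ⟨Finset.disjoint_of_subset_right (hTN.trans hT₃₂) hd, fun h => heT₃ (hTN h), hdd⟩
      · intro z hz
        rcases hcov hz with hz' | hz'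
        · exact Or.inl ⟨K_mono (Finset.coe_subset.2 h1') hz'.1, hz'.2⟩
        · rw [hKu] at hz'
          rcases hz'.1 with hz'' | hz''
          · exact Or.inr ⟨hz'', hz'.2⟩
          · refine Or.inl ⟨Conn.trans (hmem w' hw') (Conn.mono ?_ hz''), hz'.2⟩
            exact Finset.coe_subset.2 ((Finset.subset_insert _ _).trans Finset.subset_union_right)
    by_cases hBm : m ≤ (B ∩ L).ncard
    · exact move TB u TA v hTB₃ hTA₃ hdAB (by simp) (by simp)
        (by rw [hKA, hKB, hK, Set.union_comm]) (by rwa [hKB])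
    · refine move TA v TB u hTA₃ hTB₃ hdAB.symm (by simp) (by simp) (by rw [hKA, hKB, hK]) ?_
      rw [hKA]
      have := Set.ncard_union_le (A ∩ L) (B ∩ L)
      rw [← Set.union_inter_distrib_right, ← hK] at this
      omega
  refine key _ ∅ T o rfl (Finset.empty_subset _) subset_rfl (Finset.disjoint_empty_left _) mem_K_self
    Set.subset_union_right (by omega)

variable {F : Finset (Sym2 V)} {p : Sym2 V → ℝ}

lemma ncard_K_mono {S T : Finset (Sym2 V)} (h : S ⊆ T) (v : V) (L : Set V) :
    (K (S : Set (Sym2 V)) v ∩ L).ncard ≤ (K (T : Set (Sym2 V)) v ∩ L).ncard :=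
  Set.ncard_le_ncard (Set.inter_subset_inter_left _ (K_mono (Finset.coe_subset.2 h)))
    ((K_finite T.finite_toSet).inter_of_left L)

/-- Tail of the number of points of `L` in a cluster, in terms of the largest such number. -/
lemma Pr_three_mul_le (hp : ∀ e ∈ F, 0 ≤ p e ∧ p e ≤ 1) (L : Set V) {m : ℕ} (hm : 1 ≤ m) (o : V) :
    Pr F p (fun T => 3 * m ≤ (K (T : Set (Sym2 V)) o ∩ L).ncard) ≤
      Pr F p (fun T => m ≤ (K (T : Set (Sym2 V)) o ∩ L).ncard) *
        Pr F p (fun T => ∃ v, m ≤ (K (T : Set (Sym2 V)) v ∩ L).ncard) := by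
  refine (Pr_mono hp fun T _ h => disjOcc_of_three_mul_le hm h).trans (Pr_disjOcc_le hp ?_ ?_)
  · exact fun S T h h' => h'.trans (ncard_K_mono h o L)
  · rintro S T h ⟨v, h'⟩
    exact ⟨v, h'.trans (ncard_K_mono h v L)⟩

/-- Markov's inequality for the number of points of `L` in large clusters. -/
lemma mul_Pr_exists_le (hp : ∀ e ∈ F, 0 ≤ p e ∧ p e ≤ 1) (L : Finset V) {m : ℕ} :
    m * Pr F p (fun T => ∃ v, m ≤ (K (T : Set (Sym2 V)) v ∩ L).ncard) ≤
      ∑ x ∈ L, Pr F p (fun T => m ≤ (K (T : Set (Sym2 V)) x).ncard) := by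
  unfold Pr
  rw [← Ex_const_mul, ← Ex_sum]
  refine Ex_mono hp fun T _ => ?_
  split_ifs with h
  · obtain ⟨v, hv⟩ := h
    rw [mul_one]
    have : K (T : Set (Sym2 V)) v ∩ L ⊆
        (L.filter fun x => m ≤ (K (T : Set (Sym2 V)) x).ncard : Finset V) := by
      rintro x ⟨hx, hxL⟩
      rw [Finset.coe_filter]
      refine ⟨hxL, ?_⟩
      rw [← K_eq hx]
      exact hv.trans (Set.ncard_le_ncard Set.inter_subset_left (K_finite T.finite_toSet))
    have := Set.ncard_le_ncard this
    rw [Set.ncard_coe_finset] at this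
    have h := hv.trans this
    calc (m : ℝ) ≤ ((L.filter fun x => m ≤ (K (T : Set (Sym2 V)) x).ncard).card : ℝ) := by
          exact_mod_cast h
      _ = ∑ x ∈ L with m ≤ (K (T : Set (Sym2 V)) x).ncard, (1 : ℝ) := by simp
      _ ≤ ∑ x ∈ L with m ≤ (K (T : Set (Sym2 V)) x).ncard, _ :=
          Finset.sum_le_sum fun x hx => by rw [if_pos (Finset.mem_filter.1 hx).2]
      _ ≤ _ := Finset.sum_le_sum_of_subset_of_nonneg (Finset.filter_subset _ _)
          fun x _ _ => by split_ifs <;> norm_num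
  · rw [mul_zero]
    exact Finset.sum_nonneg fun x _ => by split_ifs <;> norm_num

end Clusters

/-! ### The fluctuation of a cluster -/

section Fluctuation

open scoped Classical

variable {V : Type*} {F : Finset (Sym2 V)} {p u w : Sym2 V → ℝ}

/-- The fluctuation of the vertex set `C`: the edges of `F` touching `C` are counted with weight
`u e` if closed and `-w e` if open. -/
noncomputable def Fluct (F : Finset (Sym2 V)) (u w : Sym2 V → ℝ) (T : Finset (Sym2 V))
    (C : Set V) : ℝ :=
  ∑ e ∈ F, if Touches C e then (if e ∈ T then -w e else u e) else 0

lemma sum_touches_insert_le {var : Sym2 V → ℝ} (hvar : ∀ e, 0 ≤ var e) (S : Set V) (y : V) :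
    ∑ e ∈ F with Touches (insert y S) e, var e ≤
      ∑ e ∈ F with Touches S e, var e + ∑ e ∈ F with y ∈ e, var e := by
  rw [Finset.sum_filter, Finset.sum_filter, Finset.sum_filter, ← Finset.sum_add_distrib]
  refine Finset.sum_le_sum fun e _ => ?_
  have := hvar e
  have h : Touches (insert y S) e → Touches S e ∨ y ∈ e := by
    rintro ⟨x, rfl | hx, hxe⟩
    · exact Or.inr hxe
    · exact Or.inl ⟨x, hx, hxe⟩
  split_ifs <;> first | linarith | tauto

/-- Second moment of the fluctuation of the cluster of `S`, started from the value `z` after the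
variance `r` has been used up. Revealing one edge touching the current cluster at a time makes the
fluctuation a martingale; each vertex of the cluster contributes at most `D` to its variance, and
because `g` is decreasing this contribution carries at most the weight of the vertex. -/
lemma Ex_sq_Cl_le {D : ℝ} {g : ℕ → ℝ} (hp : ∀ e ∈ F, 0 ≤ p e ∧ p e ≤ 1)
    (hmean : ∀ e, (1 - p e) * u e = p e * w e)
    (hvar : ∀ e, 0 ≤ (1 - p e) * u e ^ 2 + p e * w e ^ 2)
    (hD : ∀ x, ∑ e ∈ F with x ∈ e, ((1 - p e) * u e ^ 2 + p e * w e ^ 2) ≤ D)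
    (hg : Antitone g) (hg0 : ∀ n, 0 ≤ g n) (S : Finset V) (z r : ℝ)
    (hr : r + ∑ e ∈ F with Touches (S : Set V) e, ((1 - p e) * u e ^ 2 + p e * w e ^ 2)
      ≤ D * S.card) :
    Ex F p (fun T => (z + Fluct F u w T (Cl (T : Set (Sym2 V)) S)) ^ 2
        * g (Cl (T : Set (Sym2 V)) (S : Set V)).ncard) ≤
      g S.card * z ^ 2
        + D * Ex F p (fun T => ∑ j ∈ Finset.Ioc S.card (Cl (T : Set (Sym2 V)) (S : Set V)).ncard, g j)
        + g S.card * (D * S.card - r) := by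
  induction hn : F.card generalizing F S z r with
  | zero =>
    obtain rfl : F = ∅ := Finset.card_eq_zero.1 hn
    have hCl : Cl ((∅ : Finset (Sym2 V)) : Set (Sym2 V)) (S : Set V) = S :=
      subset_antisymm (Cl_subset_of_closed subset_rfl fun a b _ h => by simp at h) subset_Cl
    simp only [Ex_empty, hCl, Set.ncard_coe_finset, Fluct, Finset.sum_empty, Finset.Ioc_self]
    simp only [Finset.filter_empty, Finset.sum_empty] at hr
    nlinarith [mul_nonneg (hg0 S.card) (sub_nonneg.2 hr)]
  | succ n ih =>
    set var : Sym2 V → ℝ := fun e => (1 - p e) * u e ^ 2 + p e * w e ^ 2 with hvardef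
    by_cases htouch : ∃ e ∈ F, Touches (S : Set V) e
    swap
    · push Not at htouch
      have hCl : ∀ T ⊆ F, Cl (T : Set (Sym2 V)) (S : Set V) = S := fun T hT =>
        subset_antisymm (Cl_subset_of_closed subset_rfl fun a b ha h =>
          absurd ⟨a, ha, Sym2.mem_mk_left a b⟩ (htouch _ (hT h))) subset_Cl
      have hZ : ∀ T, Fluct F u w T (S : Set V) = 0 := fun T =>
        Finset.sum_eq_zero fun e he => if_neg (htouch e he)
      rw [Ex_congr (g := fun _ => z ^ 2 * g S.card), Ex_congr (f := fun T : Finset (Sym2 V) =>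
        ∑ j ∈ Finset.Ioc S.card (Cl (T : Set (Sym2 V)) (S : Set V)).ncard, g j) (g := fun _ => 0)]
      · rw [Ex_const, Ex_const]
        have : 0 ≤ ∑ e ∈ F with Touches (S : Set V) e, var e := Finset.sum_nonneg fun e _ => hvar e
        nlinarith [mul_nonneg (hg0 S.card) (sub_nonneg.2 hr), mul_nonneg (hg0 S.card) this]
      · intro T hT
        simp [hCl T hT]
      · intro T hT
        simp [hCl T hT, hZ]
    obtain ⟨e, heF, x, hxS, hxe⟩ := htouch
    obtain ⟨y, rfl⟩ := Sym2.mem_iff_exists.1 hxe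
    set e := s(x, y) with he
    set F' := F.erase e with hF'
    have hF'F : F' ⊆ F := Finset.erase_subset _ _
    have hcard : F'.card = n := by rw [hF', Finset.card_erase_of_mem heF, hn]; rfl
    have hp' : ∀ e ∈ F', 0 ≤ p e ∧ p e ≤ 1 := fun f hf => hp f (hF'F hf)
    have hD' : ∀ x, ∑ e ∈ F' with x ∈ e, var e ≤ D := fun x =>
      (Finset.sum_le_sum_of_subset_of_nonneg (Finset.filter_subset_filter _ hF'F)
        fun f _ _ => hvar f).trans (hD x)
    have heS : Touches (S : Set V) e := ⟨x, hxS, Sym2.mem_mk_left x y⟩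
    have hsplit : ∑ f ∈ F with Touches (S : Set V) f, var f =
        var e + ∑ f ∈ F' with Touches (S : Set V) f, var f := by
      rw [Finset.sum_filter, Finset.sum_filter, ← Finset.add_sum_erase F _ heF, if_pos heS]
    have hZsplit : ∀ T C, e ∉ T → Touches C e →
        Fluct F u w T C = u e + Fluct F' u w T C := by
      intro T C heT hC
      rw [Fluct, ← Finset.add_sum_erase F _ heF, if_pos hC, if_neg heT, Fluct]
    have hZsplit' : ∀ T C, Touches C e →
        Fluct F u w (insert e T) C = -w e + Fluct F' u w T C := by
      intro T C hC
      rw [Fluct, ← Finset.add_sum_erase F _ heF, if_pos hC, if_pos (Finset.mem_insert_self _ _),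
        Fluct]
      congr 1
      refine Finset.sum_congr rfl fun f hf => ?_
      have : f ≠ e := Finset.ne_of_mem_erase hf
      simp [this]
    have hTe : ∀ T ⊆ F', e ∉ T := fun T hT h => Finset.notMem_erase e F (hT h)
    have htCl : ∀ (T : Finset (Sym2 V)), Touches (Cl (T : Set (Sym2 V)) (S : Set V)) e := fun T =>
      ⟨x, subset_Cl hxS, Sym2.mem_mk_left x y⟩
    have hCl : ∀ (T : Finset (Sym2 V)), Cl ((insert e T : Finset (Sym2 V)) : Set (Sym2 V)) (S : Set V)
        = Cl (T : Set (Sym2 V)) ((insert y S : Finset V) : Set V) := by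
      intro T
      rw [Finset.coe_insert, Finset.coe_insert, he, Cl_insert (by exact hxS)]
    have ih0 := ih hp' hD' S (z + u e) (r + var e) (by rw [hsplit] at hr; linarith) hcard
    obtain ⟨hp0, hp1⟩ := hp e heF
    have hq0 : 0 ≤ 1 - p e := by linarith
    have hm := hmean e
    -- the bound after opening `e`, expressed through the quantities for `S`
    have ih1 : Ex F' p (fun T => (z - w e + Fluct F' u w T
          (Cl (T : Set (Sym2 V)) ((insert y S : Finset V) : Set V))) ^ 2
        * g (Cl (T : Set (Sym2 V)) ((insert y S : Finset V) : Set V)).ncard) ≤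
      g S.card * (z - w e) ^ 2
        + D * Ex F' p (fun T => ∑ j ∈ Finset.Ioc S.card
            (Cl (T : Set (Sym2 V)) ((insert y S : Finset V) : Set V)).ncard, g j)
        + g S.card * (D * S.card - (r + var e)) := by
      by_cases hy : y ∈ S
      · rw [Finset.insert_eq_of_mem hy]
        exact ih hp' hD' S (z - w e) (r + var e) (by rw [hsplit] at hr; linarith) hcard
      have hcS : (insert y S).card = S.card + 1 := Finset.card_insert_of_notMem hy
      have hr' : r + var e + ∑ f ∈ F' with Touches ((insert y S : Finset V) : Set V) f, var f
          ≤ D * (insert y S).card := by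
        have h1 := sum_touches_insert_le (F := F') hvar (S : Set V) y
        have h2 := hD' y
        rw [hsplit] at hr
        rw [hcS, Finset.coe_insert]
        push_cast
        linarith
      have h1 := ih hp' hD' (insert y S) (z - w e) (r + var e) hr' hcard
      refine h1.trans ?_
      have hsum : ∀ T ⊆ F', ∑ j ∈ Finset.Ioc S.card
            (Cl (T : Set (Sym2 V)) ((insert y S : Finset V) : Set V)).ncard, g j =
          g (S.card + 1) + ∑ j ∈ Finset.Ioc (insert y S).card
            (Cl (T : Set (Sym2 V)) ((insert y S : Finset V) : Set V)).ncard, g j := by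
        intro T _
        have hle : S.card + 1 ≤ (Cl (T : Set (Sym2 V)) ((insert y S : Finset V) : Set V)).ncard := by
          rw [← hcS, ← Set.ncard_coe_finset]
          exact Set.ncard_le_ncard subset_Cl (Cl_finite (Finset.finite_toSet _) T.finite_toSet)
        rw [hcS]
        exact (Finset.sum_Ioc_consecutive g (Nat.le_succ _) hle).symm.trans (by
          rw [Nat.Ioc_succ_singleton, Finset.sum_singleton])
      rw [Ex_congr hsum, Ex_add, Ex_const, hcS]
      have hgS : g (S.card + 1) ≤ g S.card := hg (Nat.le_succ _)
      have hrest : 0 ≤ D * S.card - (r + var e) := by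
        rw [hsplit] at hr
        have : 0 ≤ ∑ f ∈ F' with Touches (S : Set V) f, var f := Finset.sum_nonneg fun f _ => hvar f
        linarith
      push_cast
      nlinarith [mul_nonneg (sub_nonneg.2 hgS) hrest, mul_nonneg (sub_nonneg.2 hgS) (sq_nonneg (z - w e))]
    rw [Ex_erase heF, Ex_erase heF]
    have e0 : Ex F' p (fun T => (z + Fluct F u w T (Cl (T : Set (Sym2 V)) S)) ^ 2
        * g (Cl (T : Set (Sym2 V)) (S : Set V)).ncard) =
      Ex F' p (fun T => (z + u e + Fluct F' u w T (Cl (T : Set (Sym2 V)) S)) ^ 2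
        * g (Cl (T : Set (Sym2 V)) (S : Set V)).ncard) :=
      Ex_congr fun T hT => by rw [hZsplit T _ (hTe T hT) (htCl T), add_assoc]
    have e1 : Ex F' p (fun T => (z + Fluct F u w (insert e T)
          (Cl ((insert e T : Finset (Sym2 V)) : Set (Sym2 V)) S)) ^ 2
        * g (Cl ((insert e T : Finset (Sym2 V)) : Set (Sym2 V)) (S : Set V)).ncard) =
      Ex F' p (fun T => (z - w e + Fluct F' u w T
          (Cl (T : Set (Sym2 V)) ((insert y S : Finset V) : Set V))) ^ 2
        * g (Cl (T : Set (Sym2 V)) ((insert y S : Finset V) : Set V)).ncard) :=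
      Ex_congr fun T hT => by
        rw [hZsplit' T _ (htCl _), hCl, ← add_assoc, sub_eq_add_neg]
    simp only [hF'] at e0 e1 ih0 ih1
    rw [e0, e1]
    simp only [hCl]
    have h0 := mul_le_mul_of_nonneg_left ih0 hq0
    have h1 := mul_le_mul_of_nonneg_left ih1 hp0
    refine (add_le_add h0 h1).trans (le_of_eq ?_)
    have hv : var e = (1 - p e) * u e ^ 2 + p e * w e ^ 2 := rfl
    have hm2 : p e * w e = (1 - p e) * u e := hm.symm
    linear_combination (g S.card) * (-1) * hv + 2 * z * g S.card * hm

variable {o : V}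

/-- Second moment bound for the fluctuation of the cluster of `o`. -/
lemma Ex_sq_K_le {D : ℝ} {g : ℕ → ℝ} (hp : ∀ e ∈ F, 0 ≤ p e ∧ p e ≤ 1)
    (hmean : ∀ e, (1 - p e) * u e = p e * w e)
    (hvar : ∀ e, 0 ≤ (1 - p e) * u e ^ 2 + p e * w e ^ 2)
    (hD : ∀ x, ∑ e ∈ F with x ∈ e, ((1 - p e) * u e ^ 2 + p e * w e ^ 2) ≤ D)
    (hg : Antitone g) (hg0 : ∀ n, 0 ≤ g n) (o : V) :
    Ex F p (fun T => Fluct F u w T (K (T : Set (Sym2 V)) o) ^ 2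
        * g (K (T : Set (Sym2 V)) o).ncard) ≤
      D * Ex F p (fun T => ∑ j ∈ Finset.Icc 1 (K (T : Set (Sym2 V)) o).ncard, g j) := by
  have h := Ex_sq_Cl_le hp hmean hvar hD hg hg0 {o} 0 0 (by
    have := hD o
    simpa [Touches] using this)
  simp only [Finset.coe_singleton, Cl_singleton, Finset.card_singleton, zero_add] at h
  refine h.trans (le_of_eq ?_)
  have : ∀ T ⊆ F, ∑ j ∈ Finset.Icc 1 (K (T : Set (Sym2 V)) o).ncard, g j =
      g 1 + ∑ j ∈ Finset.Ioc 1 (K (T : Set (Sym2 V)) o).ncard, g j := by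
    intro T _
    have hle : 1 ≤ (K (T : Set (Sym2 V)) o).ncard :=
      (Set.ncard_pos (K_finite T.finite_toSet)).2 ⟨o, mem_K_self⟩
    rw [← Finset.add_sum_Ioc_eq_sum_Icc hle]
  rw [Ex_congr this, Ex_add, Ex_const]
  push_cast
  ring

/-- First moment bound for the fluctuation, weighted by a decreasing function `ψ` of the size of
the cluster. By the inequality of arithmetic and geometric means, `ψ |Z|` is controlled by `g Z ^
2` with `g k = ψ k / √k`, and `k * g k ≤ ∑ j ≤ k, g j`. -/
lemma Ex_abs_K_le {D : ℝ} {ψ : ℕ → ℝ} (hp : ∀ e ∈ F, 0 ≤ p e ∧ p e ≤ 1)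
    (hmean : ∀ e, (1 - p e) * u e = p e * w e)
    (hvar : ∀ e, 0 ≤ (1 - p e) * u e ^ 2 + p e * w e ^ 2) (hD0 : 0 < D)
    (hD : ∀ x, ∑ e ∈ F with x ∈ e, ((1 - p e) * u e ^ 2 + p e * w e ^ 2) ≤ D)
    (hψ : Antitone ψ) (hψ0 : ∀ n, 0 ≤ ψ n) (o : V) :
    Ex F p (fun T => ψ (K (T : Set (Sym2 V)) o).ncard * |Fluct F u w T (K (T : Set (Sym2 V)) o)|) ≤
      √D * Ex F p (fun T => ∑ j ∈ Finset.Icc 1 (K (T : Set (Sym2 V)) o).ncard, ψ j / √j) := by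
  set g : ℕ → ℝ := fun k => ψ (max k 1) / √(max k 1 : ℕ) with hg
  have hganti : Antitone g := by
    intro a b hab
    have h1 : max a 1 ≤ max b 1 := max_le_max_right 1 hab
    have h2 : (0 : ℝ) < (max a 1 : ℕ) := by
      have : 1 ≤ max a 1 := le_max_right _ _
      exact_mod_cast this
    exact div_le_div₀ (hψ0 _) (hψ h1) (Real.sqrt_pos.2 h2)
      (Real.sqrt_le_sqrt (by exact_mod_cast h1))
  have hg0 : ∀ n, 0 ≤ g n := fun n => div_nonneg (hψ0 _) (Real.sqrt_nonneg _)
  have hgeq : ∀ k : ℕ, ∑ j ∈ Finset.Icc 1 k, ψ j / √j = ∑ j ∈ Finset.Icc 1 k, g j := fun k =>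
    Finset.sum_congr rfl fun j hj => by
      simp only [hg, max_eq_left (Finset.mem_Icc.1 hj).1]
  have hsq := Ex_sq_K_le hp hmean hvar hD hganti hg0 o
  simp only [hgeq]
  have hsD : 0 < √D := Real.sqrt_pos.2 hD0
  have hDD : √D * √D = D := Real.mul_self_sqrt hD0.le
  have hpt : ∀ T ⊆ F, ψ (K (T : Set (Sym2 V)) o).ncard * |Fluct F u w T (K (T : Set (Sym2 V)) o)| ≤
      (1 / (2 * √D)) * (Fluct F u w T (K (T : Set (Sym2 V)) o) ^ 2
        * g (K (T : Set (Sym2 V)) o).ncard)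
      + (√D / 2) * ∑ j ∈ Finset.Icc 1 (K (T : Set (Sym2 V)) o).ncard, g j := by
    intro T _
    set k := (K (T : Set (Sym2 V)) o).ncard with hk
    set Z := Fluct F u w T (K (T : Set (Sym2 V)) o)
    have hk1 : 1 ≤ k := (Set.ncard_pos (K_finite T.finite_toSet)).2 ⟨o, mem_K_self⟩
    have hk0 : (0 : ℝ) < k := by exact_mod_cast hk1
    have hsk : 0 < √(k : ℝ) := Real.sqrt_pos.2 hk0
    have hkk : √(k : ℝ) * √(k : ℝ) = k := Real.mul_self_sqrt hk0.le
    have hgk : g k = ψ k / √k := by simp only [hg, max_eq_left hk1]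
    have hψk : ψ k = g k * √k := by rw [hgk]; field_simp
    have hsum : k * g k ≤ ∑ j ∈ Finset.Icc 1 k, g j := by
      have := Finset.card_nsmul_le_sum (Finset.Icc 1 k) g (g k)
        fun j hj => hganti (Finset.mem_Icc.1 hj).2
      simpa using this
    have h1 : (√D / 2) * (k * g k) ≤ (√D / 2) * ∑ j ∈ Finset.Icc 1 k, g j :=
      mul_le_mul_of_nonneg_left hsum (by positivity)
    refine le_trans ?_ (add_le_add_right h1 _)
    rw [hψk]
    have h2 : √k * |Z| ≤ 1 / (2 * √D) * Z ^ 2 + √D / 2 * k := by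
      rw [div_mul_eq_mul_div, div_mul_eq_mul_div, div_add_div _ _ (by positivity) two_ne_zero,
        le_div_iff₀ (by positivity), ← sq_abs Z]
      have : 0 ≤ (|Z| - √D * √k) ^ 2 := sq_nonneg _
      nlinarith
    nlinarith [mul_le_mul_of_nonneg_left h2 (hg0 k)]
  refine (Ex_mono hp hpt).trans ?_
  rw [Ex_add, Ex_const_mul, Ex_const_mul]
  have h3 := mul_le_mul_of_nonneg_left hsq (by positivity : 0 ≤ 1 / (2 * √D))
  refine (add_le_add_left h3 _).trans (le_of_eq ?_)
  rw [← mul_assoc]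
  have : 1 / (2 * √D) * D = √D / 2 := by
    rw [div_mul_eq_mul_div, div_eq_div_iff (by positivity) two_ne_zero]
    linear_combination (-2) * hDD
  rw [this]
  ring

end Fluctuation

/-! ### Resampling one edge -/

section Resampling

open scoped Classical

variable {V : Type*} {F : Finset (Sym2 V)} {p u w : Sym2 V → ℝ}

/-- The sum of `φ` of the sizes of the distinct clusters touching the edge with endpoints `x, y`. -/
noncomputable def edgeMass (φ : ℕ → ℝ) (T : Set (Sym2 V)) (x y : V) : ℝ :=
  φ (K T x).ncard + if y ∈ K T x then 0 else φ (K T y).ncard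

/-- Opening the edge `x y` merges two large clusters if they were distinct, and then lowers
`edgeMass φ` by at least `1`; the closed state thus outweighs the open one. -/
lemma mul_Pr_le_Ex_edgeMass {x y : V} {n : ℕ} {φ : ℕ → ℝ} (hp : ∀ e ∈ F, 0 ≤ p e ∧ p e ≤ 1)
    (hmean : ∀ e, (1 - p e) * u e = p e * w e) (hu : ∀ e, 0 ≤ u e)
    (hφ : ∀ a b, φ (a + b) + (if n ≤ a ∧ n ≤ b then 1 else 0) ≤ φ a + φ b)
    (he : s(x, y) ∈ F) :
    u s(x, y) * Pr F p (fun T => y ∉ K (T : Set (Sym2 V)) x ∧ n ≤ (K (T : Set (Sym2 V)) x).ncard ∧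
        n ≤ (K (T : Set (Sym2 V)) y).ncard) ≤
      Ex F p (fun T => (if s(x, y) ∈ T then -w s(x, y) else u s(x, y)) * edgeMass φ T x y) := by
  set e := s(x, y) with he'
  set F' := F.erase e with hF'
  have hTe : ∀ T ⊆ F', e ∉ T := fun T hT h => Finset.notMem_erase e F (hT h)
  have hp' : ∀ e ∈ F', 0 ≤ p e ∧ p e ≤ 1 := fun f hf => hp f (Finset.mem_of_mem_erase hf)
  have h0 : Pr F' p (fun T => y ∉ K ((insert e T : Finset _) : Set (Sym2 V)) x ∧
      n ≤ (K ((insert e T : Finset _) : Set (Sym2 V)) x).ncard ∧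
      n ≤ (K ((insert e T : Finset _) : Set (Sym2 V)) y).ncard) = 0 :=
    Pr_eq_zero fun T _ h => h.1 (Conn.edge (by simp [he']))
  rw [Ex_erase he, Pr_erase he, h0, mul_zero, add_zero]
  rw [Ex_congr (f := fun T : Finset (Sym2 V) => (if e ∈ T then -w e else u e) * _)
    (g := fun T => u e * edgeMass φ T x y) (fun T hT => by rw [if_neg (hTe T hT)]),
    Ex_congr (f := fun T : Finset (Sym2 V) => (if e ∈ insert e T then -w e else u e) * _)
    (g := fun T => -w e * edgeMass φ ((insert e T : Finset _) : Set (Sym2 V)) x y)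
    (fun T hT => by rw [if_pos (Finset.mem_insert_self _ _)]), Ex_const_mul, Ex_const_mul]
  have key : Pr F' p (fun T => y ∉ K (T : Set (Sym2 V)) x ∧ n ≤ (K (T : Set (Sym2 V)) x).ncard ∧
        n ≤ (K (T : Set (Sym2 V)) y).ncard) ≤
      Ex F' p (fun T => edgeMass φ T x y) -
        Ex F' p (fun T => edgeMass φ ((insert e T : Finset _) : Set (Sym2 V)) x y) := by
    rw [← Ex_sub]
    refine Ex_mono hp' fun T hT => ?_
    have h1 : K ((insert e T : Finset _) : Set (Sym2 V)) x = K (T : Set (Sym2 V)) x ∪ K (T : Set (Sym2 V)) y := by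
      rw [Finset.coe_insert, K_insert]
    have h2 : edgeMass φ ((insert e T : Finset _) : Set (Sym2 V)) x y =
        φ (K (T : Set (Sym2 V)) x ∪ K (T : Set (Sym2 V)) y).ncard := by
      rw [edgeMass, if_pos, add_zero, h1]
      rw [h1]
      exact Or.inr mem_K_self
    rw [h2, edgeMass]
    by_cases hy : y ∈ K (T : Set (Sym2 V)) x
    · rw [if_neg (fun h => h.1 hy), if_pos hy, ← K_eq hy, Set.union_self]
      linarith
    · rw [if_neg hy, Set.ncard_union_eq _ (K_finite T.finite_toSet) (K_finite T.finite_toSet)]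
      · have := hφ (K (T : Set (Sym2 V)) x).ncard (K (T : Set (Sym2 V)) y).ncard
        simp only [hy, not_false_eq_true, true_and]
        linarith
      · rw [Set.disjoint_left]
        exact fun z hz hz' => hy (Conn.trans hz (Conn.symm hz'))
  have hm := hmean e
  have h3 := mul_le_mul_of_nonneg_left key (mul_nonneg (sub_nonneg.2 (hp e he).2) (hu e))
  have h4 : p e * (-w e * Ex F' p (fun T => edgeMass φ ((insert e T : Finset _) : Set (Sym2 V)) x y)) =
      -((1 - p e) * u e * Ex F' p (fun T => edgeMass φ ((insert e T : Finset _) : Set (Sym2 V)) x y)) := by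
    rw [hm]; ring
  rw [h4]
  linarith

end Resampling

/-! ### The mean cluster size and the flow out of finite sets -/

section Sharpness

open scoped Classical

variable {V : Type*} {F G : Finset (Sym2 V)} {p : Sym2 V → ℝ} {f g : Finset (Sym2 V) → ℝ}

lemma Ex_inter_eq : Ex F p (fun T => f (T ∩ G)) = Ex (F ∩ G) p f := by
  rw [← Ex_inter (p := p) (f := f) (F' := F) Finset.inter_subset_left]
  refine Ex_congr fun T hT => ?_
  rw [← Finset.inter_assoc, Finset.inter_eq_left.2 hT]

lemma Ex_indep : Ex F p (fun T => f (T ∩ G) * g (T \ G)) =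
    Ex F p (fun T => f (T ∩ G)) * Ex F p (fun T => g (T \ G)) := by
  have hd : Disjoint (F ∩ G) (F \ G) := Finset.disjoint_sdiff_inter F G |>.symm
  have hF : F = F ∩ G ∪ F \ G := by rw [Finset.union_comm, Finset.sdiff_union_inter]
  have hS : ∀ S ⊆ F ∩ G, ∀ T ⊆ F \ G, (S ∪ T) ∩ G = S ∧ (S ∪ T) \ G = T := by
    intro S hS T hT
    constructor
    · ext e
      have h1 := @hS e
      have h2 := @hT e
      simp only [Finset.mem_inter, Finset.mem_union, Finset.mem_sdiff] at *
      tauto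
    · ext e
      have h1 := @hS e
      have h2 := @hT e
      simp only [Finset.mem_inter, Finset.mem_union, Finset.mem_sdiff] at *
      tauto
  have e1 : ∀ h : Finset (Sym2 V) → ℝ, Ex F p h =
      Ex (F ∩ G) p fun S => Ex (F \ G) p fun T => h (S ∪ T) := by
    intro h
    conv_lhs => rw [hF]
    exact Ex_union hd
  rw [e1, e1, e1]
  have a1 : Ex (F ∩ G) p (fun S => Ex (F \ G) p fun T => f ((S ∪ T) ∩ G) * g ((S ∪ T) \ G)) =
      Ex (F ∩ G) p (fun S => f S * Ex (F \ G) p g) :=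
    Ex_congr fun S h => by
      rw [← Ex_const_mul]
      exact Ex_congr fun T h' => by rw [(hS S h T h').1, (hS S h T h').2]
  have a2 : Ex (F ∩ G) p (fun S => Ex (F \ G) p fun T => f ((S ∪ T) ∩ G)) =
      Ex (F ∩ G) p f :=
    Ex_congr fun S h => by
      rw [Ex_congr (g := fun _ => f S) fun T h' => by rw [(hS S h T h').1]]
      simp
  have a3 : Ex (F ∩ G) p (fun S => Ex (F \ G) p fun T => g ((S ∪ T) \ G)) =
      Ex (F \ G) p g := by
    rw [Ex_congr (g := fun _ => Ex (F \ G) p g) fun S h =>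
      Ex_congr fun T h' => by rw [(hS S h T h').2]]
    simp
  rw [a1, a2, a3, Ex_mul_const]

lemma monotone_conn_ite (o x : V) :
    Monotone fun T : Finset (Sym2 V) => if Conn (T : Set (Sym2 V)) o x then (1 : ℝ) else 0 :=
  monotone_ite fun _ _ h h' => h'.mono (Finset.coe_subset.2 h)

/-- The van den Berg–Kesten bound on a connection leaving `S`, decomposed according to the first
edge out of the cluster inside `S`. -/
lemma Pr_conn_le (hp : ∀ e, 0 ≤ p e ∧ p e ≤ 1) {S W : Finset V}
    (hW : ∀ e ∈ F, ∀ v ∈ e, v ∈ W) {o z : V} (ho : o ∈ S) (hz : z ∉ S) :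
    Pr F p (fun T => Conn (T : Set (Sym2 V)) o z) ≤
      ∑ x ∈ S, ∑ y ∈ W \ S, p s(x, y) * Pr S.sym2 p (fun T => Conn (T : Set (Sym2 V)) o x) *
        Pr F p (fun T => Conn (T : Set (Sym2 V)) y z) := by
  set A : V → V → Finset (Sym2 V) → Prop := fun x y I =>
    Conn ((I ∩ S.sym2 : Finset _) : Set (Sym2 V)) o x ∧ s(x, y) ∈ I with hA
  have hAmono : ∀ x y, ∀ I I' : Finset (Sym2 V), I ⊆ I' → A x y I → A x y I' :=
    fun x y I I' h h' => ⟨h'.1.mono (Finset.coe_subset.2 (Finset.inter_subset_inter_right h)), h h'.2⟩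
  have h1 : Pr F p (fun T => Conn (T : Set (Sym2 V)) o z) ≤
      ∑ x ∈ S, ∑ y ∈ W \ S, Pr F p (DisjOcc (A x y) fun J => Conn (J : Set (Sym2 V)) y z) := by
    unfold Pr
    simp only [← Ex_sum]
    refine Ex_mono (fun e _ => hp e) fun T hT => ?_
    split_ifs with h
    swap
    · exact Finset.sum_nonneg fun _ _ => Finset.sum_nonneg fun _ _ => by split_ifs <;> norm_num
    set TS := T ∩ S.sym2 with hTS
    set C := K (TS : Set (Sym2 V)) o with hC
    have hCS : C ⊆ (S : Set V) := K_subset_of_closed ho fun a b _ hab => by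
      have := (Finset.mem_inter.1 (Finset.mem_coe.1 hab)).2
      exact (Finset.mem_sym2_iff.1 this) b (Sym2.mem_mk_right a b)
    obtain ⟨x, hx, y, hy, hxy, hyz⟩ := h.exists_last_exit (C := C) mem_K_self fun h => hz (hCS h)
    have hyS : y ∉ S := by
      intro hyS
      refine hy (Conn.trans hx (.edge ?_))
      rw [hTS, Finset.coe_inter]
      refine ⟨hxy, ?_⟩
      simp only [Finset.mem_coe, Finset.mk_mem_sym2_iff]
      exact ⟨hCS hx, hyS⟩
    have hyW : y ∈ W \ S := Finset.mem_sdiff.2 ⟨hW _ (hT hxy) y (Sym2.mem_mk_right x y), hyS⟩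
    -- the edges touching `C` and the remaining ones are the disjoint witnesses
    have hd : DisjOcc (A x y) (fun J => Conn (J : Set (Sym2 V)) y z) T := by
      refine ⟨T.filter (Touches C), Finset.filter_subset _ _, T.filter fun e => ¬ Touches C e,
        Finset.filter_subset _ _, Finset.disjoint_filter_filter_not _ _ _, ⟨?_, ?_⟩, ?_⟩
      · have hx' : x ∈ K {e ∈ (TS : Set (Sym2 V)) | Touches C e} o := by
          rw [K_filter_touches hC.symm]; exact hx
        refine Conn.mono ?_ hx'
        rintro e ⟨he, heC⟩
        rw [hTS, Finset.coe_inter] at he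
        rw [Finset.coe_inter, Finset.coe_filter]
        exact ⟨⟨he.1, heC⟩, he.2⟩
      · exact Finset.mem_filter.2 ⟨hxy, x, hx, Sym2.mem_mk_left x y⟩
      · refine Conn.mono ?_ hyz
        rw [Finset.coe_filter]
        exact fun e he => he
    have hnn : ∀ x y, (0 : ℝ) ≤ if DisjOcc (A x y) (fun J => Conn (J : Set (Sym2 V)) y z) T then 1
        else 0 := fun x y => by split_ifs <;> norm_num
    refine le_trans ?_ (Finset.single_le_sum (fun x _ => Finset.sum_nonneg fun y _ => hnn x y)
      (Finset.mem_coe.1 (hCS hx)))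
    refine le_trans ?_ (Finset.single_le_sum (fun y _ => hnn x y) hyW)
    rw [if_pos hd]
  refine h1.trans (Finset.sum_le_sum fun x _ => Finset.sum_le_sum fun y hy => ?_)
  refine (Pr_disjOcc_le (fun e _ => hp e) (hAmono x y) fun I I' h h' =>
    h'.mono (Finset.coe_subset.2 h)).trans ?_
  refine mul_le_mul_of_nonneg_right ?_ (Pr_nonneg fun e _ => hp e)
  have hyS : s(x, y) ∉ S.sym2 := by
    rw [Finset.mk_mem_sym2_iff]
    exact fun h => (Finset.mem_sdiff.1 hy).2 h.2
  have hle : ∀ F : Finset (Sym2 V), Ex F p (fun T => if Conn ((T ∩ S.sym2 : Finset _) : Set (Sym2 V)) o x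
      then (1 : ℝ) else 0) ≤ Pr S.sym2 p (fun T => Conn (T : Set (Sym2 V)) o x) := by
    intro F
    rw [Ex_inter_eq (f := fun T : Finset (Sym2 V) => if Conn (T : Set (Sym2 V)) o x then (1 : ℝ) else 0)]
    exact Ex_mono_set (fun e _ => hp e) Finset.inter_subset_right (monotone_conn_ite o x)
  by_cases heF : s(x, y) ∈ F
  · unfold Pr
    rw [Ex_erase heF, Ex_congr (g := fun _ => 0), Ex_const, mul_zero, zero_add]
    · refine mul_le_mul_of_nonneg_left ?_ (hp _).1
      refine le_trans (Ex_mono (fun e _ => hp e) fun T hT => ?_) (hle (F.erase s(x, y)))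
      simp only [hA, Finset.insert_inter_of_notMem hyS]
      split_ifs <;> first | (norm_num; done) | tauto
    · intro T hT
      exact if_neg fun h => Finset.notMem_erase _ _ (hT h.2)
  · have : Pr F p (A x y) = 0 := by
      unfold Pr
      rw [Ex_congr (g := fun _ => 0), Ex_const]
      intro T hT
      exact if_neg fun h => heF (hT h.2)
    rw [this]
    exact mul_nonneg (hp _).1 (Pr_nonneg fun e _ => hp e)

/-- If from every vertex `o` some set `S o` of at most `M` vertices has expected outgoing flow at
most `r < 1`, then mean cluster sizes are at most `M / (1 - r)`, in any finite edge set. -/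
lemma Ex_ncard_le (hp : ∀ e, 0 ≤ p e ∧ p e ≤ 1) {S : V → Finset V} {M r : ℝ} (hr : r < 1)
    (hr0 : 0 ≤ r) (ho : ∀ o, o ∈ S o) (hM : ∀ o, ((S o).card : ℝ) ≤ M)
    (hflow : ∀ (o : V) (W : Finset V), ∑ x ∈ S o, ∑ y ∈ W \ S o,
      p s(x, y) * Pr (S o).sym2 p (fun T => Conn (T : Set (Sym2 V)) o x) ≤ r) (o : V) :
    Ex F p (fun T => ((K (T : Set (Sym2 V)) o).ncard : ℝ)) ≤ M / (1 - r) := by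
  obtain ⟨W, hW⟩ : ∃ W : Finset V, ∀ e ∈ F, ∀ v ∈ e, v ∈ W := by
    refine ⟨F.biUnion Sym2.toFinset, fun e he v hv => Finset.mem_biUnion.2 ⟨e, he, ?_⟩⟩
    simpa using hv
  have hoW : ∀ o, ∀ T ⊆ F, K (T : Set (Sym2 V)) o ⊆ insert o (W : Set V) := fun o T hT =>
    K_subset_of_closed (Set.mem_insert _ _) fun a b _ hab =>
      Or.inr (hW _ (hT hab) b (Sym2.mem_mk_right a b))
  set χ : V → ℝ := fun o => Ex F p (fun T => ((K (T : Set (Sym2 V)) o).ncard : ℝ)) with hχ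
  have hχ0 : ∀ o, 0 ≤ χ o := fun o => Ex_nonneg (fun e _ => hp e) fun T _ => by positivity
  have hsum : ∀ (o : V) (W : Finset V), ∑ z ∈ W, Pr F p (fun T => Conn (T : Set (Sym2 V)) o z) ≤ χ o := by
    intro o W
    unfold Pr
    rw [← Ex_sum]
    refine Ex_mono (fun e _ => hp e) fun T _ => ?_
    calc (∑ z ∈ W, if Conn (T : Set (Sym2 V)) o z then (1 : ℝ) else 0)
        = ((W.filter fun z => Conn (T : Set (Sym2 V)) o z).card : ℝ) := by
          rw [← Finset.sum_filter]; simp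
      _ ≤ _ := by
          rw [← Set.ncard_coe_finset]
          exact_mod_cast Set.ncard_le_ncard (fun z hz => (Finset.mem_filter.1 hz).2)
            (K_finite T.finite_toSet)
  -- leaving `S o`, the cluster restarts from an endpoint outside `S o`
  have hrec : ∀ (o : V) (X : ℝ), (∀ y ∈ W, χ y ≤ X) → 0 ≤ X → χ o ≤ M + r * X := by
    intro o X hX hX0
    have h1 : χ o ≤ (S o).card + ∑ z ∈ W \ S o, Pr F p (fun T => Conn (T : Set (Sym2 V)) o z) := by
      unfold Pr
      rw [← Ex_sum, ← Ex_const (F := F) (p := p) ((S o).card : ℝ), ← Ex_add]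
      refine Ex_mono (fun e _ => hp e) fun T hT => ?_
      have hsub : K (T : Set (Sym2 V)) o ⊆
          ((S o ∪ (W \ S o).filter fun z => Conn (T : Set (Sym2 V)) o z : Finset V) : Set V) := by
        intro z hz
        rw [Finset.mem_coe, Finset.mem_union, Finset.mem_filter, Finset.mem_sdiff]
        by_cases hzS : z ∈ S o
        · exact Or.inl hzS
        · refine Or.inr ⟨⟨?_, hzS⟩, hz⟩
          rcases hoW o T hT hz with rfl | h
          · exact absurd (ho z) hzS
          · exact h
      have h2 := (Set.ncard_le_ncard hsub).trans
        ((Set.ncard_coe_finset _).le.trans (Finset.card_union_le _ _))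
      calc ((K (T : Set (Sym2 V)) o).ncard : ℝ)
          ≤ (S o).card + ((W \ S o).filter fun z => Conn (T : Set (Sym2 V)) o z).card := by
            exact_mod_cast h2
        _ = _ := by rw [← Finset.sum_filter]; simp
    have h2 : ∑ z ∈ W \ S o, Pr F p (fun T => Conn (T : Set (Sym2 V)) o z) ≤ r * X := by
      calc ∑ z ∈ W \ S o, Pr F p (fun T => Conn (T : Set (Sym2 V)) o z)
          ≤ ∑ z ∈ W \ S o, ∑ x ∈ S o, ∑ y ∈ W \ S o, p s(x, y) *
              Pr (S o).sym2 p (fun T => Conn (T : Set (Sym2 V)) o x) *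
              Pr F p (fun T => Conn (T : Set (Sym2 V)) y z) :=
            Finset.sum_le_sum fun z hz => Pr_conn_le hp hW (ho o) (Finset.mem_sdiff.1 hz).2
        _ = ∑ x ∈ S o, ∑ y ∈ W \ S o, p s(x, y) *
              Pr (S o).sym2 p (fun T => Conn (T : Set (Sym2 V)) o x) *
              ∑ z ∈ W \ S o, Pr F p (fun T => Conn (T : Set (Sym2 V)) y z) := by
            rw [Finset.sum_comm]
            refine Finset.sum_congr rfl fun x _ => ?_
            rw [Finset.sum_comm]
            refine Finset.sum_congr rfl fun y _ => ?_
            rw [Finset.mul_sum]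
        _ ≤ ∑ x ∈ S o, ∑ y ∈ W \ S o, p s(x, y) *
              Pr (S o).sym2 p (fun T => Conn (T : Set (Sym2 V)) o x) * X := by
            refine Finset.sum_le_sum fun x _ => Finset.sum_le_sum fun y hy => ?_
            refine mul_le_mul_of_nonneg_left ?_
              (mul_nonneg (hp _).1 (Pr_nonneg fun e _ => hp e))
            exact (hsum y _).trans (hX y (Finset.mem_sdiff.1 hy).1)
        _ = (∑ x ∈ S o, ∑ y ∈ W \ S o, p s(x, y) *
              Pr (S o).sym2 p (fun T => Conn (T : Set (Sym2 V)) o x)) * X := by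
            simp only [Finset.sum_mul]
        _ ≤ r * X := mul_le_mul_of_nonneg_right (hflow o W) hX0
    linarith [hM o]
  have h1r : 0 < 1 - r := by linarith
  have hM0 : 0 ≤ M := (Nat.cast_nonneg _).trans (hM o)
  rcases W.eq_empty_or_nonempty with rfl | hne
  · have := hrec o 0 (by simp) le_rfl
    rw [mul_zero, add_zero] at this
    refine this.trans ?_
    rw [le_div_iff₀ h1r]
    nlinarith
  · obtain ⟨v, hv, hmax⟩ := W.exists_max_image χ hne
    have hv' := hrec v (χ v) hmax (hχ0 v)
    have hv2 : χ v ≤ M / (1 - r) := by rw [le_div_iff₀ h1r]; linarith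
    refine (hrec o (χ v) hmax (hχ0 v)).trans ?_
    have : M / (1 - r) = M + r * (M / (1 - r)) := by field_simp; ring
    rw [this]
    nlinarith

end Sharpness

/-! ### Sprinkling and escape from finite sets -/

section Sprinkling

open scoped Classical

variable {V : Type*} {F : Finset (Sym2 V)}

/-- The vertices of `L` whose cluster stays inside `L`. -/
noncomputable def Safe (L : Finset V) (T : Set (Sym2 V)) : Finset V := L.filter fun x => K T x ⊆ L

lemma mem_Safe {L : Finset V} {T : Set (Sym2 V)} {x : V} : x ∈ Safe L T ↔ K T x ⊆ L :=
  ⟨fun h => (Finset.mem_filter.1 h).2, fun h => Finset.mem_filter.2 ⟨h mem_K_self, h⟩⟩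

/-- The event that the safe set is `S` does not depend on the edges inside `S`. -/
lemma Safe_sdiff {L S : Finset V} {T : Finset (Sym2 V)} :
    Safe L ((T \ S.sym2 : Finset _) : Set (Sym2 V)) = S ↔ Safe L (T : Set (Sym2 V)) = S := by
  have hsub : ((T \ S.sym2 : Finset _) : Set (Sym2 V)) ⊆ (T : Set (Sym2 V)) :=
    Finset.coe_subset.2 Finset.sdiff_subset
  have hout : ∀ a b, s(a, b) ∈ (T : Set (Sym2 V)) → (a ∉ S ∨ b ∉ S) →
      s(a, b) ∈ ((T \ S.sym2 : Finset _) : Set (Sym2 V)) := by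
    intro a b hab h
    rw [Finset.mem_coe, Finset.mem_sdiff, Finset.mk_mem_sym2_iff]
    exact ⟨hab, by tauto⟩
  constructor
  · intro h
    ext x
    rw [mem_Safe]
    constructor
    · intro hx
      rw [← h, mem_Safe]
      exact (K_mono hsub).trans hx
    · intro hx
      refine (K_subset_of_closed (C := (S : Set V)) hx fun a b ha hab => ?_).trans ?_
      · by_contra hb
        have h1 : K ((T \ S.sym2 : Finset _) : Set (Sym2 V)) a ⊆ L := mem_Safe.1 (h.symm ▸ ha)
        apply hb
        rw [K_eq (Conn.edge (hout a b hab (Or.inr hb)))] at h1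
        have := mem_Safe.2 h1
        rwa [h] at this
      · rw [← h]
        exact Finset.coe_subset.2 (Finset.filter_subset _ _)
  · intro h
    ext x
    rw [mem_Safe]
    constructor
    · intro hx
      by_contra hxS
      have hx' : ¬ K (T : Set (Sym2 V)) x ⊆ L := fun h' => hxS (h ▸ mem_Safe.2 h')
      refine hx' (Set.Subset.trans (K_subset_of_closed mem_K_self fun a b ha hab => ?_) hx)
      have haS : a ∉ S := by
        intro haS
        rw [← h, mem_Safe] at haS
        rw [K_eq (K_mono hsub ha)] at hx'
        exact hx' haS
      exact Conn.trans ha (.edge (hout a b hab (Or.inl haS)))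
    · intro hx
      rw [← h, mem_Safe] at hx
      exact (K_mono hsub).trans hx

/-- The retention probabilities with weights `J` at inverse temperature `b`. -/
noncomputable def prob (J : Sym2 V → ℝ) (b : ℝ) (e : Sym2 V) : ℝ := 1 - Real.exp (-(b * J e))

variable {J : Sym2 V → ℝ} {b : ℝ}

lemma prob_mem (hJ : ∀ e, 0 ≤ J e) (hb : 0 ≤ b) (e : Sym2 V) :
    0 ≤ prob J b e ∧ prob J b e ≤ 1 := by
  have h1 : Real.exp (-(b * J e)) ≤ 1 :=
    Real.exp_le_one_iff.2 (neg_nonpos.2 (mul_nonneg hb (hJ e)))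
  have h2 := Real.exp_pos (-(b * J e))
  constructor <;> unfold prob <;> linarith

lemma prob_le (e : Sym2 V) : prob J b e ≤ b * J e := by
  have := Real.add_one_le_exp (-(b * J e))
  unfold prob
  linarith

lemma prob_mono (hJ : ∀ e, 0 ≤ J e) {b' : ℝ} (h : b ≤ b') (e : Sym2 V) :
    prob J b e ≤ prob J b' e := by
  have := Real.exp_le_exp.2 (neg_le_neg (mul_le_mul_of_nonneg_right h (hJ e)))
  unfold prob
  linarith

lemma prob_add (b d : ℝ) (e : Sym2 V) :
    prob J (b + d) e = 1 - (1 - prob J b e) * (1 - prob J d e) := by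
  unfold prob
  rw [add_mul, neg_add, Real.exp_add]
  ring

lemma Pr_inter_empty {p : Sym2 V → ℝ} {B : Finset (Sym2 V)} (hB : B ⊆ F) :
    Pr F p (fun T => T ∩ B = ∅) = ∏ e ∈ B, (1 - p e) := by
  rw [Pr_eq_Ex, Ex_inter (f := fun T => if T = ∅ then 1 else 0) hB, Ex, Finset.sum_eq_single ∅]
  · simp
  · intro T _ hT
    simp [hT]
  · simp

/-- The pairs `(x, y)` with `x ∈ S`, `y ∈ W \ S` and `x y ∈ F`. -/
noncomputable def bdPairs (F : Finset (Sym2 V)) (S W : Finset V) : Finset (V × V) :=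
  (S ×ˢ (W \ S)).filter fun q => s(q.1, q.2) ∈ F

/-- The total weight of the edges of `F` from the part of `S` joined to `o` out of `S`. -/
noncomputable def outWeight (F : Finset (Sym2 V)) (J : Sym2 V → ℝ) (W : Finset V) (o : V)
    (S : Finset V) (T : Finset (Sym2 V)) : ℝ :=
  ∑ q ∈ bdPairs F S W, if Conn (T : Set (Sym2 V)) o q.1 then J s(q.1, q.2) else 0

lemma mk_injOn_bdPairs (S W : Finset V) :
    Set.InjOn (fun q : V × V => s(q.1, q.2)) (bdPairs F S W : Set (V × V)) := by
  rintro ⟨a, b⟩ h ⟨c, d⟩ h' heq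
  simp only [bdPairs, Finset.coe_filter, Finset.mem_product, Finset.mem_sdiff, Set.mem_ofPred_eq]
    at h h'
  rcases Sym2.eq_iff.1 heq with ⟨rfl, rfl⟩ | ⟨rfl, rfl⟩
  · rfl
  · exact absurd h.1.1 h'.1.2.2

lemma outWeight_nonneg (hJ : ∀ e, 0 ≤ J e) {W : Finset V} {o : V} {S : Finset V}
    {T : Finset (Sym2 V)} : 0 ≤ outWeight F J W o S T :=
  Finset.sum_nonneg fun q _ => by split_ifs <;> [exact hJ _; exact le_rfl]

lemma outWeight_le (hJ : ∀ e, 0 ≤ J e) {W : Finset V} {o : V} {S : Finset V}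
    {T : Finset (Sym2 V)} : outWeight F J W o S T ≤ ∑ e ∈ F, J e := by
  calc outWeight F J W o S T ≤ ∑ q ∈ bdPairs F S W, J s(q.1, q.2) :=
        Finset.sum_le_sum fun q _ => by split_ifs <;> [exact le_rfl; exact hJ _]
    _ = ∑ e ∈ (bdPairs F S W).image (fun q => s(q.1, q.2)), J e :=
        (Finset.sum_image (f := J) (mk_injOn_bdPairs S W)).symm
    _ ≤ _ := by
        refine Finset.sum_le_sum_of_subset_of_nonneg ?_ fun e _ _ => hJ e
        intro e he
        obtain ⟨q, hq, rfl⟩ := Finset.mem_image.1 he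
        exact (Finset.mem_filter.1 hq).2

lemma monotone_outWeight (hJ : ∀ e, 0 ≤ J e) (W : Finset V) (o : V) (S : Finset V) :
    Monotone (outWeight F J W o S) := by
  intro T T' h
  refine Finset.sum_le_sum fun q _ => ?_
  have := hJ s(q.1, q.2)
  have h' : Conn (T : Set (Sym2 V)) o q.1 → Conn (T' : Set (Sym2 V)) o q.1 :=
    fun h' => h'.mono (Finset.coe_subset.2 h)
  split_ifs <;> first | linarith | tauto

/-- One sprinkling step. Given that the safe set of the old configuration is `S ∋ o`, the cluster of
`o` still avoids the complement of `L` only if no new edge joins it to the complement of `S`. -/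
lemma Pr_step_le (hJ : ∀ e, 0 ≤ J e) (hb : 0 ≤ b) {d κ : ℝ} (hd : 0 ≤ d) {L W : Finset V} {o : V}
    (hκ : ∀ S ⊆ L, o ∈ S → κ ≤ Ex F (prob J b) fun T => outWeight F J W o S (T ∩ S.sym2)) :
    Pr F (prob J (b + d)) (fun T => K (T : Set (Sym2 V)) o ⊆ L) ≤
      Pr F (prob J b) (fun T => K (T : Set (Sym2 V)) o ⊆ L) *
        (1 - d * κ + (d * ∑ e ∈ F, J e) ^ 2) := by
  set B := ∑ e ∈ F, J e with hB
  have hB0 : 0 ≤ B := Finset.sum_nonneg fun e _ => hJ e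
  have hp := prob_mem hJ hb
  have hpd := prob_mem hJ hd
  set h : Finset V → Finset (Sym2 V) → ℝ := fun S T => 1 - d * outWeight F J W o S T + (d * B) ^ 2
    with hh
  have hexp : ∀ S T, Real.exp (-(d * outWeight F J W o S T)) ≤ h S T := by
    intro S T
    have h1 : 0 ≤ d * outWeight F J W o S T := mul_nonneg hd (outWeight_nonneg hJ)
    have h2 : d * outWeight F J W o S T ≤ d * B := mul_le_mul_of_nonneg_left (outWeight_le hJ) hd
    set x := d * outWeight F J W o S T with hx
    have h3 : Real.exp (-x) ≤ 1 - x + x ^ 2 := by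
      have h4 : 1 + x ≤ Real.exp x := by linarith [Real.add_one_le_exp x]
      rw [Real.exp_neg]
      refine (inv_anti₀ (by linarith) h4).trans ?_
      rw [inv_le_iff_one_le_mul₀ (by linarith)]
      nlinarith [mul_nonneg h1 (mul_nonneg h1 h1)]
    have h5 : x ^ 2 ≤ (d * B) ^ 2 := pow_le_pow_left₀ h1 h2 2
    simp only [hh, ← hx]
    linarith
  have hh0 : ∀ S T, 0 ≤ h S T := fun S T => (Real.exp_pos _).le.trans (hexp S T)
  set 𝒮 := L.powerset.filter fun S => o ∈ S with h𝒮
  -- given the old configuration `T`, decompose according to its safe set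
  have hpt : ∀ T ⊆ F, Ex F (prob J d) (fun T' => if K ((T ∪ T' : Finset _) : Set (Sym2 V)) o ⊆ L
      then (1 : ℝ) else 0) ≤ ∑ S ∈ 𝒮, h S (T ∩ S.sym2) *
        (if Safe L ((T \ S.sym2 : Finset _) : Set (Sym2 V)) = S then (1 : ℝ) else 0) := by
    intro T hT
    have hnn : ∀ S ∈ 𝒮, 0 ≤ h S (T ∩ S.sym2) *
        (if Safe L ((T \ S.sym2 : Finset _) : Set (Sym2 V)) = S then (1 : ℝ) else 0) := fun S _ =>
      mul_nonneg (hh0 _ _) (by split_ifs <;> norm_num)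
    by_cases hKL : K (T : Set (Sym2 V)) o ⊆ L
    swap
    · rw [Ex_congr (g := fun _ => 0), Ex_const]
      · exact Finset.sum_nonneg hnn
      · intro T' _
        exact if_neg fun h => hKL ((K_mono (Finset.coe_subset.2 Finset.subset_union_left)).trans h)
    set S := Safe L (T : Set (Sym2 V)) with hS
    have hoS : o ∈ S := mem_Safe.2 hKL
    have hS𝒮 : S ∈ 𝒮 :=
      Finset.mem_filter.2 ⟨Finset.mem_powerset.2 (Finset.filter_subset _ _), hoS⟩
    refine le_trans ?_ (Finset.single_le_sum hnn hS𝒮)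
    rw [if_pos (Safe_sdiff.2 hS.symm), mul_one]
    refine le_trans ?_ (hexp _ _)
    have hKS : K (T : Set (Sym2 V)) o ⊆ (S : Set V) := by
      intro x hx
      refine mem_Safe.2 ?_
      rw [← K_eq hx]
      exact hKL
    have hKin : ∀ x, Conn (T : Set (Sym2 V)) o x →
        Conn ((T ∩ S.sym2 : Finset _) : Set (Sym2 V)) o x := by
      refine fun x hx => K_subset_of_closed (T := (T : Set (Sym2 V))) mem_K_self
        (fun a c ha hac => Conn.trans ha (.edge ?_)) hx
      have haT : Conn (T : Set (Sym2 V)) o a :=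
        Conn.mono (Finset.coe_subset.2 Finset.inter_subset_left) ha
      rw [Finset.mem_coe, Finset.mem_inter, Finset.mk_mem_sym2_iff]
      exact ⟨hac, hKS haT, hKS (Conn.trans haT (.edge hac))⟩
    set Bd := ((bdPairs F S W).filter fun q =>
      Conn ((T ∩ S.sym2 : Finset _) : Set (Sym2 V)) o q.1).image (fun q => s(q.1, q.2)) with hBd
    have hBdF : Bd ⊆ F := by
      intro e he
      obtain ⟨q, hq, rfl⟩ := Finset.mem_image.1 he
      exact (Finset.mem_filter.1 (Finset.mem_filter.1 hq).1).2
    have h1 : Ex F (prob J d) (fun T' => if K ((T ∪ T' : Finset _) : Set (Sym2 V)) o ⊆ L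
        then (1 : ℝ) else 0) ≤ Pr F (prob J d) (fun T' => T' ∩ Bd = ∅) := by
      refine Pr_mono (A := fun T' => K ((T ∪ T' : Finset _) : Set (Sym2 V)) o ⊆ L)
        (fun e _ => hpd e) fun T' hT' hK => ?_
      rw [Finset.eq_empty_iff_forall_notMem]
      intro e he
      obtain ⟨he1, he2⟩ := Finset.mem_inter.1 he
      obtain ⟨⟨x, y⟩, hq, rfl⟩ := Finset.mem_image.1 he2
      obtain ⟨hq1, hq2⟩ := Finset.mem_filter.1 hq
      simp only [bdPairs, Finset.mem_filter, Finset.mem_product, Finset.mem_sdiff] at hq1 hq2 he1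
      have hox : Conn ((T ∪ T' : Finset _) : Set (Sym2 V)) o x := hq2.mono (Finset.coe_subset.2
        (Finset.inter_subset_left.trans Finset.subset_union_left))
      have hoy : Conn ((T ∪ T' : Finset _) : Set (Sym2 V)) o y :=
        hox.trans (.edge (by simp [he1]))
      refine hq1.1.2.2 (mem_Safe.2 ?_)
      rw [K_eq hoy] at hK
      exact (K_mono (Finset.coe_subset.2 Finset.subset_union_left)).trans hK
    refine h1.trans ?_
    rw [Pr_inter_empty hBdF]
    have h2 : ∀ e, 1 - prob J d e = Real.exp (-(d * J e)) := fun e => by simp [prob]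
    simp only [h2]
    rw [← Real.exp_sum]
    refine Real.exp_le_exp.2 (le_of_eq ?_)
    rw [Finset.sum_neg_distrib, ← Finset.mul_sum, hBd, Finset.sum_image, Finset.sum_filter, outWeight]
    exact (mk_injOn_bdPairs S W).mono (Finset.coe_subset.2 (Finset.filter_subset _ _))
  have hsprinkle : Pr F (prob J (b + d)) (fun T => K (T : Set (Sym2 V)) o ⊆ L) =
      Ex F (prob J b) fun T => Ex F (prob J d) fun T' =>
        if K ((T ∪ T' : Finset _) : Set (Sym2 V)) o ⊆ L then (1 : ℝ) else 0 := by
    rw [← Ex_sprinkle (f := fun T : Finset (Sym2 V) => if K (T : Set (Sym2 V)) o ⊆ L then (1 : ℝ) else 0)]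
    exact Ex_congr_p fun e _ => prob_add b d e
  rw [hsprinkle]
  refine (Ex_mono (fun e _ => hp e) hpt).trans ?_
  rw [Ex_sum]
  have hfac : ∀ S ∈ 𝒮, Ex F (prob J b) (fun T => h S (T ∩ S.sym2)) ≤ 1 - d * κ + (d * B) ^ 2 := by
    intro S hS
    obtain ⟨hSL, hoS⟩ := Finset.mem_filter.1 hS
    simp only [hh]
    rw [Ex_add, Ex_sub, Ex_const, Ex_const, Ex_const_mul]
    have := mul_le_mul_of_nonneg_left (hκ S (Finset.mem_powerset.1 hSL) hoS) hd
    linarith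
  -- the flow out of `S` depends on the edges inside `S`, the event `Safe = S` on the other ones
  have hterm : ∀ S ∈ 𝒮, Ex F (prob J b) (fun T => h S (T ∩ S.sym2) *
        (if Safe L ((T \ S.sym2 : Finset _) : Set (Sym2 V)) = S then (1 : ℝ) else 0)) ≤
      Pr F (prob J b) (fun T => Safe L (T : Set (Sym2 V)) = S) * (1 - d * κ + (d * B) ^ 2) := by
    intro S hS
    rw [Ex_indep (G := S.sym2) (f := h S) (g := fun T : Finset (Sym2 V) =>
      if Safe L (T : Set (Sym2 V)) = S then (1 : ℝ) else 0)]
    simp only [Safe_sdiff]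
    rw [mul_comm, ← Pr_eq_Ex]
    exact mul_le_mul_of_nonneg_left (hfac S hS) (Pr_nonneg fun e _ => hp e)
  refine (Finset.sum_le_sum hterm).trans ?_
  rw [← Finset.sum_mul]
  by_cases hoL : o ∈ L
  · have hpos : 0 ≤ 1 - d * κ + (d * B) ^ 2 :=
      (Ex_nonneg (fun e _ => hp e) fun T _ => hh0 _ _).trans
        (hfac {o} (by simp [h𝒮, hoL]))
    refine mul_le_mul_of_nonneg_right ?_ hpos
    simp only [Pr_eq_Ex]
    rw [← Ex_sum]
    refine Ex_mono (fun e _ => hp e) fun T _ => ?_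
    rw [Finset.sum_ite_eq]
    by_cases hm : Safe L (T : Set (Sym2 V)) ∈ 𝒮
    · rw [if_pos hm, if_pos (mem_Safe.1 (Finset.mem_filter.1 hm).2)]
    · rw [if_neg hm]
      split_ifs <;> norm_num
  · have : 𝒮 = ∅ := by
      rw [h𝒮, Finset.filter_eq_empty_iff]
      exact fun S hS hoS => hoL (Finset.mem_powerset.1 hS hoS)
    rw [this, Finset.sum_empty, zero_mul, Pr_eq_zero, zero_mul]
    exact fun T _ h => hoL (h mem_K_self)

lemma Ex_prob_mono (hJ : ∀ e, 0 ≤ J e) (hb : 0 ≤ b) {b' : ℝ} (h : b ≤ b') {f : Finset (Sym2 V) → ℝ}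
    (hf : Monotone f) : Ex F (prob J b) f ≤ Ex F (prob J b') f :=
  Ex_mono_p (fun e _ => prob_mem hJ hb e) (fun e _ => prob_mem hJ (hb.trans h) e)
    (fun e _ => prob_mono hJ h e) hf

/-- If the expected weight out of every set `S ∋ o` inside `L` is at least `κ` at inverse
temperature `b`, then the cluster of `o` leaves `L` with probability bounded below at any larger
inverse temperature: iterate the sprinkling step with vanishing step size. -/
lemma Pr_subset_le_exp (hJ : ∀ e, 0 ≤ J e) (hb : 0 ≤ b) {t κ : ℝ} (ht : 0 ≤ t) {L W : Finset V}
    {o : V}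
    (hκ : ∀ S ⊆ L, o ∈ S → κ ≤ Ex F (prob J b) fun T => outWeight F J W o S (T ∩ S.sym2)) :
    Pr F (prob J (b + t)) (fun T => K (T : Set (Sym2 V)) o ⊆ L) ≤ Real.exp (-(t * κ)) := by
  set B := ∑ e ∈ F, J e with hB
  have hmain : ∀ k : ℕ, 1 ≤ k → Pr F (prob J (b + t)) (fun T => K (T : Set (Sym2 V)) o ⊆ L) ≤
      Real.exp (-(t * κ) + (t * B) ^ 2 / k) := by
    intro k hk
    have hk0 : (0 : ℝ) < k := by exact_mod_cast hk
    set d := t / k with hd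
    have hd0 : 0 ≤ d := by positivity
    have hit : ∀ i : ℕ, Pr F (prob J (b + i * d)) (fun T => K (T : Set (Sym2 V)) o ⊆ L) ≤
        Real.exp (-(d * κ) + (d * B) ^ 2) ^ i := by
      intro i
      induction i with
      | zero =>
        rw [pow_zero]
        exact Pr_le_one fun e _ => prob_mem hJ (by simpa using hb) e
      | succ i ih =>
        have hbi : 0 ≤ b + i * d := by positivity
        have hκi : ∀ S ⊆ L, o ∈ S →
            κ ≤ Ex F (prob J (b + i * d)) fun T => outWeight F J W o S (T ∩ S.sym2) := by
          intro S hS ho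
          refine (hκ S hS ho).trans (Ex_prob_mono hJ hb (by linarith [show 0 ≤ i * d by positivity])
            fun T T' h => ?_)
          exact monotone_outWeight hJ W o S (Finset.inter_subset_inter_right h)
        have hstep := Pr_step_le hJ hbi hd0 hκi
        have e1 : b + (i + 1 : ℕ) * d = b + i * d + d := by push_cast; ring
        rw [e1, pow_succ]
        refine hstep.trans ?_
        refine (mul_le_mul_of_nonneg_left ?_ (Pr_nonneg fun e _ => prob_mem hJ hbi e)).trans
          (mul_le_mul_of_nonneg_right ih (Real.exp_pos _).le)
        have := Real.add_one_le_exp (-(d * κ) + (d * B) ^ 2)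
        linarith
    have h1 := hit k
    have e2 : b + k * d = b + t := by rw [hd]; field_simp
    rw [e2, ← Real.exp_nat_mul] at h1
    convert h1 using 2
    rw [hd]
    field_simp
  have hlim : Filter.Tendsto (fun k : ℕ => Real.exp (-(t * κ) + (t * B) ^ 2 / k)) Filter.atTop
      (nhds (Real.exp (-(t * κ)))) := by
    have : Filter.Tendsto (fun k : ℕ => -(t * κ) + (t * B) ^ 2 / k) Filter.atTop
        (nhds (-(t * κ) + 0)) :=
      tendsto_const_nhds.add (tendsto_const_div_atTop_nhds_zero_nat _)
    rw [add_zero] at this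
    exact (Real.continuous_exp.tendsto _).comp this
  exact ge_of_tendsto hlim (Filter.eventually_atTop.2 ⟨1, hmain⟩)

end Sprinkling

end Percolation

/-! ### The mass-transport principle -/

namespace WeightedGraph

open Percolation Filter

section MassTransport

variable {V : Type*} {G : WeightedGraph V}

lemma IsAut.refl : G.IsAut (RelIso.refl _) := fun e => by
  congr 1
  ext1
  exact congrFun Sym2.map_id (e : Sym2 V)

lemma IsAut.trans {φ ψ : G.graph ≃g G.graph} (hφ : G.IsAut φ) (hψ : G.IsAut ψ) :
    G.IsAut (φ.trans ψ) := fun e => by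
  have h : SimpleGraph.Iso.mapEdgeSet (φ.trans ψ : G.graph ≃g G.graph) e = ψ.mapEdgeSet (φ.mapEdgeSet e) := by
    ext1
    exact (Sym2.map_map (g := ψ) (f := φ) (e : Sym2 V)).symm
  rw [h, hψ, hφ]

lemma IsAut.symm {φ : G.graph ≃g G.graph} (hφ : G.IsAut φ) : G.IsAut φ.symm := fun e => by
  have h : φ.mapEdgeSet (SimpleGraph.Iso.mapEdgeSet (φ.symm : G.graph ≃g G.graph) e) = e := by
    ext1
    refine (Sym2.map_map (g := φ) (f := φ.symm) (e : Sym2 V)).trans ?_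
    have : (φ ∘ φ.symm : V → V) = id := by ext; simp
    rw [this, Sym2.map_id]
    rfl
  have := hφ (SimpleGraph.Iso.mapEdgeSet (φ.symm : G.graph ≃g G.graph) e)
  rw [h] at this
  exact this.symm

lemma stabOrbit_map {φ : G.graph ≃g G.graph} (hφ : G.IsAut φ) (x y : V) :
    G.stabOrbit (φ x) (φ y) = φ '' G.stabOrbit x y := by
  apply subset_antisymm
  · rintro z ⟨ψ, hψ, h1, h2⟩
    refine ⟨φ.symm z, ⟨(φ.trans ψ).trans φ.symm, (hφ.trans hψ).trans hφ.symm, ?_, ?_⟩, by simp⟩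
    · simp [h1]
    · simp [h2]
  · rintro _ ⟨z, ⟨ψ, hψ, h1, rfl⟩, rfl⟩
    refine ⟨(φ.symm.trans ψ).trans φ, (hφ.symm.trans hψ).trans hφ, ?_, ?_⟩
    · simp [h1]
    · simp

lemma encard_stabOrbit_map {φ : G.graph ≃g G.graph} (hφ : G.IsAut φ) (x y : V) :
    (G.stabOrbit (φ x) (φ y)).encard = (G.stabOrbit x y).encard := by
  rw [stabOrbit_map hφ]
  exact φ.injective.encard_image _

/-- The **mass-transport principle** on a unimodular transitive weighted graph. -/
theorem tsum_mass_eq (htrans : G.IsTransitive) (hunimod : G.IsUnimodular) {f : V → V → ℝ≥0∞}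
    (hf : ∀ φ : G.graph ≃g G.graph, G.IsAut φ → ∀ x y, f (φ x) (φ y) = f x y) (o : V) :
    ∑' y, f o y = ∑' y, f y o := by
  choose g hgaut hg using fun y => htrans y o
  set τ : V → V := fun y => g y o with hτ
  have hfτ : ∀ y, f y o = f o (τ y) := fun y => by
    rw [← hf (g y) (hgaut y) y o, hg]
  -- group the vertices by their orbits under the stabilizer of `o`, on which `f o` is constant
  let r : Setoid V :=
    { r := fun y z => z ∈ G.stabOrbit o y
      iseqv := by
        refine ⟨fun y => ⟨RelIso.refl _, .refl, rfl, rfl⟩, ?_, ?_⟩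
        · rintro y z ⟨φ, hφ, h1, rfl⟩
          exact ⟨φ.symm, hφ.symm, φ.symm_apply_eq.2 h1.symm, φ.symm_apply_apply _⟩
        · rintro y z w ⟨φ, hφ, h1, rfl⟩ ⟨ψ, hψ, h2, rfl⟩
          exact ⟨φ.trans ψ, hφ.trans hψ, by simp [h1, h2], rfl⟩ }
  let π : V → Quotient r := Quotient.mk r
  have hπ : ∀ y z, π y = π z ↔ z ∈ G.stabOrbit o y := fun y z => Quotient.eq
  have hconst : ∀ y z, π y = π z → f o z = f o y := by
    intro y z h
    obtain ⟨φ, hφ, h1, rfl⟩ := (hπ y z).1 h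
    conv_lhs => rw [← h1]
    exact hf φ hφ o y
  have hfib : ∀ (σ : V → V), ∑' y, f o (σ y) =
      ∑' q : Quotient r, ({y | π (σ y) = q}.encard : ℝ≥0∞) * f o q.out := by
    intro σ
    rw [← (Equiv.sigmaFiberEquiv fun y => π (σ y)).tsum_eq, ENNReal.tsum_sigma']
    refine tsum_congr fun q => ?_
    rw [← ENNReal.tsum_set_const]
    refine tsum_congr fun y => ?_
    refine hconst _ _ ?_
    exact (Quotient.out_eq q).trans y.2.symm
  simp only [hfτ]
  rw [hfib τ]
  have := hfib id
  simp only [id] at this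
  rw [this]
  refine tsum_congr fun q => ?_
  congr 2
  set z := q.out with hz
  have hq : q = π z := (Quotient.out_eq q).symm
  obtain ⟨γ, hγ, hγz⟩ := htrans z o
  have e1 : {y | π y = q} = G.stabOrbit o z := by
    ext y
    rw [hq]
    exact eq_comm.trans (hπ z y)
  -- the vertices `y` from which `o` looks like `z` from `o` form the orbit of the reverse pair
  have e2 : {y | π (τ y) = q} = G.stabOrbit o (γ o) := by
    ext y
    rw [hq]
    refine (eq_comm.trans (hπ z (τ y))).trans ⟨?_, ?_⟩
    · rintro ⟨χ, hχ, h1, h2⟩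
      refine ⟨(γ.symm.trans χ).trans (g y).symm, (hγ.symm.trans hχ).trans (hgaut y).symm, ?_, ?_⟩
      · have : γ.symm o = z := γ.symm_apply_eq.2 hγz.symm
        simp only [RelIso.trans_apply, this, h2]
        exact (g y).symm_apply_eq.2 rfl
      · simp only [RelIso.trans_apply, RelIso.symm_apply_apply, h1]
        exact (g y).symm_apply_eq.2 (hg y).symm
    · rintro ⟨ψ, hψ, h1, h2⟩
      refine ⟨(γ.trans ψ).trans (g y), (hγ.trans hψ).trans (hgaut y), ?_, ?_⟩
      · simp only [RelIso.trans_apply, h2, hg]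
      · simp only [RelIso.trans_apply, hγz, h1]
        rfl
  rw [e1, e2]
  conv_rhs => rw [← hγz]
  rw [encard_stabOrbit_map hγ, hγz, hunimod]

end MassTransport

/-! ### Finite-volume approximation of the percolation measure -/

section FiniteVolume

open scoped Classical

variable {V : Type*} (G : WeightedGraph V)

/-- The weights, extended by `0` to all unordered pairs. -/
noncomputable def wt (e : Sym2 V) : ℝ := if h : e ∈ G.graph.edgeSet then G.J ⟨e, h⟩ else 0

/-- The set of retained edges. -/
def opn (ω : G.graph.edgeSet → Bool) : Set (Sym2 V) := {e | ∃ h : e ∈ G.graph.edgeSet, ω ⟨e, h⟩ = true}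

/-- The set of retained edges in the finite set `F`. -/
noncomputable def trace (F : Finset (Sym2 V)) (ω : G.graph.edgeSet → Bool) : Finset (Sym2 V) :=
  F.filter fun e => e ∈ G.opn ω

lemma wt_nonneg (e : Sym2 V) : 0 ≤ G.wt e := by
  unfold wt
  split_ifs <;> [exact (G.J_pos _).le; exact le_rfl]

lemma wt_map {φ : G.graph ≃g G.graph} (hφ : G.IsAut φ) (e : Sym2 V) :
    G.wt (e.map φ) = G.wt e := by
  have h : e.map φ ∈ G.graph.edgeSet ↔ e ∈ G.graph.edgeSet := by
    induction e with
    | h a b => simp [φ.map_adj_iff]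
  unfold wt
  by_cases he : e ∈ G.graph.edgeSet
  · rw [dif_pos he, dif_pos (h.2 he), ← hφ ⟨e, he⟩]
    rfl
  · rw [dif_neg he, dif_neg (fun h' => he (h.1 h'))]

lemma cluster_eq (ω : G.graph.edgeSet → Bool) (v : V) : G.cluster ω v = K (G.opn ω) v := by
  ext w
  change (G.openSubgraph ω).Reachable v w ↔ Conn (G.opn ω) v w
  constructor
  · rintro ⟨p⟩
    induction p with
    | nil => exact .refl
    | cons h _ ih => exact Conn.trans (.edge ((SimpleGraph.fromEdgeSet_adj _).1 h).1) ih
  · intro h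
    induction h with
    | refl => exact SimpleGraph.Reachable.refl _
    | @tail b c _ hbc ih =>
      by_cases hb : b = c
      · exact hb ▸ ih
      · exact ih.trans (SimpleGraph.Adj.reachable ((SimpleGraph.fromEdgeSet_adj _).2 ⟨hbc, hb⟩))

lemma coe_trace (F : Finset (Sym2 V)) (ω : G.graph.edgeSet → Bool) :
    (G.trace F ω : Set (Sym2 V)) ⊆ G.opn ω := fun _ he => (Finset.mem_filter.1 he).2

lemma trace_mono {F F' : Finset (Sym2 V)} (h : F ⊆ F') (ω : G.graph.edgeSet → Bool) :
    G.trace F ω ⊆ G.trace F' ω := Finset.filter_subset_filter _ h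

instance (b : ℝ≥0) : IsProbabilityMeasure (G.percolation b) := by
  unfold percolation; infer_instance

lemma measurableSet_mem_opn (e : Sym2 V) : MeasurableSet {ω | e ∈ G.opn ω} := by
  by_cases h : e ∈ G.graph.edgeSet
  · have : {ω | e ∈ G.opn ω} = (fun ω : G.graph.edgeSet → Bool => ω ⟨e, h⟩) ⁻¹' {true} := by
      ext ω
      exact ⟨fun ⟨_, h'⟩ => h', fun h' => ⟨h, h'⟩⟩
    rw [this]
    exact measurable_pi_apply _ (measurableSet_singleton _)
  · have : {ω | e ∈ G.opn ω} = ∅ := by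
      ext ω
      exact ⟨fun ⟨h', _⟩ => h h', fun h' => h'.elim⟩
    rw [this]
    exact .empty

lemma measurableSet_trace_eq (F T : Finset (Sym2 V)) : MeasurableSet {ω | G.trace F ω = T} := by
  by_cases hT : T ⊆ F
  · have : {ω | G.trace F ω = T} = ⋂ e ∈ F, {ω | e ∈ G.opn ω ↔ e ∈ T} := by
      ext ω
      simp only [Set.mem_ofPred_eq, Set.mem_iInter, trace, Finset.ext_iff, Finset.mem_filter]
      constructor
      · intro h e he
        rw [← h e]
        simp [he]
      · intro h e
        constructor
        · rintro ⟨h1, h2⟩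
          exact (h e h1).1 h2
        · exact fun h1 => ⟨hT h1, (h e (hT h1)).2 h1⟩
    rw [this]
    refine Finset.measurableSet_biInter _ fun e _ => ?_
    by_cases he : e ∈ T
    · simpa [he] using G.measurableSet_mem_opn e
    · simp only [he, iff_false]
      exact (G.measurableSet_mem_opn e).compl
  · have : {ω | G.trace F ω = T} = ∅ := by
      ext ω
      simp only [Set.mem_ofPred_eq, Set.mem_empty_iff_false, iff_false]
      rintro rfl
      exact hT (Finset.filter_subset _ _)
    rw [this]
    exact .empty

lemma measurable_comp_trace {α : Type*} [MeasurableSpace α] (F : Finset (Sym2 V))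
    (f : Finset (Sym2 V) → α) : Measurable fun ω => f (G.trace F ω) := by
  intro s _
  have : (fun ω => f (G.trace F ω)) ⁻¹' s =
      ⋃ T ∈ F.powerset.filter fun T => f T ∈ s, {ω | G.trace F ω = T} := by
    ext ω
    simp only [Set.mem_preimage, Set.mem_iUnion, Finset.mem_filter, Finset.mem_powerset,
      Set.mem_ofPred_eq, exists_prop]
    constructor
    · exact fun h => ⟨_, ⟨Finset.filter_subset _ _, h⟩, rfl⟩
    · rintro ⟨T, ⟨-, h⟩, rfl⟩
      exact h
  rw [this]
  exact Finset.measurableSet_biUnion _ fun T _ => G.measurableSet_trace_eq F T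

/-- The law of the trace on a finite edge set is the finite product law. -/
lemma percolation_trace_eq (b : ℝ≥0) {F T : Finset (Sym2 V)} (hT : T ⊆ F) :
    (G.percolation b).real {ω | G.trace F ω = T} =
      (∏ e ∈ T, prob G.wt b e) * ∏ e ∈ F \ T, (1 - prob G.wt b e) := by
  have hsplit : (∏ e ∈ T, prob G.wt b e) * ∏ e ∈ F \ T, (1 - prob G.wt b e) =
      ∏ e ∈ F, if e ∈ T then prob G.wt b e else 1 - prob G.wt b e := by
    rw [Finset.prod_ite, Finset.filter_mem_eq_inter, Finset.inter_eq_right.2 hT]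
    congr 2
    ext e
    simp
  rw [hsplit]
  by_cases hTG : ∀ e ∈ T, e ∈ G.graph.edgeSet
  · have hset : {ω | G.trace F ω = T} = Set.pi ((F.subtype (· ∈ G.graph.edgeSet) : Finset _) : Set G.graph.edgeSet)
        fun e => {decide ((e : Sym2 V) ∈ T)} := by
      ext ω
      simp only [Set.mem_ofPred_eq, Set.mem_pi, Finset.mem_coe, Finset.mem_subtype,
        Set.mem_singleton_iff]
      constructor
      · rintro rfl ⟨e, he⟩ heF
        simp only [trace, Finset.mem_filter]
        have heF' : e ∈ F := heF
        by_cases h : ω ⟨e, he⟩ = true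
        · have : e ∈ G.opn ω := ⟨he, h⟩
          simp [this, heF', h]
        · have : e ∉ G.opn ω := fun ⟨_, h'⟩ => h h'
          simp [this, h]
      · intro h
        ext e
        simp only [trace, Finset.mem_filter]
        constructor
        · rintro ⟨heF, he, hω⟩
          have := h ⟨e, he⟩ heF
          rw [hω] at this
          simpa using this.symm
        · intro heT
          refine ⟨hT heT, hTG e heT, ?_⟩
          rw [h ⟨e, hTG e heT⟩ (hT heT)]
          simpa using heT
    rw [hset, measureReal_def, percolation, Measure.infinitePi_pi _ fun _ _ => measurableSet_singleton _,
      ENNReal.toReal_prod, ← Finset.prod_subset (Finset.filter_subset (· ∈ G.graph.edgeSet) F)]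
    · rw [← Finset.subtype_map, Finset.prod_map]
      refine Finset.prod_congr rfl fun e _ => ?_
      have hpe : prob G.wt b e = 1 - Real.exp (-((b : ℝ) * G.J e)) := by
        rw [prob, wt, dif_pos e.2]
      change ((bernoulliMeasure true false (G.retentionProb b e)).real
        {decide ((e : Sym2 V) ∈ T)}) = if (e : Sym2 V) ∈ T then prob G.wt b e else 1 - prob G.wt b e
      rw [bernoulliMeasure_real_apply _ (measurableSet_singleton _), hpe]
      by_cases heT : (e : Sym2 V) ∈ T
      · simp [heT, retentionProb]
      · simp [heT, retentionProb]
    · intro e heF he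
      have he' : e ∉ G.graph.edgeSet := fun h => he (Finset.mem_filter.2 ⟨heF, h⟩)
      have : e ∉ T := fun h => he' (hTG e h)
      simp [this, prob, wt, he']
  · push Not at hTG
    obtain ⟨e, heT, he⟩ := hTG
    have hset : {ω | G.trace F ω = T} = ∅ := by
      ext ω
      simp only [Set.mem_ofPred_eq, Set.mem_empty_iff_false, iff_false]
      rintro rfl
      obtain ⟨-, h, -⟩ := Finset.mem_filter.1 heT
      exact he h
    rw [hset, measureReal_empty]
    refine (Finset.prod_eq_zero (hT heT) ?_).symm
    simp [heT, prob, wt, he]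

lemma integral_comp_trace (b : ℝ≥0) (F : Finset (Sym2 V)) (f : Finset (Sym2 V) → ℝ) :
    ∫ ω, f (G.trace F ω) ∂(G.percolation b) = Ex F (prob G.wt b) f := by
  have h : ∀ ω, f (G.trace F ω) =
      ∑ T ∈ F.powerset, Set.indicator {ω | G.trace F ω = T} (fun _ => f T) ω := by
    intro ω
    rw [Finset.sum_eq_single (G.trace F ω)]
    · rw [Set.indicator_of_mem (s := {ω' | G.trace F ω' = G.trace F ω}) rfl]
    · intro T _ hT
      exact Set.indicator_of_notMem (fun h => hT h.symm) _
    · exact fun h => absurd (Finset.mem_powerset.2 (Finset.filter_subset _ _)) h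
  simp only [h]
  rw [integral_finsetSum]
  · refine Finset.sum_congr rfl fun T hT => ?_
    rw [integral_indicator_const _ (G.measurableSet_trace_eq F T),
      G.percolation_trace_eq b (Finset.mem_powerset.1 hT), smul_eq_mul]
  · exact fun T _ => (integrable_const _).indicator (G.measurableSet_trace_eq F T)

lemma percolation_comp_trace (b : ℝ≥0) (F : Finset (Sym2 V)) (A : Finset (Sym2 V) → Prop) :
    (G.percolation b).real {ω | A (G.trace F ω)} = Pr F (prob G.wt b) A := by
  rw [Pr, ← G.integral_comp_trace b F]
  have hm : MeasurableSet {ω | A (G.trace F ω)} :=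
    measurableSet_setOfPred.2 (G.measurable_comp_trace F A)
  rw [← integral_indicator_one hm]
  refine integral_congr_ae (.of_forall fun ω => ?_)
  by_cases h : A (G.trace F ω)
  · simp [h, Set.indicator]
  · simp [h, Set.indicator]

end FiniteVolume

section Exhaustion

open scoped Classical

variable {V : Type*} [Countable V] (G : WeightedGraph V)

/-- An increasing sequence of finite sets of pairs that exhausts all pairs. -/
noncomputable def exh (V : Type*) [Countable V] (k : ℕ) : Finset (Sym2 V) :=
  ((Set.finite_Iio k).preimage
    (Exists.choose_spec (exists_injective_nat (Sym2 V))).injOn).toFinset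

lemma mem_exh {e : Sym2 V} {k : ℕ} :
    e ∈ exh V k ↔ (exists_injective_nat (Sym2 V)).choose e < k := by simp [exh]

lemma exh_mono {k l : ℕ} (h : k ≤ l) : exh V k ⊆ exh V l := fun _ he =>
  mem_exh.2 ((mem_exh.1 he).trans_le h)

lemma eventually_mem_exh (e : Sym2 V) : ∀ᶠ k in atTop, e ∈ exh V k :=
  (eventually_gt_atTop _).mono fun _ hk => mem_exh.2 hk

lemma eventually_subset_exh (F : Finset (Sym2 V)) : ∀ᶠ k in atTop, F ⊆ exh V k := by
  have : ∀ᶠ k in atTop, ∀ e ∈ F, e ∈ exh V k :=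
    (Finset.eventually_all F).2 fun e _ => eventually_mem_exh e
  exact this

/-- The restriction of the configuration to the `k`-th set of the exhaustion. -/
noncomputable def tr (k : ℕ) (ω : G.graph.edgeSet → Bool) : Set (Sym2 V) := (G.trace (exh V k) ω : Finset _)

lemma tr_subset (k : ℕ) (ω : G.graph.edgeSet → Bool) : G.tr k ω ⊆ G.opn ω := G.coe_trace _ ω

lemma eventually_conn {ω : G.graph.edgeSet → Bool} {x y : V} (h : Conn (G.opn ω) x y) :
    ∀ᶠ k in atTop, Conn (G.tr k ω) x y := by
  induction h with
  | refl => exact .of_forall fun _ => .refl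
  | @tail c d _ hbc ih =>
    filter_upwards [ih, eventually_mem_exh s(c, d)] with k h1 h2
    exact h1.trans (.edge (Finset.mem_filter.2 ⟨h2, hbc⟩))

lemma conn_iff_exists {ω : G.graph.edgeSet → Bool} {x y : V} :
    Conn (G.opn ω) x y ↔ ∃ k, Conn (G.tr k ω) x y :=
  ⟨fun h => (G.eventually_conn h).exists, fun ⟨k, h⟩ => h.mono (G.tr_subset k ω)⟩

lemma eventually_subset_K {ω : G.graph.edgeSet → Bool} {x : V} {S : Set V} (hS : S.Finite)
    (h : S ⊆ K (G.opn ω) x) : ∀ᶠ k in atTop, S ⊆ K (G.tr k ω) x :=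
  (hS.eventually_all).2 fun _ hy => G.eventually_conn (h hy)

lemma eventually_K_eq {ω : G.graph.edgeSet → Bool} {x : V} (h : (K (G.opn ω) x).Finite) :
    ∀ᶠ k in atTop, K (G.tr k ω) x = K (G.opn ω) x :=
  (G.eventually_subset_K h subset_rfl).mono fun k hk =>
    subset_antisymm (K_mono (G.tr_subset k ω)) hk

lemma measurableSet_conn (x y : V) : MeasurableSet {ω | Conn (G.opn ω) x y} := by
  have : {ω | Conn (G.opn ω) x y} = ⋃ k, {ω | Conn (G.tr k ω) x y} := by
    ext ω
    simp [G.conn_iff_exists]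
  rw [this]
  refine .iUnion fun k => ?_
  exact measurableSet_setOfPred.2 (G.measurable_comp_trace (exh V k) fun T => Conn (T : Set (Sym2 V)) x y)

lemma le_encard_iff {ω : G.graph.edgeSet → Bool} {x : V} {n : ℕ} {L : Set V} :
    (n : ℕ∞) ≤ (K (G.opn ω) x ∩ L).encard ↔ ∃ k, n ≤ (K (G.tr k ω) x ∩ L).ncard := by
  have hfin : ∀ k, (K (G.tr k ω) x ∩ L).Finite := fun k =>
    (K_finite (Finset.finite_toSet _)).inter_of_left L
  constructor
  · intro h
    obtain ⟨S, hS, hcard⟩ := Set.exists_subset_encard_eq h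
    have hSfin : S.Finite := Set.finite_of_encard_eq_coe hcard
    obtain ⟨k, hk⟩ := (G.eventually_subset_K hSfin (hS.trans Set.inter_subset_left)).exists
    refine ⟨k, ?_⟩
    have := Set.encard_le_encard (Set.subset_inter hk (hS.trans Set.inter_subset_right))
    rw [hcard, ← (hfin k).cast_ncard_eq] at this
    exact_mod_cast this
  · rintro ⟨k, hk⟩
    refine le_trans ?_ (Set.encard_le_encard
      (Set.inter_subset_inter_left L (K_mono (G.tr_subset k ω))))
    rw [← (hfin k).cast_ncard_eq]
    exact_mod_cast hk

/-- Probabilities of increasing finitary events are limits of finite-volume probabilities. -/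
lemma tendsto_Pr (b : ℝ≥0) {A : Finset (Sym2 V) → Prop} (hA : ∀ S T, S ⊆ T → A S → A T) :
    Tendsto (fun k => Pr (exh V k) (prob G.wt b) A) atTop
      (nhds ((G.percolation b).real {ω | ∃ k, A (G.trace (exh V k) ω)})) := by
  have h : {ω | ∃ k, A (G.trace (exh V k) ω)} = ⋃ k, {ω | A (G.trace (exh V k) ω)} := by
    ext; simp
  rw [h]
  simp only [← G.percolation_comp_trace b]
  have hmono : Monotone fun k => {ω | A (G.trace (exh V k) ω)} := fun k l hkl ω hω =>
    hA _ _ (G.trace_mono (exh_mono hkl) ω) hω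
  exact (ENNReal.tendsto_toReal (measure_ne_top _ _)).comp (tendsto_measure_iUnion_atTop hmono)

/-- The probability that the cluster of `o` has at least `n` vertices. -/
noncomputable def tail (b : ℝ≥0) (o : V) (n : ℕ) : ℝ :=
  (G.percolation b).real {ω | (n : ℕ∞) ≤ (G.cluster ω o).encard}

lemma tendsto_tail (b : ℝ≥0) (o : V) (n : ℕ) :
    Tendsto (fun k => Pr (exh V k) (prob G.wt b) fun T => n ≤ (K (T : Set (Sym2 V)) o).ncard) atTop
      (nhds (G.tail b o n)) := by
  have h := G.tendsto_Pr b (A := fun T => n ≤ (K (T : Set (Sym2 V)) o).ncard) fun S T h h' =>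
    h'.trans (Set.ncard_le_ncard (K_mono (Finset.coe_subset.2 h)) (K_finite T.finite_toSet))
  have hset : {ω | (n : ℕ∞) ≤ (G.cluster ω o).encard} =
      {ω | ∃ k, n ≤ (K (G.trace (exh V k) ω : Set (Sym2 V)) o).ncard} := by
    ext ω
    have := G.le_encard_iff (ω := ω) (x := o) (n := n) (L := Set.univ)
    simp only [Set.inter_univ] at this
    simp only [Set.mem_ofPred_eq, G.cluster_eq]
    exact this
  rw [tail, hset]
  exact h

lemma Pr_le_tail (b : ℝ≥0) (F : Finset (Sym2 V)) (o : V) (n : ℕ) :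
    Pr F (prob G.wt b) (fun T => n ≤ (K (T : Set (Sym2 V)) o).ncard) ≤ G.tail b o n := by
  refine ge_of_tendsto (G.tendsto_tail b o n) ((eventually_subset_exh F).mono fun k hk => ?_)
  exact Ex_mono_set (fun e _ => prob_mem G.wt_nonneg b.2 e) hk (monotone_ite fun S T h h' =>
    h'.trans (Set.ncard_le_ncard (K_mono (Finset.coe_subset.2 h)) (K_finite T.finite_toSet)))

end Exhaustion

/-! ### Invariance under automorphisms -/

section Invariance

open scoped Classical

variable {V : Type*} (G : WeightedGraph V)

/-- The action of a graph automorphism on configurations. -/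
def shift (φ : G.graph ≃g G.graph) (ω : G.graph.edgeSet → Bool) : G.graph.edgeSet → Bool :=
  fun e => ω (φ.mapEdgeSet.symm e)

lemma measurePreserving_shift {φ : G.graph ≃g G.graph} (hφ : G.IsAut φ) (b : ℝ≥0) :
    MeasurePreserving (G.shift φ) (G.percolation b) (G.percolation b) := by
  refine ⟨measurable_pi_lambda _ fun e => measurable_pi_apply _, ?_⟩
  have h := Measure.infinitePi_map_piCongrLeft
    (μ := fun e => bernoulliMeasure true false (G.retentionProb b e)) φ.mapEdgeSet
  have h1 : ∀ e, G.retentionProb b (φ.mapEdgeSet e) = G.retentionProb b e := by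
    intro e
    simp only [retentionProb, hφ e]
  simp only [h1] at h
  have h2 : (MeasurableEquiv.piCongrLeft (fun _ : G.graph.edgeSet => Bool) φ.mapEdgeSet :
      (G.graph.edgeSet → Bool) → _) = G.shift φ := by
    funext ω e
    obtain ⟨e', rfl⟩ := φ.mapEdgeSet.surjective e
    simp only [MeasurableEquiv.coe_piCongrLeft, shift, Equiv.symm_apply_apply]
    exact Equiv.piCongrLeft_apply_apply (fun _ => Bool) φ.mapEdgeSet ω e'
  rw [h2] at h
  exact h

lemma mem_opn_shift {φ : G.graph ≃g G.graph} {ω : G.graph.edgeSet → Bool} {e : Sym2 V} :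
    e.map φ ∈ G.opn (G.shift φ ω) ↔ e ∈ G.opn ω := by
  have key : ∀ h : e ∈ G.graph.edgeSet, ∀ h' : e.map φ ∈ G.graph.edgeSet,
      G.shift φ ω ⟨e.map φ, h'⟩ = ω ⟨e, h⟩ := by
    intro h h'
    have : (⟨e.map φ, h'⟩ : G.graph.edgeSet) = φ.mapEdgeSet ⟨e, h⟩ := rfl
    rw [this, shift, Equiv.symm_apply_apply]
  have h : e.map φ ∈ G.graph.edgeSet ↔ e ∈ G.graph.edgeSet := by
    induction e with
    | h a b => simp [φ.map_adj_iff]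
  constructor
  · rintro ⟨h1, h2⟩
    exact ⟨h.1 h1, by rw [← key (h.1 h1) h1]; exact h2⟩
  · rintro ⟨h1, h2⟩
    exact ⟨h.2 h1, by rw [key h1 (h.2 h1)]; exact h2⟩

lemma conn_shift {φ : G.graph ≃g G.graph} {ω : G.graph.edgeSet → Bool} {x y : V} :
    Conn (G.opn (G.shift φ ω)) (φ x) (φ y) ↔ Conn (G.opn ω) x y := by
  constructor
  · intro h
    have : ∀ z, Conn (G.opn (G.shift φ ω)) (φ x) z → Conn (G.opn ω) x (φ.symm z) := by
      intro z hz
      induction hz with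
      | refl => rw [RelIso.symm_apply_apply]; exact .refl
      | @tail c d _ hcd ih =>
        refine ih.trans (.edge ?_)
        rw [← G.mem_opn_shift (φ := φ)]
        simpa using hcd
    simpa using this _ h
  · intro h
    induction h with
    | refl => exact .refl
    | @tail c d _ hcd ih => exact ih.trans (.edge ((G.mem_opn_shift (φ := φ)).2 hcd))

lemma K_shift {φ : G.graph ≃g G.graph} {ω : G.graph.edgeSet → Bool} {x : V} :
    K (G.opn (G.shift φ ω)) (φ x) = φ '' K (G.opn ω) x := by
  ext z
  obtain ⟨y, rfl⟩ := φ.surjective z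
  rw [φ.injective.mem_set_image]
  exact G.conn_shift

lemma ncard_K_shift {φ : G.graph ≃g G.graph} {ω : G.graph.edgeSet → Bool} {x : V} :
    (K (G.opn (G.shift φ ω)) (φ x)).ncard = (K (G.opn ω) x).ncard := by
  rw [K_shift]
  exact Set.ncard_image_of_injective _ φ.injective

lemma touches_shift {φ : G.graph ≃g G.graph} {ω : G.graph.edgeSet → Bool} {x : V} {e : Sym2 V} :
    Touches (K (G.opn (G.shift φ ω)) (φ x)) (e.map φ) ↔ Touches (K (G.opn ω) x) e := by
  rw [K_shift]
  constructor
  · rintro ⟨_, ⟨y, hy, rfl⟩, hye⟩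
    obtain ⟨z, hz, hzy⟩ := Sym2.mem_map.1 hye
    rw [φ.injective hzy] at hz
    exact ⟨y, hy, hz⟩
  · rintro ⟨y, hy, hye⟩
    exact ⟨φ y, ⟨y, hy, rfl⟩, Sym2.mem_map.2 ⟨y, hye, rfl⟩⟩

end Invariance

section Tails

variable {V : Type*} [Countable V] (G : WeightedGraph V)

lemma measurableSet_le_encard (x : V) (n : ℕ) :
    MeasurableSet {ω | (n : ℕ∞) ≤ (K (G.opn ω) x).encard} := by
  have : {ω | (n : ℕ∞) ≤ (K (G.opn ω) x).encard} = ⋃ k, {ω | n ≤ (K (G.tr k ω) x).ncard} := by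
    ext ω
    have := G.le_encard_iff (ω := ω) (x := x) (n := n) (L := Set.univ)
    simp only [Set.inter_univ] at this
    simp [this]
  rw [this]
  exact .iUnion fun k => measurableSet_setOfPred.2
    (G.measurable_comp_trace (exh V k) fun T => n ≤ (K (T : Set (Sym2 V)) x).ncard)

lemma measurable_ncard (x : V) : Measurable fun ω => (K (G.opn ω) x).ncard := by
  have hpos : ∀ m : ℕ, 1 ≤ m → MeasurableSet ((fun ω => (K (G.opn ω) x).ncard) ⁻¹' {m}) := by
    intro m hm
    have : (fun ω => (K (G.opn ω) x).ncard) ⁻¹' {m} =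
        {ω | (m : ℕ∞) ≤ (K (G.opn ω) x).encard} \ {ω | ((m + 1 : ℕ) : ℕ∞) ≤ (K (G.opn ω) x).encard} := by
      ext ω
      simp only [Set.mem_preimage, Set.mem_singleton_iff, Set.mem_sdiff, Set.mem_ofPred_eq, not_le]
      rcases (K (G.opn ω) x).finite_or_infinite with h | h
      · rw [← h.cast_ncard_eq]
        norm_cast
        omega
      · rw [h.ncard, h.encard_eq]
        simp
        omega
    rw [this]
    exact (G.measurableSet_le_encard x m).diff (G.measurableSet_le_encard x (m + 1))
  refine measurable_to_countable' fun m => ?_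
  rcases Nat.eq_zero_or_pos m with rfl | hm
  · have : (fun ω => (K (G.opn ω) x).ncard) ⁻¹' {0} =
        (⋃ m : ℕ, (fun ω => (K (G.opn ω) x).ncard) ⁻¹' {m + 1})ᶜ := by
      ext ω
      simp only [Set.mem_preimage, Set.mem_singleton_iff, Set.mem_compl_iff, Set.mem_iUnion, not_exists]
      constructor
      · intro h m; omega
      · intro h
        by_contra h0
        exact h _ (Nat.succ_pred_eq_of_ne_zero h0).symm
    rw [this]
    exact (MeasurableSet.iUnion fun m => hpos _ (by omega)).compl
  · exact hpos m hm

lemma tail_eq (htrans : G.IsTransitive) (b : ℝ≥0) (x y : V) (n : ℕ) :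
    G.tail b x n = G.tail b y n := by
  obtain ⟨φ, hφ, rfl⟩ := htrans x y
  unfold tail
  simp only [cluster_eq]
  rw [measureReal_def, measureReal_def, ← (G.measurePreserving_shift hφ b).measure_preimage
    (G.measurableSet_le_encard (φ x) n).nullMeasurableSet]
  congr 2
  ext ω
  simp only [Set.mem_preimage, Set.mem_ofPred_eq, K_shift]
  rw [φ.injective.encard_image]

lemma tail_nonneg (b : ℝ≥0) (x : V) (n : ℕ) : 0 ≤ G.tail b x n := measureReal_nonneg

lemma tail_one (b : ℝ≥0) (x : V) : G.tail b x 1 = 1 := by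
  have : {ω | ((1 : ℕ) : ℕ∞) ≤ (G.cluster ω x).encard} = Set.univ := by
    refine Set.eq_univ_of_forall fun ω => ?_
    rw [Set.mem_ofPred_eq, Nat.cast_one, Set.one_le_encard_iff_nonempty, cluster_eq]
    exact ⟨x, mem_K_self⟩
  rw [tail, this]
  exact probReal_univ

/-- There is no infinite cluster once the tail of the cluster size at one vertex tends to `0`. -/
lemma noInfiniteCluster_of_tail (htrans : G.IsTransitive) {b : ℝ≥0} {o : V}
    (h : Tendsto (G.tail b o) atTop (nhds 0)) : G.NoInfiniteCluster b := by
  refine ae_all_iff.2 fun v => ?_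
  have h0 : (G.percolation b).real {ω | ¬ (G.cluster ω v).Finite} ≤ 0 := by
    refine ge_of_tendsto h (.of_forall fun n => ?_)
    rw [G.tail_eq htrans b o v]
    refine measureReal_mono (fun ω hω => ?_) (measure_ne_top _ _)
    rw [Set.mem_ofPred_eq, Set.Infinite.encard_eq hω]
    exact le_top
  have h1 := le_antisymm h0 measureReal_nonneg
  rw [measureReal_def, ENNReal.toReal_eq_zero_iff] at h1
  exact h1.resolve_right (measure_ne_top _ _)

end Tails

/-! ### Heavy edges -/

section Heavy

variable {V : Type*} (G : WeightedGraph V)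

lemma finite_nbr {ε : ℝ} (hε : 0 < ε) (x : V) : {y | ε ≤ G.wt s(x, y)}.Finite := by
  have h1 : {e : {e : G.graph.edgeSet // x ∈ (e : Sym2 V)} | ε ≤ G.J e}.Finite := by
    have := (G.summable_J x).tendsto_cofinite_zero.eventually (gt_mem_nhds hε)
    rw [eventually_cofinite] at this
    refine this.subset fun e he => ?_
    simpa using he
  refine Set.Finite.of_finite_image (f := fun y => s(x, y)) ((h1.image
    fun e : {e : G.graph.edgeSet // x ∈ (e : Sym2 V)} => ((e : G.graph.edgeSet) : Sym2 V)).subset ?_)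
    fun a _ b _ h => Sym2.congr_right.1 h
  rintro _ ⟨y, hy, rfl⟩
  have hy' : ε ≤ G.wt s(x, y) := hy
  by_cases he : s(x, y) ∈ G.graph.edgeSet
  · refine ⟨⟨⟨s(x, y), he⟩, Sym2.mem_mk_left x y⟩, ?_, rfl⟩
    rw [wt, dif_pos he] at hy'
    exact hy'
  · rw [wt, dif_neg he] at hy'
    linarith

/-- The vertices joined to `x` by an edge of weight at least `ε`; for `ε ≤ 0` the value is junk. -/
noncomputable def nbr (ε : ℝ) (x : V) : Finset V :=
  if h : 0 < ε then (G.finite_nbr h x).toFinset else ∅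

lemma mem_nbr {ε : ℝ} (hε : 0 < ε) {x y : V} : y ∈ G.nbr ε x ↔ ε ≤ G.wt s(x, y) := by
  simp [nbr, hε]

lemma card_nbr {ε : ℝ} (hε : 0 < ε) (x : V) :
    {e : G.graph.edgeSet | x ∈ (e : Sym2 V) ∧ ε ≤ G.J e}.ncard = (G.nbr ε x).card := by
  rw [← Set.ncard_coe_finset, ← Set.ncard_image_of_injective _ (Subtype.val_injective (p := (· ∈ G.graph.edgeSet))),
    ← Set.ncard_image_of_injective (G.nbr ε x : Set V) (f := fun y => s(x, y)) fun a b h => Sym2.congr_right.1 h]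
  congr 1
  ext e
  constructor
  · rintro ⟨⟨e, he⟩, ⟨hx, hJ⟩, rfl⟩
    obtain ⟨y, rfl⟩ := Sym2.mem_iff_exists.1 hx
    refine ⟨y, (G.mem_nbr hε).2 ?_, rfl⟩
    rw [wt, dif_pos he]
    exact hJ
  · rintro ⟨y, hy, rfl⟩
    have hy := (G.mem_nbr hε).1 hy
    by_cases he : s(x, y) ∈ G.graph.edgeSet
    · rw [wt, dif_pos he] at hy
      exact ⟨⟨_, he⟩, ⟨Sym2.mem_mk_left x y, hy⟩, rfl⟩
    · rw [wt, dif_neg he] at hy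
      linarith

lemma wt_pos_mem {e : Sym2 V} (h : 0 < G.wt e) : e ∈ G.graph.edgeSet := by
  by_contra he
  rw [wt, dif_neg he] at h
  exact lt_irrefl _ h

lemma card_nbr_eq (htrans : G.IsTransitive) {ε : ℝ} (hε : 0 < ε) (x y : V) :
    (G.nbr ε x).card = (G.nbr ε y).card := by
  obtain ⟨φ, hφ, rfl⟩ := htrans x y
  refine Finset.card_bij (fun z _ => φ z) ?_ (fun a _ b _ h => φ.injective h) ?_
  · intro z hz
    rw [mem_nbr G hε] at hz ⊢
    rwa [← G.wt_map hφ s(x, z)] at hz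
  · intro z hz
    obtain ⟨z, rfl⟩ := φ.surjective z
    refine ⟨z, ?_, rfl⟩
    rw [mem_nbr G hε] at hz ⊢
    rwa [← G.wt_map hφ s(x, z)]

end Heavy

/-! ### Transporting the boundary mass of clusters -/

section TwoGhost

open scoped Classical

/-- The weight `1 / max n k` given to each vertex of a cluster of size `k`. -/
noncomputable def vtxMass (n k : ℕ) : ℝ := 1 / (max n k : ℕ)

/-- The total weight `min 1 (k / n)` of a cluster of size `k`. -/
noncomputable def cluMass (n k : ℕ) : ℝ := k * vtxMass n k

lemma vtxMass_nonneg (n k : ℕ) : 0 ≤ vtxMass n k := by unfold vtxMass; positivity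

lemma vtxMass_antitone {n : ℕ} (hn : 1 ≤ n) : Antitone (vtxMass n) := by
  intro a b h
  unfold vtxMass
  have h1 : (0 : ℝ) < (max n a : ℕ) := by
    have : 0 < max n a := lt_max_of_lt_left hn
    exact_mod_cast this
  exact one_div_le_one_div_of_le h1 (by exact_mod_cast max_le_max_left n h)

lemma cluMass_nonneg (n k : ℕ) : 0 ≤ cluMass n k := mul_nonneg (Nat.cast_nonneg _) (vtxMass_nonneg n k)

lemma cluMass_le_one (n k : ℕ) : cluMass n k ≤ 1 := by
  unfold cluMass vtxMass
  rw [mul_one_div]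
  exact div_le_one_of_le₀ (by exact_mod_cast le_max_right n k) (Nat.cast_nonneg _)

lemma cluMass_eq_one {n k : ℕ} (hn : 1 ≤ n) (h : n ≤ k) : cluMass n k = 1 := by
  unfold cluMass vtxMass
  rw [max_eq_right h, mul_one_div]
  have : (k : ℝ) ≠ 0 := by
    have : k ≠ 0 := by omega
    exact_mod_cast this
  exact div_self this

lemma cluMass_add {n : ℕ} (hn : 1 ≤ n) (a b : ℕ) :
    cluMass n (a + b) + (if n ≤ a ∧ n ≤ b then 1 else 0) ≤ cluMass n a + cluMass n b := by
  split_ifs with h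
  · rw [cluMass_eq_one hn h.1, cluMass_eq_one hn h.2]
    linarith [cluMass_le_one n (a + b)]
  · have h1 := vtxMass_antitone hn (Nat.le_add_right a b)
    have h2 := vtxMass_antitone hn (Nat.le_add_left b a)
    unfold cluMass
    push_cast
    nlinarith [mul_le_mul_of_nonneg_left h1 (Nat.cast_nonneg (α := ℝ) a),
      mul_le_mul_of_nonneg_left h2 (Nat.cast_nonneg (α := ℝ) b)]

variable {V : Type*}

lemma edgeMass_nonneg (n : ℕ) (T : Set (Sym2 V)) (x y : V) : 0 ≤ edgeMass (cluMass n) T x y := by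
  unfold edgeMass
  have h1 := cluMass_nonneg n (K T x).ncard
  have h2 := cluMass_nonneg n (K T y).ncard
  split_ifs <;> linarith

lemma edgeMass_le_two (n : ℕ) (T : Set (Sym2 V)) (x y : V) : edgeMass (cluMass n) T x y ≤ 2 := by
  unfold edgeMass
  have h1 := cluMass_le_one n (K T x).ncard
  have h2 := cluMass_le_one n (K T y).ncard
  split_ifs <;> linarith

/-- Summing the vertex weights over the clusters touching an edge gives `edgeMass`. -/
lemma tsum_vtxMass_eq {n : ℕ} {T : Set (Sym2 V)} {x y : V} (hx : (K T x).Finite) (hy : (K T y).Finite) :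
    ∑' z, (if Touches (K T z) s(x, y) then ENNReal.ofReal (vtxMass n (K T z).ncard) else 0) =
      ENNReal.ofReal (edgeMass (cluMass n) T x y) := by
  have hone : ∀ x, (K T x).Finite →
      ∑' z, (if z ∈ K T x then ENNReal.ofReal (vtxMass n (K T z).ncard) else 0) =
        ENNReal.ofReal (cluMass n (K T x).ncard) := by
    intro x hx
    rw [tsum_eq_sum (s := hx.toFinset)]
    · have : ∀ z ∈ hx.toFinset, (if z ∈ K T x then ENNReal.ofReal (vtxMass n (K T z).ncard) else 0) =
          ENNReal.ofReal (vtxMass n (K T x).ncard) := by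
        intro z hz
        have hz' : z ∈ K T x := hx.mem_toFinset.1 hz
        rw [if_pos hz', K_eq hz']
      rw [Finset.sum_congr rfl this, Finset.sum_const, nsmul_eq_mul, cluMass,
        ENNReal.ofReal_mul (Nat.cast_nonneg _), ENNReal.ofReal_natCast, Set.ncard_eq_toFinset_card _ hx]
    · intro z hz
      rw [if_neg (fun h => hz (hx.mem_toFinset.2 h))]
  have htouch : ∀ z, Touches (K T z) s(x, y) ↔ z ∈ K T x ∨ z ∈ K T y := by
    intro z
    constructor
    · rintro ⟨v, hv, hve⟩
      rcases Sym2.mem_iff.1 hve with rfl | rfl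
      · exact Or.inl (mem_K_comm.1 hv)
      · exact Or.inr (mem_K_comm.1 hv)
    · rintro (h | h)
      · exact ⟨x, mem_K_comm.1 h, Sym2.mem_mk_left x y⟩
      · exact ⟨y, mem_K_comm.1 h, Sym2.mem_mk_right x y⟩
  simp only [htouch]
  unfold edgeMass
  by_cases h : y ∈ K T x
  · rw [if_pos h, add_zero, ← K_eq h]
    simp only [or_self]
    exact hone x hx
  · rw [if_neg h, ENNReal.ofReal_add (cluMass_nonneg _ _) (cluMass_nonneg _ _), ← hone x hx, ← hone y hy,
      ← ENNReal.tsum_add]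
    refine tsum_congr fun z => ?_
    have : ¬ (z ∈ K T x ∧ z ∈ K T y) := fun ⟨h1, h2⟩ => h (Conn.trans h1 (Conn.symm h2))
    split_ifs <;> first | simp; done | tauto

lemma tsum_mem_edge {e : Sym2 V} (he : ¬ e.IsDiag) (c : ℝ≥0∞) :
    ∑' y : V, (if y ∈ e then c else 0) = 2 * c := by
  induction e with
  | h a b =>
    have hab : a ≠ b := he
    rw [tsum_eq_sum (s := {a, b})]
    · rw [Finset.sum_pair hab]
      simp [two_mul]
    · intro y hy
      rw [if_neg]
      simpa using hy

variable (G : WeightedGraph V)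

/-- The bijection of unordered pairs induced by an automorphism. -/
def pairEquiv (φ : G.graph ≃g G.graph) : Sym2 V ≃ Sym2 V where
  toFun := Sym2.map φ
  invFun := Sym2.map φ.symm
  left_inv e := by
    rw [Sym2.map_map]
    have : (φ.symm ∘ φ : V → V) = id := by ext; simp
    rw [this, Sym2.map_id, id]
  right_inv e := by
    rw [Sym2.map_map]
    have : (φ ∘ φ.symm : V → V) = id := by ext; simp
    rw [this, Sym2.map_id, id]

/-- The mass `∑ X e` over the edges `e` touching the cluster of `o`, times the vertex weight, in
`ℝ≥0∞` so that it is defined for infinite clusters as well. -/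
noncomputable def bdMass (n : ℕ) (X : (G.graph.edgeSet → Bool) → Sym2 V → ℝ) (o : V)
    (ω : G.graph.edgeSet → Bool) : ℝ≥0∞ :=
  ENNReal.ofReal (vtxMass n (K (G.opn ω) o).ncard) *
    ∑' e, if Touches (K (G.opn ω) o) e then ENNReal.ofReal (X ω e) else 0

variable [Countable V]

lemma measurableSet_touches (x : V) (e : Sym2 V) :
    MeasurableSet {ω | Touches (K (G.opn ω) x) e} := by
  have : {ω | Touches (K (G.opn ω) x) e} = ⋃ z ∈ {z | z ∈ e}, {ω | Conn (G.opn ω) x z} := by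
    ext ω
    simp only [Touches, Set.mem_ofPred_eq, Set.mem_iUnion, exists_prop]
    exact ⟨fun ⟨z, h1, h2⟩ => ⟨z, h2, h1⟩, fun ⟨z, h1, h2⟩ => ⟨z, h2, h1⟩⟩
  rw [this]
  exact .biUnion (Set.to_countable _) fun z _ => G.measurableSet_conn x z

lemma measurable_vtxMass (n : ℕ) (x : V) :
    Measurable fun ω => vtxMass n (K (G.opn ω) x).ncard :=
  (measurable_from_top (f := vtxMass n)).comp (G.measurable_ncard x)

lemma measurable_edgeMass (n : ℕ) (x y : V) :
    Measurable fun ω => edgeMass (cluMass n) (G.opn ω) x y := by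
  unfold edgeMass
  refine Measurable.add ((measurable_from_top (f := cluMass n)).comp (G.measurable_ncard x)) ?_
  exact Measurable.ite (G.measurableSet_conn x y) measurable_const
    ((measurable_from_top (f := cluMass n)).comp (G.measurable_ncard y))

variable {G}

lemma measurable_bdMass {n : ℕ} {X : (G.graph.edgeSet → Bool) → Sym2 V → ℝ}
    (hXm : ∀ e, Measurable fun ω => X ω e) (o : V) : Measurable (G.bdMass n X o) := by
  refine (G.measurable_vtxMass n o).ennreal_ofReal.mul (Measurable.tsum fun e => ?_)
  exact Measurable.ite (G.measurableSet_touches o e) (hXm e).ennreal_ofReal measurable_const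

/-- Mass transport for an invariant, nonnegative observable `X` of the heavy edges: each vertex `x`
sends the mass `vtxMass * X e` to both endpoints of every edge `e` touching its cluster. -/
lemma two_mul_lintegral_bdMass (htrans : G.IsTransitive) (hunimod : G.IsUnimodular) {b : ℝ≥0}
    (hfin : ∀ᵐ ω ∂(G.percolation b), ∀ v, (K (G.opn ω) v).Finite) {ε : ℝ} (hε : 0 < ε) (n : ℕ)
    {X : (G.graph.edgeSet → Bool) → Sym2 V → ℝ} (hXm : ∀ e, Measurable fun ω => X ω e)
    (hXinv : ∀ φ : G.graph ≃g G.graph, G.IsAut φ → ∀ ω e, X (G.shift φ ω) (e.map φ) = X ω e)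
    (hXsupp : ∀ ω e, ¬ ε ≤ G.wt e → X ω e = 0) (o : V) :
    2 * ∫⁻ ω, G.bdMass n X o ω ∂(G.percolation b) =
      ∑ y ∈ G.nbr ε o, ∫⁻ ω, ENNReal.ofReal (X ω s(o, y)) *
        ENNReal.ofReal (edgeMass (cluMass n) (G.opn ω) o y) ∂(G.percolation b) := by
  set P := G.percolation b with hP
  set m : (G.graph.edgeSet → Bool) → V → V → Sym2 V → ℝ≥0∞ := fun ω x y e =>
    if y ∈ e then (if Touches (K (G.opn ω) x) e then
      ENNReal.ofReal (vtxMass n (K (G.opn ω) x).ncard) * ENNReal.ofReal (X ω e) else 0) else 0 with hm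
  have hmm : ∀ x y e, Measurable fun ω => m ω x y e := by
    intro x y e
    simp only [hm]
    split_ifs
    · exact Measurable.ite (G.measurableSet_touches x e)
        ((G.measurable_vtxMass n x).ennreal_ofReal.mul (hXm e).ennreal_ofReal) measurable_const
    · exact measurable_const
  have hnotdiag : ∀ ω e, e.IsDiag → X ω e = 0 := by
    intro ω e he
    refine hXsupp ω e fun h => ?_
    exact G.graph.not_isDiag_of_mem_edgeSet (G.wt_pos_mem (hε.trans_le h)) he
  have hmtp := tsum_mass_eq htrans hunimod (f := fun x y => ∫⁻ ω, ∑' e, m ω x y e ∂P) ?_ o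
  · have hL : ∑' y, ∫⁻ ω, ∑' e, m ω o y e ∂P = 2 * ∫⁻ ω, G.bdMass n X o ω ∂P := by
      rw [← lintegral_tsum fun y => (Measurable.tsum (hmm o y)).aemeasurable,
        ← lintegral_const_mul _ (measurable_bdMass hXm o)]
      refine lintegral_congr fun ω => ?_
      rw [ENNReal.tsum_comm, bdMass, ← ENNReal.tsum_mul_left, ← ENNReal.tsum_mul_left]
      refine tsum_congr fun e => ?_
      simp only [hm]
      by_cases he : e.IsDiag
      · simp [hnotdiag ω e he]
      · rw [tsum_mem_edge he]
        split_ifs <;> simp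
    have hR : ∑' x, ∫⁻ ω, ∑' e, m ω x o e ∂P = ∑ y ∈ G.nbr ε o, ∫⁻ ω, ENNReal.ofReal (X ω s(o, y)) *
        ENNReal.ofReal (edgeMass (cluMass n) (G.opn ω) o y) ∂P := by
      have hmeas : ∀ y ∈ G.nbr ε o, Measurable fun ω => ENNReal.ofReal (X ω s(o, y)) *
          ENNReal.ofReal (edgeMass (cluMass n) (G.opn ω) o y) := fun y _ =>
        (hXm _).ennreal_ofReal.mul (G.measurable_edgeMass n o y).ennreal_ofReal
      rw [← lintegral_tsum fun x => (Measurable.tsum (hmm x o)).aemeasurable,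
        ← lintegral_finsetSum _ hmeas]
      refine lintegral_congr_ae ?_
      filter_upwards [hfin] with ω hω
      rw [ENNReal.tsum_comm, tsum_eq_sum (s := (G.nbr ε o).image fun y => s(o, y)),
        Finset.sum_image fun a _ c _ h => Sym2.congr_right.1 h]
      · refine Finset.sum_congr rfl fun y _ => ?_
        rw [← tsum_vtxMass_eq (hω o) (hω y), ← ENNReal.tsum_mul_left]
        refine tsum_congr fun z => ?_
        simp only [hm, Sym2.mem_mk_left, if_true]
        split_ifs
        · rw [mul_comm]
        · simp
      · intro e he
        refine ENNReal.tsum_eq_zero.2 fun x => ?_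
        simp only [hm]
        split_ifs with h1 h2
        · rw [hXsupp ω e, ENNReal.ofReal_zero, mul_zero]
          intro h
          obtain ⟨y, rfl⟩ := Sym2.mem_iff_exists.1 h1
          exact he (Finset.mem_image.2 ⟨y, (G.mem_nbr hε).2 h, rfl⟩)
        · rfl
        · rfl
    rw [← hL, ← hR]
    exact hmtp
  · intro φ hφ x y
    rw [← (G.measurePreserving_shift hφ b).lintegral_comp (Measurable.tsum (hmm (φ x) (φ y)))]
    refine lintegral_congr fun ω => ?_
    rw [← (G.pairEquiv φ).tsum_eq]
    refine tsum_congr fun e => ?_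
    have h1 : φ y ∈ (G.pairEquiv φ) e ↔ y ∈ e := by
      change φ y ∈ e.map φ ↔ _
      rw [Sym2.mem_map]
      exact ⟨fun ⟨z, hz, hzy⟩ => φ.injective hzy ▸ hz, fun h => ⟨y, h, rfl⟩⟩
    have h2 : Touches (K (G.opn (G.shift φ ω)) (φ x)) ((G.pairEquiv φ) e) ↔
        Touches (K (G.opn ω) x) e := G.touches_shift
    have h3 : X (G.shift φ ω) ((G.pairEquiv φ) e) = X ω e := hXinv φ hφ ω e
    simp only [hm, h1, h2, h3, ncard_K_shift]

/-- The real-valued form of the mass-transport identity, for bounded observables. -/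
lemma integral_bdMass (htrans : G.IsTransitive) (hunimod : G.IsUnimodular) {b : ℝ≥0}
    (hfin : ∀ᵐ ω ∂(G.percolation b), ∀ v, (K (G.opn ω) v).Finite) {ε : ℝ} (hε : 0 < ε) (n : ℕ)
    {X : (G.graph.edgeSet → Bool) → Sym2 V → ℝ} {c : ℝ} (hXm : ∀ e, Measurable fun ω => X ω e)
    (hX0 : ∀ ω e, 0 ≤ X ω e) (hXc : ∀ ω e, X ω e ≤ c)
    (hXinv : ∀ φ : G.graph ≃g G.graph, G.IsAut φ → ∀ ω e, X (G.shift φ ω) (e.map φ) = X ω e)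
    (hXsupp : ∀ ω e, ¬ ε ≤ G.wt e → X ω e = 0) (o : V) :
    Integrable (fun ω => (G.bdMass n X o ω).toReal) (G.percolation b) ∧
    2 * ∫ ω, (G.bdMass n X o ω).toReal ∂(G.percolation b) =
      ∑ y ∈ G.nbr ε o, ∫ ω, X ω s(o, y) * edgeMass (cluMass n) (G.opn ω) o y ∂(G.percolation b) := by
  set P := G.percolation b with hP
  have hmain := two_mul_lintegral_bdMass htrans hunimod hfin hε n hXm hXinv hXsupp o
  have hc : 0 ≤ c := by
    have := nonempty_of_isProbabilityMeasure P
    exact (hX0 (Classical.arbitrary _) s(o, o)).trans (hXc _ _)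
  have hint : ∀ y, Integrable (fun ω => X ω s(o, y) * edgeMass (cluMass n) (G.opn ω) o y) P := by
    intro y
    refine Integrable.of_bound (C := c * 2)
      ((hXm _).mul (G.measurable_edgeMass n o y)).aestronglyMeasurable (.of_forall fun ω => ?_)
    rw [Real.norm_of_nonneg (mul_nonneg (hX0 _ _) (edgeMass_nonneg _ _ _ _))]
    exact mul_le_mul (hXc _ _) (edgeMass_le_two _ _ _ _) (edgeMass_nonneg _ _ _ _) hc
  have hterm : ∀ y, ∫⁻ ω, ENNReal.ofReal (X ω s(o, y)) *
      ENNReal.ofReal (edgeMass (cluMass n) (G.opn ω) o y) ∂P =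
        ENNReal.ofReal (∫ ω, X ω s(o, y) * edgeMass (cluMass n) (G.opn ω) o y ∂P) := by
    intro y
    rw [ofReal_integral_eq_lintegral_ofReal (hint y) (.of_forall fun ω =>
      mul_nonneg (hX0 _ _) (edgeMass_nonneg _ _ _ _))]
    exact lintegral_congr fun ω => (ENNReal.ofReal_mul (hX0 _ _)).symm
  rw [← hP] at hmain
  simp only [hterm] at hmain
  have hpos : ∀ y ∈ G.nbr ε o, 0 ≤ ∫ ω, X ω s(o, y) * edgeMass (cluMass n) (G.opn ω) o y ∂P :=
    fun y _ => integral_nonneg fun ω => mul_nonneg (hX0 _ _) (edgeMass_nonneg _ _ _ _)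
  rw [← ENNReal.ofReal_sum_of_nonneg hpos] at hmain
  have hne : ∫⁻ ω, G.bdMass n X o ω ∂P ≠ ⊤ := by
    intro h
    rw [h] at hmain
    simp at hmain
  refine ⟨integrable_toReal_of_lintegral_ne_top (measurable_bdMass hXm o).aemeasurable hne, ?_⟩
  rw [integral_toReal (measurable_bdMass hXm o).aemeasurable
    (ae_lt_top (measurable_bdMass hXm o) hne)]
  have := congrArg ENNReal.toReal hmain
  rw [ENNReal.toReal_mul, ENNReal.toReal_ofReal (Finset.sum_nonneg hpos)] at this
  simpa using this

end TwoGhost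

/-! ### The two-ghost inequality -/

section TwoGhostInequality

open scoped Classical

lemma integral_le_of_tendsto_of_abs_le {Ω : Type*} [MeasurableSpace Ω] {P : Measure Ω}
    {h : Ω → ℝ} {f : ℕ → Ω → ℝ} {B : ℝ} (hf : ∀ k, Integrable (f k) P)
    (hlim : ∀ᵐ ω ∂P, Tendsto (fun k => f k ω) atTop (nhds (h ω)))
    (hB : ∀ k, ∫ ω, |f k ω| ∂P ≤ B) : ∫ ω, h ω ∂P ≤ B := by
  have hB0 : 0 ≤ B := (integral_nonneg fun _ => abs_nonneg _).trans (hB 0)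
  have h1 : ∫⁻ ω, ‖h ω‖ₑ ∂P ≤ liminf (fun k => ∫⁻ ω, ‖f k ω‖ₑ ∂P) atTop := by
    have := lintegral_liminf_le' (μ := P) (f := fun k ω => ‖f k ω‖ₑ) (u := atTop)
      fun k => (hf k).aestronglyMeasurable.enorm
    refine le_trans (le_of_eq (lintegral_congr_ae ?_)) this
    filter_upwards [hlim] with ω hω using hω.enorm.liminf_eq.symm
  have h2 : ∀ k, ∫⁻ ω, ‖f k ω‖ₑ ∂P ≤ ENNReal.ofReal B := by
    intro k
    rw [← ofReal_integral_norm_eq_lintegral_enorm (hf k)]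
    exact ENNReal.ofReal_le_ofReal (hB k)
  have h3 : ∫⁻ ω, ‖h ω‖ₑ ∂P ≤ ENNReal.ofReal B :=
    h1.trans ((liminf_le_liminf (.of_forall h2)).trans (by simp))
  have h4 := (enorm_integral_le_lintegral_enorm h).trans h3
  rw [Real.enorm_eq_ofReal_abs] at h4
  exact (le_abs_self _).trans ((ENNReal.ofReal_le_ofReal_iff hB0).1 h4)

variable {V : Type*} (G : WeightedGraph V)

/-- The fluctuation weight of a closed edge: `1` on edges of weight at least `ε`. -/
noncomputable def closedWt (ε : ℝ) (e : Sym2 V) : ℝ := if ε ≤ G.wt e then 1 else 0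

/-- The fluctuation weight of an open edge, chosen so that the fluctuation of an edge of weight at
least `ε` has mean zero. -/
noncomputable def openWt (b : ℝ≥0) (ε : ℝ) (e : Sym2 V) : ℝ :=
  if ε ≤ G.wt e then (1 - prob G.wt b e) / prob G.wt b e else 0

variable {G} {b : ℝ≥0} {ε : ℝ}

lemma prob_pos (hb : 0 < b) (hε : 0 < ε) {e : Sym2 V} (he : ε ≤ G.wt e) : 0 < prob G.wt b e := by
  unfold prob
  have h1 : 0 < (b : ℝ) * G.wt e := mul_pos (by exact_mod_cast hb) (hε.trans_le he)
  have h2 : Real.exp (-(b * G.wt e)) < 1 := by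
    rw [← Real.exp_zero]; exact Real.exp_lt_exp.2 (by linarith)
  linarith

lemma mean_zero (hb : 0 < b) (hε : 0 < ε) (e : Sym2 V) :
    (1 - prob G.wt b e) * G.closedWt ε e = prob G.wt b e * G.openWt b ε e := by
  unfold closedWt openWt
  split_ifs with h
  · have := prob_pos hb hε h
    field_simp
  · simp

lemma openWt_nonneg (hb : 0 < b) (hε : 0 < ε) (e : Sym2 V) : 0 ≤ G.openWt b ε e := by
  unfold openWt
  split_ifs with h
  · have := prob_pos hb hε h
    have := (prob_mem G.wt_nonneg b.2 e).2
    exact div_nonneg (sub_nonneg.2 this) (prob_pos hb hε h).le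
  · exact le_rfl

lemma openWt_le (hb : 0 < b) (hε : 0 < ε) (e : Sym2 V) : G.openWt b ε e ≤ 1 / (b * ε) := by
  have hb' : (0 : ℝ) < b := by exact_mod_cast hb
  unfold openWt
  split_ifs with h
  · have hp := prob_pos hb hε h
    rw [div_le_div_iff₀ hp (by positivity), one_mul]
    have hx : b * ε ≤ b * G.wt e := mul_le_mul_of_nonneg_left h hb'.le
    have h1 : 0 ≤ 1 - prob G.wt b e := sub_nonneg.2 (prob_mem G.wt_nonneg b.2 e).2
    refine (mul_le_mul_of_nonneg_left hx h1).trans ?_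
    -- `x e⁻ˣ ≤ 1 - e⁻ˣ` is `1 + x ≤ eˣ`
    have h2 : 1 - prob G.wt b e = Real.exp (-(b * G.wt e)) := by simp [prob]
    rw [h2, prob]
    have h3 := Real.add_one_le_exp (b * G.wt e)
    have h4 := Real.exp_pos (-(b * G.wt e))
    have h5 : Real.exp (-(b * G.wt e)) * Real.exp (b * G.wt e) = 1 := by
      rw [← Real.exp_add]; simp
    nlinarith
  · positivity

lemma variance_le (hb : 0 < b) (hε : 0 < ε) (e : Sym2 V) :
    (1 - prob G.wt b e) * G.closedWt ε e ^ 2 + prob G.wt b e * G.openWt b ε e ^ 2 ≤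
      if ε ≤ G.wt e then 1 / (b * ε) else 0 := by
  by_cases h : ε ≤ G.wt e
  · have hp := prob_pos hb hε h
    have h1 : (1 - prob G.wt b e) * G.closedWt ε e ^ 2 + prob G.wt b e * G.openWt b ε e ^ 2 =
        G.openWt b ε e := by
      unfold closedWt openWt
      rw [if_pos h, if_pos h]
      field_simp
      ring
    rw [h1, if_pos h]
    exact openWt_le hb hε e
  · simp [closedWt, openWt, h]

lemma variance_nonneg (e : Sym2 V) :
    0 ≤ (1 - prob G.wt b e) * G.closedWt ε e ^ 2 + prob G.wt b e * G.openWt b ε e ^ 2 := by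
  have h := prob_mem G.wt_nonneg b.2 e
  exact add_nonneg (mul_nonneg (sub_nonneg.2 h.2) (sq_nonneg _)) (mul_nonneg h.1 (sq_nonneg _))

lemma sum_variance_le (hb : 0 < b) (hε : 0 < ε) (F : Finset (Sym2 V)) (x : V) :
    ∑ e ∈ F with x ∈ e, ((1 - prob G.wt b e) * G.closedWt ε e ^ 2
      + prob G.wt b e * G.openWt b ε e ^ 2) ≤ (G.nbr ε x).card / (b * ε) := by
  have hb' : (0 : ℝ) < b := by exact_mod_cast hb
  refine (Finset.sum_le_sum fun e _ => variance_le hb hε e).trans ?_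
  rw [← Finset.sum_filter, Finset.sum_const, nsmul_eq_mul, mul_one_div]
  refine div_le_div_of_nonneg_right ?_ (by positivity)
  have hsub : (F.filter fun e => x ∈ e).filter (fun e => ε ≤ G.wt e) ⊆
      (G.nbr ε x).image fun y => s(x, y) := by
    intro e he
    obtain ⟨he1, he2⟩ := Finset.mem_filter.1 he
    obtain ⟨y, rfl⟩ := Sym2.mem_iff_exists.1 (Finset.mem_filter.1 he1).2
    exact Finset.mem_image.2 ⟨y, (G.mem_nbr hε).2 he2, rfl⟩
  exact_mod_cast (Finset.card_le_card hsub).trans Finset.card_image_le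

/-- The heavy edges touching the finite set `C`. -/
noncomputable def heavyEdges (G : WeightedGraph V) (ε : ℝ) (C : Finset V) : Finset (Sym2 V) :=
  C.biUnion fun x => (G.nbr ε x).image fun y => s(x, y)

lemma mem_heavyEdges (hε : 0 < ε) {C : Finset V} {e : Sym2 V} :
    e ∈ G.heavyEdges ε C ↔ ε ≤ G.wt e ∧ Touches (C : Set V) e := by
  simp only [heavyEdges, Finset.mem_biUnion, Finset.mem_image, G.mem_nbr hε, Touches, Finset.mem_coe]
  constructor
  · rintro ⟨x, hx, y, hy, rfl⟩
    exact ⟨hy, x, hx, Sym2.mem_mk_left x y⟩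
  · rintro ⟨h, x, hx, hxe⟩
    obtain ⟨y, rfl⟩ := Sym2.mem_iff_exists.1 hxe
    exact ⟨x, hx, y, h, rfl⟩

variable [Countable V]

lemma toReal_bdMass (hε : 0 < ε) {n : ℕ} {X : (G.graph.edgeSet → Bool) → Sym2 V → ℝ}
    (hX0 : ∀ ω e, 0 ≤ X ω e) (hXsupp : ∀ ω e, ¬ ε ≤ G.wt e → X ω e = 0) {o : V}
    {ω : G.graph.edgeSet → Bool} (hfin : (K (G.opn ω) o).Finite) :
    (G.bdMass n X o ω).toReal =
      vtxMass n (K (G.opn ω) o).ncard * ∑ e ∈ G.heavyEdges ε hfin.toFinset, X ω e := by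
  rw [bdMass, tsum_eq_sum (s := G.heavyEdges ε hfin.toFinset)]
  · rw [ENNReal.toReal_mul, ENNReal.toReal_ofReal (vtxMass_nonneg _ _)]
    congr 1
    rw [ENNReal.toReal_sum fun e _ => by split_ifs <;> simp]
    refine Finset.sum_congr rfl fun e he => ?_
    have h := ((mem_heavyEdges hε).1 he).2
    rw [hfin.coe_toFinset] at h
    rw [if_pos h, ENNReal.toReal_ofReal (hX0 _ _)]
  · intro e he
    split_ifs with h
    · rw [hXsupp ω e, ENNReal.ofReal_zero]
      intro h'
      refine he ((mem_heavyEdges hε).2 ⟨h', ?_⟩)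
      rwa [hfin.coe_toFinset]
    · rfl

/-- Expectations of uniformly bounded finite-volume functions converge along with the functions. -/
lemma tendsto_Ex {f : ℕ → Finset (Sym2 V) → ℝ} {g : (G.graph.edgeSet → Bool) → ℝ} {C : ℝ}
    (hC : ∀ k T, |f k T| ≤ C)
    (hlim : ∀ᵐ ω ∂(G.percolation b), Tendsto (fun k => f k (G.trace (exh V k) ω)) atTop (nhds (g ω))) :
    Tendsto (fun k => Ex (exh V k) (prob G.wt b) (f k)) atTop (nhds (∫ ω, g ω ∂(G.percolation b))) := by
  simp only [← G.integral_comp_trace b]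
  refine tendsto_integral_of_dominated_convergence (fun _ => C)
    (fun k => (G.measurable_comp_trace _ _).aestronglyMeasurable) (integrable_const _)
    (fun k => .of_forall fun ω => ?_) hlim
  exact hC _ _

/-- **Two-ghost inequality**: a bound on the expected number of heavy edges at `o` that join two
distinct clusters with at least `n` vertices each. -/
theorem sum_two_ghost_le (htrans : G.IsTransitive) (hunimod : G.IsUnimodular) (hb : 0 < b)
    (hfin : ∀ᵐ ω ∂(G.percolation b), ∀ v, (K (G.opn ω) v).Finite) (hε : 0 < ε) {n : ℕ} (hn : 1 ≤ n)
    (o : V) {R : ℝ}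
    (hR : ∀ m, ∑ j ∈ Finset.Icc 1 m, vtxMass n j / √j * G.tail b o j ≤ R) :
    ∑ y ∈ G.nbr ε o, (G.percolation b).real {ω | y ∉ K (G.opn ω) o ∧
        n ≤ (K (G.opn ω) o).ncard ∧ n ≤ (K (G.opn ω) y).ncard} ≤
      2 * √((G.nbr ε o).card / (b * ε)) * R := by
  set P := G.percolation b with hP
  set u := G.closedWt ε with hu
  set w := G.openWt b ε with hw
  set p := prob G.wt b with hp
  have hb' : (0 : ℝ) < b := by exact_mod_cast hb
  have hR0 : 0 ≤ R := by simpa using hR 0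
  rcases (G.nbr ε o).eq_empty_or_nonempty with hne | hne
  · rw [hne]; simp
  set D : ℝ := (G.nbr ε o).card / (b * ε) with hD
  have hD0 : 0 < D := div_pos (by exact_mod_cast hne.card_pos) (by positivity)
  have hu0 : ∀ e, 0 ≤ u e := fun e => by simp only [hu, closedWt]; split_ifs <;> norm_num
  have hu1 : ∀ e, u e ≤ 1 := fun e => by simp only [hu, closedWt]; split_ifs <;> norm_num
  have hw0 : ∀ e, 0 ≤ w e := openWt_nonneg hb hε
  have hwb : ∀ e, w e ≤ 1 / (b * ε) := openWt_le hb hε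
  have husupp : ∀ e, ¬ ε ≤ G.wt e → u e = 0 := fun e h => if_neg h
  have hwsupp : ∀ e, ¬ ε ≤ G.wt e → w e = 0 := fun e h => if_neg h
  have hpmem := prob_mem G.wt_nonneg b.2
  have hwtinv : ∀ φ : G.graph ≃g G.graph, G.IsAut φ → ∀ e : Sym2 V, u (e.map φ) = u e ∧ w (e.map φ) = w e := by
    intro φ hφ e
    simp only [hu, hw, closedWt, openWt, prob, G.wt_map hφ e, and_self]
  -- mass transport needs nonnegative observables: separate the closed from the open edges
  set Xc : (G.graph.edgeSet → Bool) → Sym2 V → ℝ := fun ω e => if e ∈ G.opn ω then 0 else u e with hXc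
  set Xo : (G.graph.edgeSet → Bool) → Sym2 V → ℝ := fun ω e => if e ∈ G.opn ω then w e else 0 with hXo
  have hXc0 : ∀ ω e, 0 ≤ Xc ω e := fun ω e => by
    simp only [hXc]; split_ifs <;> [exact le_rfl; exact hu0 e]
  have hXo0 : ∀ ω e, 0 ≤ Xo ω e := fun ω e => by
    simp only [hXo]; split_ifs <;> [exact hw0 e; exact le_rfl]
  have hXcs : ∀ ω e, ¬ ε ≤ G.wt e → Xc ω e = 0 := fun ω e h => by
    simp only [hXc, husupp e h, ite_self]
  have hXos : ∀ ω e, ¬ ε ≤ G.wt e → Xo ω e = 0 := fun ω e h => by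
    simp only [hXo, hwsupp e h, ite_self]
  have hXcm : ∀ e, Measurable fun ω => Xc ω e := fun e =>
    Measurable.ite (G.measurableSet_mem_opn e) measurable_const measurable_const
  have hXom : ∀ e, Measurable fun ω => Xo ω e := fun e =>
    Measurable.ite (G.measurableSet_mem_opn e) measurable_const measurable_const
  obtain ⟨hcint, hceq⟩ := integral_bdMass htrans hunimod hfin hε n (c := 1) hXcm hXc0
    (fun ω e => by simp only [hXc]; split_ifs <;> [norm_num; exact hu1 e])
    (fun φ hφ ω e => by simp only [hXc, G.mem_opn_shift, (hwtinv φ hφ e).1]) hXcs o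
  obtain ⟨hoint, hoeq⟩ := integral_bdMass htrans hunimod hfin hε n (c := 1 / (b * ε)) hXom hXo0
    (fun ω e => by simp only [hXo]; split_ifs <;> [exact hwb e; positivity])
    (fun φ hφ ω e => by simp only [hXo, G.mem_opn_shift, (hwtinv φ hφ e).2]) hXos o
  have hemint : ∀ (X : (G.graph.edgeSet → Bool) → Sym2 V → ℝ) (c : ℝ),
      (∀ e, Measurable fun ω => X ω e) → (∀ ω e, 0 ≤ X ω e) → (∀ ω e, X ω e ≤ c) → 0 ≤ c → ∀ y,
      Integrable (fun ω => X ω s(o, y) * edgeMass (cluMass n) (G.opn ω) o y) P := by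
    intro X c h1 h2 h3 hc y
    refine Integrable.of_bound (C := c * 2)
      ((h1 _).mul (G.measurable_edgeMass n o y)).aestronglyMeasurable (.of_forall fun ω => ?_)
    rw [Real.norm_of_nonneg (mul_nonneg (h2 _ _) (edgeMass_nonneg _ _ _ _))]
    exact mul_le_mul (h3 _ _) (edgeMass_le_two _ _ _ _) (edgeMass_nonneg _ _ _ _) hc
  have hcem := hemint Xc 1 hXcm hXc0
    (fun ω e => by simp only [hXc]; split_ifs <;> [norm_num; exact hu1 e]) zero_le_one
  have hoem := hemint Xo (1 / (b * ε)) hXom hXo0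
    (fun ω e => by simp only [hXo]; split_ifs <;> [exact hwb e; positivity]) (by positivity)
  -- the upper bound: the fluctuation of the cluster of `o`
  have hupper : ∫ ω, ((G.bdMass n Xc o ω).toReal - (G.bdMass n Xo o ω).toReal) ∂P ≤ √D * R := by
    refine integral_le_of_tendsto_of_abs_le (f := fun k ω =>
      (fun T : Finset (Sym2 V) => vtxMass n (K (T : Set (Sym2 V)) o).ncard *
        Fluct (exh V k) u w T (K (T : Set (Sym2 V)) o)) (G.trace (exh V k) ω)) ?_ ?_ ?_
    · intro k
      refine Integrable.of_bound (C := ∑ T ∈ (exh V k).powerset,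
        |vtxMass n (K (T : Set (Sym2 V)) o).ncard * Fluct (exh V k) u w T (K (T : Set (Sym2 V)) o)|)
        (G.measurable_comp_trace (exh V k) (fun T : Finset (Sym2 V) =>
          vtxMass n (K (T : Set (Sym2 V)) o).ncard *
            Fluct (exh V k) u w T (K (T : Set (Sym2 V)) o))).aestronglyMeasurable
        (.of_forall fun ω => ?_)
      exact Finset.single_le_sum (f := fun T : Finset (Sym2 V) =>
        |vtxMass n (K (T : Set (Sym2 V)) o).ncard * Fluct (exh V k) u w T (K (T : Set (Sym2 V)) o)|)
        (fun T _ => abs_nonneg _) (Finset.mem_powerset.2 (Finset.filter_subset _ _))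
    · filter_upwards [hfin] with ω hω
      have hC := hω o
      refine tendsto_const_nhds.congr' ?_
      filter_upwards [G.eventually_K_eq hC, eventually_subset_exh (G.heavyEdges ε hC.toFinset)]
        with k hk1 hk2
      rw [toReal_bdMass hε hXc0 hXcs hC, toReal_bdMass hε hXo0 hXos hC, ← mul_sub,
        ← Finset.sum_sub_distrib]
      change _ = vtxMass n (K (G.tr k ω) o).ncard *
        Fluct (exh V k) u w (G.trace (exh V k) ω) (K (G.tr k ω) o)
      rw [hk1]
      congr 1
      unfold Fluct
      refine Finset.sum_subset_zero_on_sdiff hk2 ?_ ?_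
      · intro e he
        obtain ⟨-, he2⟩ := Finset.mem_sdiff.1 he
        split_ifs with h1 h2
        · rw [hwsupp e, neg_zero]
          exact fun h => he2 ((mem_heavyEdges hε).2 ⟨h, by rwa [hC.coe_toFinset]⟩)
        · rw [husupp e]
          exact fun h => he2 ((mem_heavyEdges hε).2 ⟨h, by rwa [hC.coe_toFinset]⟩)
        · rfl
      · intro e he
        have h1 := ((mem_heavyEdges hε).1 he).2
        rw [hC.coe_toFinset] at h1
        have h2 : e ∈ G.trace (exh V k) ω ↔ e ∈ G.opn ω := by
          simp [trace, hk2 he]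
        rw [if_pos h1]
        simp only [hXc, hXo, h2]
        split_ifs <;> simp
    · intro k
      have h1 : ∀ T : Finset (Sym2 V), |vtxMass n (K (T : Set (Sym2 V)) o).ncard *
          Fluct (exh V k) u w T (K (T : Set (Sym2 V)) o)| =
          vtxMass n (K (T : Set (Sym2 V)) o).ncard *
          |Fluct (exh V k) u w T (K (T : Set (Sym2 V)) o)| := fun T => by
        rw [abs_mul, abs_of_nonneg (vtxMass_nonneg _ _)]
      simp only [h1]
      rw [G.integral_comp_trace b (exh V k) (fun T : Finset (Sym2 V) =>
        vtxMass n (K (T : Set (Sym2 V)) o).ncard *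
          |Fluct (exh V k) u w T (K (T : Set (Sym2 V)) o)|)]
      refine (Ex_abs_K_le (fun e _ => hpmem e) (mean_zero hb hε) variance_nonneg hD0
        (fun x => ?_) (vtxMass_antitone hn) (vtxMass_nonneg n) o).trans ?_
      · rw [hD, G.card_nbr_eq htrans hε o x]
        exact sum_variance_le hb hε _ x
      · refine mul_le_mul_of_nonneg_left ?_ (Real.sqrt_nonneg _)
        -- bound the sum over `j ≤ |K|` by a sum with a deterministic range
        obtain ⟨m, hm⟩ : ∃ m, ∀ T ⊆ exh V k, (K (T : Set (Sym2 V)) o).ncard ≤ m :=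
          ⟨(K (exh V k : Set (Sym2 V)) o).ncard, fun T hT =>
            Set.ncard_le_ncard (K_mono (Finset.coe_subset.2 hT)) (K_finite (Finset.finite_toSet _))⟩
        have h2 : ∀ T ⊆ exh V k, ∑ j ∈ Finset.Icc 1 (K (T : Set (Sym2 V)) o).ncard, vtxMass n j / √j =
            ∑ j ∈ Finset.Icc 1 m, vtxMass n j / √j *
              if j ≤ (K (T : Set (Sym2 V)) o).ncard then (1 : ℝ) else 0 := by
          intro T hT
          simp only [mul_ite, mul_one, mul_zero]
          rw [← Finset.sum_filter]
          refine Finset.sum_congr ?_ fun _ _ => rfl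
          ext j
          simp only [Finset.mem_Icc, Finset.mem_filter]
          have := hm T hT
          omega
        rw [Ex_congr h2, Ex_sum]
        refine (Finset.sum_le_sum fun j _ => ?_).trans (hR m)
        rw [Ex_const_mul, ← Pr_eq_Ex]
        exact mul_le_mul_of_nonneg_left (G.Pr_le_tail b _ o j)
          (div_nonneg (vtxMass_nonneg _ _) (Real.sqrt_nonneg _))
  -- the lower bound: resampling the edges at `o`
  have hlower : ∀ y ∈ G.nbr ε o, P.real {ω | y ∉ K (G.opn ω) o ∧
        n ≤ (K (G.opn ω) o).ncard ∧ n ≤ (K (G.opn ω) y).ncard} ≤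
      ∫ ω, Xc ω s(o, y) * edgeMass (cluMass n) (G.opn ω) o y ∂P -
        ∫ ω, Xo ω s(o, y) * edgeMass (cluMass n) (G.opn ω) o y ∂P := by
    intro y hy
    rw [← integral_sub (hcem y) (hoem y)]
    set A : Set (Sym2 V) → Prop := fun T => y ∉ K T o ∧ n ≤ (K T o).ncard ∧ n ≤ (K T y).ncard with hA
    have hAm : MeasurableSet {ω | A (G.opn ω)} := by
      refine (G.measurableSet_conn o y).compl.inter (MeasurableSet.inter ?_ ?_)
      · exact (G.measurable_ncard o) (measurableSet_Ici (a := n))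
      · exact (G.measurable_ncard y) (measurableSet_Ici (a := n))
    have hK : ∀ᵐ ω ∂P, ∀ᶠ k in atTop, K (G.tr k ω) o = K (G.opn ω) o ∧
        K (G.tr k ω) y = K (G.opn ω) y := by
      filter_upwards [hfin] with ω hω
      exact (G.eventually_K_eq (hω o)).and (G.eventually_K_eq (hω y))
    have t1 : Tendsto (fun k => Ex (exh V k) p fun T => if A T then (1 : ℝ) else 0) atTop
        (nhds (∫ ω, (if A (G.opn ω) then (1 : ℝ) else 0) ∂P)) := by
      refine tendsto_Ex (C := 1) (fun k T => by split_ifs <;> simp) ?_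
      filter_upwards [hK] with ω hω
      refine tendsto_const_nhds.congr' ?_
      filter_upwards [hω] with k hk
      change _ = if A (G.tr k ω) then (1 : ℝ) else 0
      simp only [hA, hk.1, hk.2]
    have hind : ∫ ω, (if A (G.opn ω) then (1 : ℝ) else 0) ∂P = P.real {ω | A (G.opn ω)} := by
      rw [← integral_indicator_one hAm]
      refine integral_congr_ae (.of_forall fun ω => ?_)
      by_cases h : A (G.opn ω) <;> simp [h, Set.indicator]
    rw [hind] at t1
    have t2 : Tendsto (fun k => Ex (exh V k) p fun T =>
        (if s(o, y) ∈ T then -w s(o, y) else u s(o, y)) * edgeMass (cluMass n) T o y) atTop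
        (nhds (∫ ω, (Xc ω s(o, y) * edgeMass (cluMass n) (G.opn ω) o y -
          Xo ω s(o, y) * edgeMass (cluMass n) (G.opn ω) o y) ∂P)) := by
      refine tendsto_Ex (C := (w s(o, y) + u s(o, y)) * 2) (fun k T => ?_) ?_
      · rw [abs_mul]
        have h0 := hu0 s(o, y)
        have h1 := hw0 s(o, y)
        refine mul_le_mul ?_ ?_ (abs_nonneg _) (add_nonneg h1 h0)
        · split_ifs
          · rw [abs_neg, abs_of_nonneg h1]; linarith
          · rw [abs_of_nonneg h0]; linarith
        · rw [abs_of_nonneg (edgeMass_nonneg _ _ _ _)]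
          exact edgeMass_le_two _ _ _ _
      · filter_upwards [hK] with ω hω
        refine tendsto_const_nhds.congr' ?_
        filter_upwards [hω, eventually_mem_exh s(o, y)] with k hk hk2
        have h2 : s(o, y) ∈ G.trace (exh V k) ω ↔ s(o, y) ∈ G.opn ω := by simp [trace, hk2]
        have h3 : edgeMass (cluMass n) (G.trace (exh V k) ω : Set (Sym2 V)) o y =
            edgeMass (cluMass n) (G.opn ω) o y := by
          change edgeMass (cluMass n) (G.tr k ω) o y = _
          simp only [edgeMass, hk.1, hk.2]
        rw [h3, ← sub_mul]
        simp only [hXc, hXo, h2]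
        split_ifs <;> ring
    refine le_of_tendsto_of_tendsto t1 t2 ?_
    filter_upwards [eventually_mem_exh s(o, y)] with k hk
    have h := mul_Pr_le_Ex_edgeMass (F := exh V k) (x := o) (y := y) (n := n) (φ := cluMass n)
      (fun e _ => hpmem e) (mean_zero hb hε) hu0 (fun a c => by
        convert cluMass_add hn a c using 3) hk
    have huy : G.closedWt ε s(o, y) = 1 := if_pos ((G.mem_nbr hε).1 hy)
    refine (le_of_eq ?_).trans h
    rw [huy, one_mul]
    exact (Pr_eq_Ex ..).symm
  calc _ ≤ ∑ y ∈ G.nbr ε o, (∫ ω, Xc ω s(o, y) * edgeMass (cluMass n) (G.opn ω) o y ∂P -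
        ∫ ω, Xo ω s(o, y) * edgeMass (cluMass n) (G.opn ω) o y ∂P) := Finset.sum_le_sum hlower
    _ = 2 * ∫ ω, ((G.bdMass n Xc o ω).toReal - (G.bdMass n Xo o ω).toReal) ∂P := by
        rw [Finset.sum_sub_distrib, ← hceq, ← hoeq, integral_sub hcint hoint]
        ring
    _ ≤ 2 * (√D * R) := mul_le_mul_of_nonneg_left hupper two_pos.le
    _ = _ := by ring

end TwoGhostInequality

end WeightedGraph

section PowerSums

/-! ### Sums of powers -/

lemma sum_rpow_le {s : ℝ} (hs0 : 0 ≤ s) (hs : s < 1) (m : ℕ) :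
    ∑ j ∈ Finset.Icc 1 m, (j : ℝ) ^ (-s) ≤ (m : ℝ) ^ (1 - s) / (1 - s) := by
  have h1s : 0 < 1 - s := by linarith
  induction m with
  | zero => simp [Real.zero_rpow h1s.ne']
  | succ m ih =>
    rw [Finset.sum_Icc_succ_top (by omega)]
    have hm : (0 : ℝ) < (m + 1 : ℕ) := by positivity
    -- concavity of `x ↦ x ^ (1 - s)`, from Bernoulli's inequality
    have h1 : (m : ℝ) ^ (1 - s) ≤
        ((m + 1 : ℕ) : ℝ) ^ (1 - s) - (1 - s) * ((m + 1 : ℕ) : ℝ) ^ (-s) := by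
      have hb : -1 ≤ -(1 / ((m + 1 : ℕ) : ℝ)) := by
        rw [neg_le_neg_iff, div_le_one hm]; push_cast; linarith [m.cast_nonneg (α := ℝ)]
      have h := rpow_one_add_le_one_add_mul_self hb h1s.le (by linarith : 1 - s ≤ 1)
      have h2 : (m : ℝ) = (m + 1 : ℕ) * (1 + -(1 / ((m + 1 : ℕ) : ℝ))) := by
        field_simp; push_cast; ring
      have h3 : ((m + 1 : ℕ) : ℝ) ^ (1 - s) = (m + 1 : ℕ) * ((m + 1 : ℕ) : ℝ) ^ (-s) := by
        rw [sub_eq_add_neg, Real.rpow_add hm, Real.rpow_one]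
      calc (m : ℝ) ^ (1 - s) = ((m + 1 : ℕ) * (1 + -(1 / ((m + 1 : ℕ) : ℝ)))) ^ (1 - s) := by
            rw [← h2]
        _ = ((m + 1 : ℕ) : ℝ) ^ (1 - s) * (1 + -(1 / ((m + 1 : ℕ) : ℝ))) ^ (1 - s) :=
            Real.mul_rpow hm.le (by linarith)
        _ ≤ ((m + 1 : ℕ) : ℝ) ^ (1 - s) * (1 + (1 - s) * -(1 / ((m + 1 : ℕ) : ℝ))) :=
            mul_le_mul_of_nonneg_left h (by positivity)
        _ = _ := by rw [h3]; field_simp; ring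
    calc _ ≤ (m : ℝ) ^ (1 - s) / (1 - s) + ((m + 1 : ℕ) : ℝ) ^ (-s) := by gcongr
      _ ≤ _ := by
        rw [div_add' _ _ _ h1s.ne']
        gcongr
        linarith

lemma sum_rpow_Ioc_le {n : ℕ} (hn : 1 ≤ n) (m : ℕ) :
    ∑ j ∈ Finset.Ioc n m, (j : ℝ) ^ (-(3 / 2 : ℝ)) ≤ 2 * (n : ℝ) ^ (-(1 / 2 : ℝ)) := by
  suffices h : ∀ m, n ≤ m → ∑ j ∈ Finset.Ioc n m, (j : ℝ) ^ (-(3 / 2 : ℝ)) ≤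
      2 * (n : ℝ) ^ (-(1 / 2 : ℝ)) - 2 * (m : ℝ) ^ (-(1 / 2 : ℝ)) by
    rcases le_total n m with h' | h'
    · have : 0 ≤ (m : ℝ) ^ (-(1 / 2 : ℝ)) := by positivity
      linarith [h m h']
    · rw [Finset.Ioc_eq_empty (by omega), Finset.sum_empty]; positivity
  intro m hm
  induction m, hm using Nat.le_induction with
  | base => simp
  | succ m hm ih =>
    rw [Finset.sum_Ioc_succ_top (by omega)]
    have hm0 : (0 : ℝ) < m := by exact_mod_cast (by omega : 0 < m)
    have hkey : ((m + 1 : ℕ) : ℝ) ^ (-(3 / 2 : ℝ)) ≤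
        2 * (m : ℝ) ^ (-(1 / 2 : ℝ)) - 2 * ((m + 1 : ℕ) : ℝ) ^ (-(1 / 2 : ℝ)) := by
      have hM : (0 : ℝ) < ((m + 1 : ℕ) : ℝ) := by positivity
      have e1 : ((m + 1 : ℕ) : ℝ) ^ (-(3 / 2 : ℝ)) = 1 / (√((m + 1 : ℕ) : ℝ)) ^ 3 := by
        rw [Real.rpow_neg hM.le, Real.sqrt_eq_rpow, ← Real.rpow_natCast, ← Real.rpow_mul hM.le]
        norm_num
      have e2 : ∀ x : ℝ, 0 < x → x ^ (-(1 / 2 : ℝ)) = 1 / √x := fun x hx => by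
        rw [Real.rpow_neg hx.le, ← Real.sqrt_eq_rpow, one_div]
      rw [e1, e2 _ hm0, e2 _ hM]
      have s1 := Real.sq_sqrt hm0.le
      have s2 := Real.sq_sqrt hM.le
      have p1 := Real.sqrt_pos.2 hm0
      have p2 := Real.sqrt_pos.2 hM
      set x := √(m : ℝ)
      set y := √((m + 1 : ℕ) : ℝ)
      have hxy : y ^ 2 = x ^ 2 + 1 := by rw [s1, s2]; push_cast; ring
      have hlt : x ≤ y := by nlinarith
      have : 2 * (1 / x) - 2 * (1 / y) - 1 / y ^ 3 = (2 * y ^ 2 * (y - x) - x) / (x * y ^ 3) := by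
        field_simp
      have h3 : 0 ≤ 2 * y ^ 2 * (y - x) - x := by
        have h4 : (y - x) * (y + x) = 1 := by nlinarith
        have h5 : 1 ≤ 2 * y * (y - x) := by nlinarith
        nlinarith
      have : 0 ≤ (2 * y ^ 2 * (y - x) - x) / (x * y ^ 3) := by positivity
      linarith
    linarith

end PowerSums

namespace Percolation

section Tightness

/-! ### Cluster points in a given set -/

open scoped Classical

variable {V : Type*} {F : Finset (Sym2 V)} {p : Sym2 V → ℝ} {q : ℕ → ℝ}

/-- A number as a sum of indicators, individual ones up to `M` and on a geometric scale beyond. -/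
lemma natCast_le_sum_ite {X M : ℕ} (k : ℕ) (hX : X ≤ 3 ^ k * M) :
    (X : ℝ) ≤ ∑ j ∈ Finset.Icc 1 M, (if j ≤ X then (1 : ℝ) else 0) +
      ∑ i ∈ Finset.range k, 2 * 3 ^ i * M * (if 3 ^ i * M ≤ X then (1 : ℝ) else 0) := by
  induction k with
  | zero =>
    have h : Finset.filter (fun j => j ≤ X) (Finset.Icc 1 M) = Finset.Icc 1 X := by
      ext j; simp at hX ⊢; omega
    simp [h]
  | succ k ih =>
    rw [Finset.sum_range_succ]
    by_cases h : X ≤ 3 ^ k * M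
    · refine (ih h).trans (add_le_add le_rfl (le_add_of_nonneg_right ?_))
      split_ifs <;> positivity
    · -- all the indicators equal `1`
      push Not at h
      have h1 : ∀ i ∈ Finset.range (k + 1), 3 ^ i * M ≤ X := fun i hi =>
        (Nat.mul_le_mul_right M (Nat.pow_le_pow_right (by norm_num)
          (Nat.lt_succ_iff.1 (Finset.mem_range.1 hi)))).trans h.le
      have h2 : ∀ j ∈ Finset.Icc 1 M, j ≤ X := fun j hj =>
        (Finset.mem_Icc.1 hj).2.trans (by simpa using h1 0 (by simp))
      have h5 : ∑ j ∈ Finset.Icc 1 M, (if j ≤ X then (1 : ℝ) else 0) = M := by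
        rw [Finset.sum_congr rfl fun j hj => if_pos (h2 j hj)]; simp
      have h6 : ∑ i ∈ Finset.range (k + 1),
          2 * 3 ^ i * (M : ℝ) * (if 3 ^ i * M ≤ X then (1 : ℝ) else 0) =
          ∑ i ∈ Finset.range (k + 1), 2 * 3 ^ i * (M : ℝ) :=
        Finset.sum_congr rfl fun i hi => by rw [if_pos (h1 i hi), mul_one]
      rw [← Finset.sum_range_succ
        (fun i => 2 * 3 ^ i * (M : ℝ) * (if 3 ^ i * M ≤ X then (1 : ℝ) else 0)), h5, h6]
      have h3 : ∀ k : ℕ, (M : ℝ) + ∑ i ∈ Finset.range (k + 1), 2 * 3 ^ i * (M : ℝ) =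
          3 ^ (k + 1) * M := by
        intro k
        induction k with
        | zero => simp; ring
        | succ k ih => rw [Finset.sum_range_succ, ← add_assoc, ih]; ring
      have h4 : (X : ℝ) ≤ 3 ^ (k + 1) * M := by exact_mod_cast hX
      rwa [h3]

/-- The tail of the number of points of a cluster in `L` decays fast beyond the scale `M` at which
the largest such number concentrates. -/
lemma Ex_ncard_inter_le (hp : ∀ e ∈ F, 0 ≤ p e ∧ p e ≤ 1) (L : Finset V) (o : V)
    (hq : ∀ x m, 1 ≤ m → Pr F p (fun T => m ≤ (K (T : Set (Sym2 V)) x).ncard) ≤ q m)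
    {M : ℕ} (hM : 1 ≤ M) (hLM : 6 * (L.card * q M) ≤ M) :
    Ex F p (fun T => ((K (T : Set (Sym2 V)) o ∩ L).ncard : ℝ)) ≤
      ∑ j ∈ Finset.Icc 1 M, q j + 4 * M * q M := by
  set f : ℕ → ℝ := fun m => Pr F p fun T => m ≤ (K (T : Set (Sym2 V)) o ∩ L).ncard with hf
  have hfq : ∀ m, 1 ≤ m → f m ≤ q m := fun m hm => (Pr_mono hp fun T _ h => h.trans
    (Set.ncard_le_ncard Set.inter_subset_left (K_finite T.finite_toSet))).trans (hq o m hm)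
  have hmax : Pr F p (fun T => ∃ v, M ≤ (K (T : Set (Sym2 V)) v ∩ L).ncard) ≤ 1 / 6 := by
    have hM0 : (0 : ℝ) < M := by exact_mod_cast hM
    have h1 := mul_Pr_exists_le hp L (m := M)
    have h2 : ∑ x ∈ L, Pr F p (fun T => M ≤ (K (T : Set (Sym2 V)) x).ncard) ≤ L.card * q M := by
      rw [← nsmul_eq_mul]
      exact Finset.sum_le_card_nsmul _ _ _ fun x _ => hq x M hM
    refine le_of_mul_le_mul_left ?_ hM0
    linarith
  have hstep : ∀ i, f (3 ^ i * M) ≤ (1 / 6) ^ i * q M := by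
    intro i
    induction i with
    | zero => simpa using hfq M hM
    | succ i ih =>
      have hM' : M ≤ 3 ^ i * M := Nat.le_mul_of_pos_left M (by positivity)
      have h := Pr_three_mul_le hp (L : Set V) (hM.trans hM') o
      have h' : Pr F p (fun T => ∃ v, 3 ^ i * M ≤ (K (T : Set (Sym2 V)) v ∩ L).ncard) ≤ 1 / 6 :=
        (Pr_mono hp fun T _ ⟨v, hv⟩ => ⟨v, hM'.trans hv⟩).trans hmax
      have e : 3 ^ (i + 1) * M = 3 * (3 ^ i * M) := by ring
      rw [e]
      calc _ ≤ f (3 ^ i * M) * _ := h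
        _ ≤ (1 / 6) ^ i * q M * (1 / 6) := mul_le_mul ih h' (Pr_nonneg hp) ((Pr_nonneg hp).trans ih)
        _ = _ := by ring
  have hqM : 0 ≤ q M := (Pr_nonneg hp).trans (hfq M hM)
  obtain ⟨k, hk⟩ : ∃ k, L.card ≤ 3 ^ k := ⟨L.card, (Nat.lt_pow_self (by norm_num)).le⟩
  have hle : ∀ T ⊆ F, ((K (T : Set (Sym2 V)) o ∩ L).ncard : ℝ) ≤
      ∑ j ∈ Finset.Icc 1 M, (if j ≤ (K (T : Set (Sym2 V)) o ∩ L).ncard then (1 : ℝ) else 0) +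
      ∑ i ∈ Finset.range k, 2 * 3 ^ i * M *
        (if 3 ^ i * M ≤ (K (T : Set (Sym2 V)) o ∩ L).ncard then (1 : ℝ) else 0) := by
    intro T _
    refine natCast_le_sum_ite k ?_
    calc _ ≤ (L : Set V).ncard := Set.ncard_le_ncard Set.inter_subset_right
      _ = L.card := Set.ncard_coe_finset L
      _ ≤ 3 ^ k * M := hk.trans (Nat.le_mul_of_pos_right _ hM)
  refine (Ex_mono hp hle).trans ?_
  rw [Ex_add, Ex_sum, Ex_sum]
  simp only [Ex_const_mul, ← Pr_eq_Ex]
  refine add_le_add (Finset.sum_le_sum fun j hj => hfq j (Finset.mem_Icc.1 hj).1) ?_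
  have hgeom : ∀ k : ℕ, ∑ i ∈ Finset.range k, (1 / 2 : ℝ) ^ i ≤ 2 := fun k => by
    rw [geom_sum_eq (by norm_num)]
    have : (0 : ℝ) ≤ (1 / 2) ^ k := by positivity
    rw [div_le_iff_of_neg (by norm_num)]; linarith
  calc _ ≤ ∑ i ∈ Finset.range k, 2 * M * q M * (1 / 2 : ℝ) ^ i := by
        refine Finset.sum_le_sum fun i _ => ?_
        refine (mul_le_mul_of_nonneg_left (hstep i) (by positivity)).trans_eq ?_
        have : (1 / 2 : ℝ) ^ i = 3 ^ i * (1 / 6) ^ i := by rw [← mul_pow]; norm_num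
        rw [this]; ring
    _ = 2 * M * q M * ∑ i ∈ Finset.range k, (1 / 2 : ℝ) ^ i := by rw [Finset.mul_sum]
    _ ≤ 2 * M * q M * 2 := mul_le_mul_of_nonneg_left (hgeom k) (by positivity)
    _ = _ := by ring

lemma sum_Pr_conn_eq (L : Finset V) (o : V) :
    ∑ x ∈ L, Pr F p (fun T => Conn (T : Set (Sym2 V)) o x) =
      Ex F p (fun T => ((K (T : Set (Sym2 V)) o ∩ L).ncard : ℝ)) := by
  simp only [Pr_eq_Ex, ← Ex_sum]
  refine Ex_congr fun T _ => ?_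
  rw [Finset.sum_boole, ← Set.ncard_coe_finset]
  congr 2
  ext x
  simp [K, and_comm]

/-- If cluster sizes have polynomial tails, then a cluster meets any given set of `N` vertices in at
most of order `N ^ ((1 - θ) / (1 + θ))` points on average. -/
lemma sum_Pr_conn_le (hp : ∀ e ∈ F, 0 ≤ p e ∧ p e ≤ 1) (L : Finset V) (o : V) {A θ : ℝ}
    (hA : 1 ≤ A) (hθ0 : 0 < θ) (hθ : θ < 1 / 2) (hL : 1 ≤ L.card)
    (hq : ∀ x m, 1 ≤ m → Pr F p (fun T => m ≤ (K (T : Set (Sym2 V)) x).ncard) ≤ A * (m : ℝ) ^ (-θ)) :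
    ∑ x ∈ L, Pr F p (fun T => Conn (T : Set (Sym2 V)) o x) ≤
      72 * (A ^ (2 / (1 + θ)) * (L.card : ℝ) ^ (-(2 * θ / (1 + θ)))) * L.card := by
  have hN : (1 : ℝ) ≤ L.card := by exact_mod_cast hL
  set N : ℝ := (L.card : ℝ) with hNdef
  set B : ℝ := (6 * (N * A)) ^ (1 / (1 + θ)) with hB
  have hNA : 1 ≤ N * A := by nlinarith
  have hB1 : 1 ≤ B := Real.one_le_rpow (by linarith) (by positivity)
  set M : ℕ := ⌈B⌉₊ with hM
  have hBM : B ≤ M := Nat.le_ceil B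
  have hM2 : (M : ℝ) ≤ 2 * B := by
    have := Nat.ceil_lt_add_one (by linarith : 0 ≤ B)
    linarith
  have hM1 : 1 ≤ M := by exact_mod_cast hB1.trans hBM
  have hM0 : (0 : ℝ) < M := by exact_mod_cast hM1
  have hpow : 6 * (N * A) ≤ (M : ℝ) ^ (1 + θ) := by
    calc 6 * (N * A) = B ^ (1 + θ) := by
          have h0 : (0 : ℝ) ≤ 6 * (N * A) := by linarith
          rw [hB, ← Real.rpow_mul h0, one_div_mul_cancel (by linarith), Real.rpow_one]
      _ ≤ _ := Real.rpow_le_rpow (by linarith) hBM (by linarith)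
  have h1 := Ex_ncard_inter_le hp L o hq hM1 (by
    have : (M : ℝ) = (M : ℝ) ^ (1 + θ) * (M : ℝ) ^ (-θ) := by
      rw [← Real.rpow_add hM0, add_neg_cancel_right, Real.rpow_one]
    calc 6 * (N * (A * (M : ℝ) ^ (-θ))) = 6 * (N * A) * (M : ℝ) ^ (-θ) := by ring
      _ ≤ (M : ℝ) ^ (1 + θ) * (M : ℝ) ^ (-θ) :=
          mul_le_mul_of_nonneg_right hpow (Real.rpow_nonneg hM0.le _)
      _ = M := this.symm)
  rw [sum_Pr_conn_eq]
  refine h1.trans ?_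
  have h2 : ∑ j ∈ Finset.Icc 1 M, A * (j : ℝ) ^ (-θ) ≤ 2 * A * (M : ℝ) ^ (1 - θ) := by
    rw [← Finset.mul_sum]
    have h := sum_rpow_le hθ0.le (by linarith : θ < 1) M
    have h' : (M : ℝ) ^ (1 - θ) / (1 - θ) ≤ 2 * (M : ℝ) ^ (1 - θ) := by
      have : 0 < (M : ℝ) ^ (1 - θ) := by positivity
      rw [div_le_iff₀ (by linarith)]
      nlinarith
    calc _ ≤ A * (2 * (M : ℝ) ^ (1 - θ)) := by gcongr; exact h.trans h'
      _ = _ := by ring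
  have h3 : (M : ℝ) * (M : ℝ) ^ (-θ) = (M : ℝ) ^ (1 - θ) := by
    rw [sub_eq_add_neg, Real.rpow_add hM0, Real.rpow_one]
  have h4 : (M : ℝ) ^ (1 - θ) ≤ 2 * B ^ (1 - θ) := by
    calc (M : ℝ) ^ (1 - θ) ≤ (2 * B) ^ (1 - θ) := Real.rpow_le_rpow hM0.le hM2 (by linarith)
      _ = 2 ^ (1 - θ) * B ^ (1 - θ) := Real.mul_rpow (by norm_num) (by linarith)
      _ ≤ 2 ^ (1 : ℝ) * B ^ (1 - θ) := by
          gcongr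
          · norm_num
          · linarith
      _ = _ := by rw [Real.rpow_one]
  have h5 : B ^ (1 - θ) ≤ 6 * (N * A) ^ ((1 - θ) / (1 + θ)) := by
    calc B ^ (1 - θ) = (6 * (N * A)) ^ ((1 - θ) / (1 + θ)) := by
          have h0 : (0 : ℝ) ≤ 6 * (N * A) := by linarith
          rw [hB, ← Real.rpow_mul h0]; congr 1; ring
      _ = 6 ^ ((1 - θ) / (1 + θ)) * (N * A) ^ ((1 - θ) / (1 + θ)) :=
          Real.mul_rpow (by norm_num) (by positivity)
      _ ≤ 6 ^ (1 : ℝ) * (N * A) ^ ((1 - θ) / (1 + θ)) := by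
          gcongr
          · norm_num
          · rw [div_le_one (by linarith)]; linarith
      _ = _ := by rw [Real.rpow_one]
  have h6 : A * (N * A) ^ ((1 - θ) / (1 + θ)) =
      A ^ (2 / (1 + θ)) * N ^ (-(2 * θ / (1 + θ))) * N := by
    have hA0 : 0 < A := by linarith
    have hN0 : 0 < N := by linarith
    have hθ1 : 1 + θ ≠ 0 := by linarith
    have e1 : A ^ (2 / (1 + θ)) = A * A ^ ((1 - θ) / (1 + θ)) := by
      rw [← Real.rpow_one_add' hA0.le]
      · congr 1; field_simp; ring
      · have : 0 < (1 - θ) / (1 + θ) := div_pos (by linarith) (by linarith)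
        linarith
    have e2 : N ^ (-(2 * θ / (1 + θ))) * N = N ^ ((1 - θ) / (1 + θ)) := by
      nth_rw 2 [← Real.rpow_one N]
      rw [← Real.rpow_add hN0]
      congr 1; field_simp; ring
    rw [mul_assoc, e2, e1, Real.mul_rpow hN0.le hA0.le]; ring
  calc _ ≤ 2 * A * (M : ℝ) ^ (1 - θ) + 4 * A * (M : ℝ) ^ (1 - θ) := by
        rw [← h3] at h2 ⊢; linarith
    _ = 6 * A * (M : ℝ) ^ (1 - θ) := by ring
    _ ≤ 6 * A * (2 * (6 * (N * A) ^ ((1 - θ) / (1 + θ)))) := by gcongr; exact h4.trans (by linarith)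
    _ = 72 * (A * (N * A) ^ ((1 - θ) / (1 + θ))) := by ring
    _ = _ := by rw [h6]; ring

end Tightness

end Percolation

/-! ### The bootstrap -/

namespace WeightedGraph

open Percolation Filter

section Bootstrap

open scoped Classical

/-- The sum in the two-ghost inequality for polynomial tails; the ranges `j ≤ n` and `j > n`
contribute the same order. -/
lemma sum_vtxMass_le {A θ : ℝ} (hA : 0 ≤ A) (hθ0 : 0 < θ) (hθ : θ < 1 / 2) {q : ℕ → ℝ}
    (hq : ∀ j : ℕ, 1 ≤ j → q j ≤ A * (j : ℝ) ^ (-θ)) {n : ℕ} (hn : 1 ≤ n) (m : ℕ) :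
    ∑ j ∈ Finset.Icc 1 m, vtxMass n j / √j * q j ≤
      (1 / (1 / 2 - θ) + 2) * A * (n : ℝ) ^ (-(1 / 2 + θ)) := by
  have hn0 : (0 : ℝ) < n := by exact_mod_cast hn
  set g : ℕ → ℝ := fun j => if j ≤ n then A * (n : ℝ) ^ (-1 : ℝ) * (j : ℝ) ^ (-(1 / 2 + θ)) else
    A * (n : ℝ) ^ (-θ) * (j : ℝ) ^ (-(3 / 2 : ℝ)) with hg
  have hg0 : ∀ j, 0 ≤ g j := fun j => by
    simp only [hg]; split_ifs <;> positivity
  have h1 : ∀ j ∈ Finset.Icc 1 m, vtxMass n j / √j * q j ≤ g j := by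
    intro j hj
    have hj1 := (Finset.mem_Icc.1 hj).1
    have hj0 : (0 : ℝ) < j := by exact_mod_cast hj1
    have hs : 1 / √(j : ℝ) = (j : ℝ) ^ (-(1 / 2 : ℝ)) := by
      rw [Real.rpow_neg hj0.le, ← Real.sqrt_eq_rpow, one_div]
    refine (mul_le_mul_of_nonneg_left (hq j hj1) (div_nonneg (vtxMass_nonneg n j)
      (Real.sqrt_nonneg _))).trans ?_
    rw [div_eq_mul_one_div, hs]
    simp only [hg, vtxMass]
    split_ifs with h
    · rw [max_eq_left h, Real.rpow_neg_one, neg_add, Real.rpow_add hj0]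
      refine le_of_eq ?_
      ring
    · push Not at h
      rw [max_eq_right h.le, one_div, ← Real.rpow_neg_one]
      calc _ = A * (j : ℝ) ^ (-θ) * ((j : ℝ) ^ (-1 : ℝ) * (j : ℝ) ^ (-(1 / 2 : ℝ))) := by ring
        _ = A * (j : ℝ) ^ (-θ) * (j : ℝ) ^ (-(3 / 2 : ℝ)) := by
            rw [← Real.rpow_add hj0]; norm_num
        _ ≤ _ := by
            have : (j : ℝ) ^ (-θ) ≤ (n : ℝ) ^ (-θ) :=
              Real.rpow_le_rpow_of_nonpos hn0 (by exact_mod_cast h.le) (by linarith)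
            gcongr
  have h2 : ∑ j ∈ Finset.Icc 1 m, g j ≤
      ∑ j ∈ Finset.Icc 1 n, g j + ∑ j ∈ Finset.Ioc n m, g j := by
    rw [← Finset.sum_union (Finset.disjoint_left.2 fun j hj hj' => by
      simp at hj hj'; omega)]
    exact Finset.sum_le_sum_of_subset_of_nonneg (fun j hj => by simp at hj ⊢; omega)
      fun j _ _ => hg0 j
  have h3 : ∑ j ∈ Finset.Icc 1 n, g j ≤ 1 / (1 / 2 - θ) * A * (n : ℝ) ^ (-(1 / 2 + θ)) := by
    rw [Finset.sum_congr rfl fun j hj => if_pos (Finset.mem_Icc.1 hj).2, ← Finset.mul_sum]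
    have h := sum_rpow_le (by linarith : 0 ≤ 1 / 2 + θ) (by linarith) n
    refine (mul_le_mul_of_nonneg_left h (by positivity)).trans_eq ?_
    have e : (n : ℝ) ^ (-1 : ℝ) * (n : ℝ) ^ (1 - (1 / 2 + θ)) = (n : ℝ) ^ (-(1 / 2 + θ)) := by
      rw [← Real.rpow_add hn0]; congr 1; ring
    rw [← e, show 1 - (1 / 2 + θ) = 1 / 2 - θ by ring]
    ring
  have h4 : ∑ j ∈ Finset.Ioc n m, g j ≤ 2 * A * (n : ℝ) ^ (-(1 / 2 + θ)) := by
    rw [Finset.sum_congr rfl fun j hj => if_neg (not_le.2 (Finset.mem_Ioc.1 hj).1), ← Finset.mul_sum]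
    refine (mul_le_mul_of_nonneg_left (sum_rpow_Ioc_le hn m) (by positivity)).trans_eq ?_
    rw [neg_add, Real.rpow_add hn0]
    ring
  refine (Finset.sum_le_sum h1).trans (h2.trans ((add_le_add h3 h4).trans_eq (by ring)))

variable {V : Type*} [Countable V] (G : WeightedGraph V) {b : ℝ≥0}

lemma tendsto_Pr_conn (x y : V) :
    Tendsto (fun k => Pr (exh V k) (prob G.wt b) fun T => Conn (T : Set (Sym2 V)) x y) atTop
      (nhds ((G.percolation b).real {ω | y ∈ K (G.opn ω) x})) := by
  have h := G.tendsto_Pr b (A := fun T => Conn (T : Set (Sym2 V)) x y) fun S T h h' =>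
    h'.mono (Finset.coe_subset.2 h)
  have hset : {ω | y ∈ K (G.opn ω) x} =
      {ω | ∃ k, Conn (G.trace (exh V k) ω : Set (Sym2 V)) x y} := by
    ext ω
    exact G.conn_iff_exists
  rwa [hset]

lemma sum_real_mem_K_le (htrans : G.IsTransitive) (L : Finset V) (o : V) {A θ : ℝ}
    (hA : 1 ≤ A) (hθ0 : 0 < θ) (hθ : θ < 1 / 2) (hL : 1 ≤ L.card)
    (hq : ∀ m : ℕ, 1 ≤ m → G.tail b o m ≤ A * (m : ℝ) ^ (-θ)) :
    ∑ x ∈ L, (G.percolation b).real {ω | x ∈ K (G.opn ω) o} ≤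
      72 * (A ^ (2 / (1 + θ)) * (L.card : ℝ) ^ (-(2 * θ / (1 + θ)))) * L.card := by
  refine le_of_tendsto (tendsto_finsetSum L fun x _ => G.tendsto_Pr_conn o x) (.of_forall fun k => ?_)
  refine sum_Pr_conn_le (fun e _ => prob_mem G.wt_nonneg b.2 e) L o hA hθ0 hθ hL fun x m hm => ?_
  exact (G.Pr_le_tail b _ x m).trans (by rw [G.tail_eq htrans b x o]; exact hq m hm)

/-- The Harris inequality for the event that two clusters are large. -/
lemma sq_tail_le_real (htrans : G.IsTransitive)
    (hfin : ∀ᵐ ω ∂(G.percolation b), ∀ v, (K (G.opn ω) v).Finite) (o x : V) (n : ℕ) :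
    G.tail b o n ^ 2 ≤ (G.percolation b).real
      {ω | n ≤ (K (G.opn ω) o).ncard ∧ n ≤ (K (G.opn ω) x).ncard} := by
  have hmono : ∀ v : V, ∀ S T : Finset (Sym2 V), S ⊆ T → n ≤ (K (S : Set (Sym2 V)) v).ncard →
      n ≤ (K (T : Set (Sym2 V)) v).ncard := fun v S T h h' =>
    h'.trans (Set.ncard_le_ncard (K_mono (Finset.coe_subset.2 h)) (K_finite T.finite_toSet))
  have h1 := G.tendsto_Pr b (A := fun T => n ≤ (K (T : Set (Sym2 V)) o).ncard ∧
    n ≤ (K (T : Set (Sym2 V)) x).ncard) fun S T h h' =>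
      ⟨hmono o S T h h'.1, hmono x S T h h'.2⟩
  have h2 := (G.tendsto_tail b o n).mul (G.tendsto_tail b x n)
  rw [G.tail_eq htrans b x o, ← sq] at h2
  refine (le_of_tendsto_of_tendsto h2 h1 (.of_forall fun k => ?_)).trans ?_
  · refine (Ex_mul_le_Ex_mul (fun e _ => prob_mem G.wt_nonneg b.2 e) (monotone_ite (hmono o))
      (monotone_ite (hmono x))).trans_eq (Ex_congr fun T _ => ?_)
    split_ifs <;> first | (norm_num; done) | tauto
  · refine ENNReal.toReal_mono (measure_ne_top _ _) (measure_mono_ae ?_)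
    filter_upwards [hfin] with ω hω h
    obtain ⟨k, hk1, hk2⟩ := h
    exact ⟨hk1.trans (Set.ncard_le_ncard (K_mono (G.tr_subset k ω)) (hω o)),
      hk2.trans (Set.ncard_le_ncard (K_mono (G.tr_subset k ω)) (hω x))⟩

/-- A polynomial tail estimate with constant `A` feeds back, through the two-ghost inequality and
the heavy neighbours of a vertex, into an estimate that is sublinear in `A`. -/
lemma sq_tail_le (htrans : G.IsTransitive) (hunimod : G.IsUnimodular) (hb : 0 < b)
    (hfin : ∀ᵐ ω ∂(G.percolation b), ∀ v, (K (G.opn ω) v).Finite) {ε : ℝ} (hε : 0 < ε) {n : ℕ}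
    (hn : 1 ≤ n) (o : V) {A θ : ℝ} (hA : 1 ≤ A) (hθ0 : 0 < θ) (hθ : θ < 1 / 2)
    (hL : 1 ≤ (G.nbr ε o).card)
    (hq : ∀ m : ℕ, 1 ≤ m → G.tail b o m ≤ A * (m : ℝ) ^ (-θ)) :
    G.tail b o n ^ 2 ≤
      2 * (1 / (1 / 2 - θ) + 2) * A * (n : ℝ) ^ (-(1 / 2 + θ)) / √((G.nbr ε o).card * (b * ε)) +
      72 * (A ^ (2 / (1 + θ)) * ((G.nbr ε o).card : ℝ) ^ (-(2 * θ / (1 + θ)))) := by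
  set P := G.percolation b with hP
  set L := G.nbr ε o with hLdef
  have hN : (0 : ℝ) < L.card := by exact_mod_cast hL
  have hb' : (0 : ℝ) < b := by exact_mod_cast hb
  have h1 := G.sum_two_ghost_le htrans hunimod hb hfin hε hn o
    (sum_vtxMass_le (by linarith) hθ0 hθ hq hn)
  have h2 := G.sum_real_mem_K_le htrans L o hA hθ0 hθ hL hq
  have h3 : ∀ x ∈ L, G.tail b o n ^ 2 ≤ P.real {ω | x ∉ K (G.opn ω) o ∧
      n ≤ (K (G.opn ω) o).ncard ∧ n ≤ (K (G.opn ω) x).ncard} + P.real {ω | x ∈ K (G.opn ω) o} := by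
    intro x _
    refine (G.sq_tail_le_real htrans hfin o x n).trans
      ((measureReal_mono (fun ω hω => ?_) (measure_ne_top _ _)).trans (measureReal_union_le _ _))
    by_cases h : x ∈ K (G.opn ω) o
    · exact Or.inr h
    · exact Or.inl ⟨h, hω⟩
  have h4 := Finset.card_nsmul_le_sum L _ _ h3
  rw [Finset.sum_add_distrib, nsmul_eq_mul] at h4
  have h5 : √((L.card : ℝ) / (b * ε)) = L.card / √(L.card * (b * ε)) := by
    rw [eq_div_iff (by positivity), ← Real.sqrt_mul (by positivity)]
    have : (L.card : ℝ) / (b * ε) * (L.card * (b * ε)) = L.card ^ 2 := by field_simp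
    rw [this, Real.sqrt_sq hN.le]
  rw [h5] at h1
  refine le_of_mul_le_mul_left (h4.trans ((add_le_add h1 h2).trans_eq ?_)) hN
  ring

end Bootstrap

section SelfImprovement

variable {V : Type*} [Countable V] (G : WeightedGraph V) {b : ℝ≥0}

lemma noInfiniteCluster_of_tail_le (htrans : G.IsTransitive) {o : V} {A θ : ℝ} (hθ : 0 < θ)
    (hA : ∀ m : ℕ, 1 ≤ m → G.tail b o m ≤ A * (m : ℝ) ^ (-θ)) : G.NoInfiniteCluster b := by
  refine G.noInfiniteCluster_of_tail htrans (o := o) ?_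
  have h : Tendsto (fun m : ℕ => A * (m : ℝ) ^ (-θ)) atTop (nhds (A * 0)) :=
    ((tendsto_rpow_neg_atTop hθ).comp tendsto_natCast_atTop_atTop).const_mul A
  rw [mul_zero] at h
  exact squeeze_zero' (.of_forall fun m => G.tail_nonneg b o m)
    ((eventually_ge_atTop 1).mono fun m hm => hA m hm) h

/-- The constant in the bootstrapped tail estimate. -/
noncomputable def bootConst (θ ε b : ℝ) : ℝ := 2 * (1 / (1 / 2 - θ) + 2) / √(b * ε) + 72

lemma bootConst_ge {θ : ℝ} (hθ : θ < 1 / 2) (ε b : ℝ) : 72 ≤ bootConst θ ε b := by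
  have : 0 < 1 / 2 - θ := by linarith
  unfold bootConst
  have : 0 ≤ 2 * (1 / (1 / 2 - θ) + 2) / √(b * ε) := by positivity
  linarith

/-- The scale `ε n ^ (-(2 - θ))` of the heavy edges balances the two terms of `sq_tail_le`. -/
lemma tail_le_of_tail_le (htrans : G.IsTransitive) (hunimod : G.IsUnimodular) {b₀ ε : ℝ}
    (hb₀ : 0 < b₀) (hb : b₀ ≤ b) (hε : 0 < ε) {o : V} {A θ : ℝ} (hA : 1 ≤ A) (hθ0 : 0 < θ)
    (hθ : θ < 1 / 2)
    (hheavy : ∀ n : ℕ, 1 ≤ n → (n : ℝ) ^ (1 + θ) ≤ (G.nbr (ε * (n : ℝ) ^ (-(2 - θ))) o).card)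
    (hq : ∀ m : ℕ, 1 ≤ m → G.tail b o m ≤ A * (m : ℝ) ^ (-θ)) {n : ℕ} (hn : 1 ≤ n) :
    G.tail b o n ≤ √(bootConst θ ε b₀) * A ^ (1 / (1 + θ)) * (n : ℝ) ^ (-θ) := by
  have hfin : ∀ᵐ ω ∂(G.percolation b), ∀ v, (K (G.opn ω) v).Finite := by
    simpa only [NoInfiniteCluster, cluster_eq] using G.noInfiniteCluster_of_tail_le htrans hθ0 hq
  have hn1 : (1 : ℝ) ≤ n := by exact_mod_cast hn
  have hn0 : (0 : ℝ) < n := by linarith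
  have hb' : (0 : ℝ) < b := hb₀.trans_le hb
  have hε' : 0 < ε * (n : ℝ) ^ (-(2 - θ)) := by positivity
  have hN := hheavy n hn
  have hN1 : 1 ≤ (G.nbr (ε * (n : ℝ) ^ (-(2 - θ))) o).card := by
    exact_mod_cast (Real.one_le_rpow hn1 (by linarith)).trans hN
  have h := G.sq_tail_le htrans hunimod (by exact_mod_cast hb') hfin hε' hn o hA hθ0 hθ hN1 hq
  set N : ℝ := ((G.nbr (ε * (n : ℝ) ^ (-(2 - θ))) o).card : ℝ)
  have hhalf : 0 < 1 / 2 - θ := by linarith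
  have hsq : ∀ x : ℝ, ((n : ℝ) ^ (x / 2)) ^ 2 = (n : ℝ) ^ x := fun x => by
    rw [← Real.rpow_natCast, ← Real.rpow_mul hn0.le]; congr 1; push_cast; ring
  have h1 : √(b₀ * ε) * (n : ℝ) ^ ((2 * θ - 1) / 2) ≤ √(N * (b * (ε * (n : ℝ) ^ (-(2 - θ))))) := by
    refine Real.le_sqrt_of_sq_le ?_
    rw [mul_pow, Real.sq_sqrt (by positivity), hsq]
    have e : (n : ℝ) ^ (2 * θ - 1) = (n : ℝ) ^ (1 + θ) * (n : ℝ) ^ (-(2 - θ)) := by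
      rw [← Real.rpow_add hn0]; congr 1; ring
    calc _ = (n : ℝ) ^ (1 + θ) * (b₀ * (ε * (n : ℝ) ^ (-(2 - θ)))) := by rw [e]; ring
      _ ≤ _ := by gcongr
  have h2 : (n : ℝ) ^ (-(1 / 2 + θ)) = (n : ℝ) ^ (-(2 * θ)) * (n : ℝ) ^ ((2 * θ - 1) / 2) := by
    rw [← Real.rpow_add hn0]; congr 1; ring
  have h3 : 2 * (1 / (1 / 2 - θ) + 2) * A * (n : ℝ) ^ (-(1 / 2 + θ)) /
      √(N * (b * (ε * (n : ℝ) ^ (-(2 - θ))))) ≤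
      2 * (1 / (1 / 2 - θ) + 2) / √(b₀ * ε) * A * (n : ℝ) ^ (-(2 * θ)) := by
    have hpos : 0 < √(b₀ * ε) * (n : ℝ) ^ ((2 * θ - 1) / 2) :=
      mul_pos (Real.sqrt_pos.2 (by positivity)) (by positivity)
    refine (div_le_div_of_nonneg_left (by positivity) hpos h1).trans_eq ?_
    rw [h2]
    have : 0 < √(b₀ * ε) := Real.sqrt_pos.2 (by positivity)
    field_simp
  have h4 : N ^ (-(2 * θ / (1 + θ))) ≤ (n : ℝ) ^ (-(2 * θ)) := by
    calc N ^ (-(2 * θ / (1 + θ))) ≤ ((n : ℝ) ^ (1 + θ)) ^ (-(2 * θ / (1 + θ))) :=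
          Real.rpow_le_rpow_of_nonpos (by positivity) hN (by
            have : 0 < 2 * θ / (1 + θ) := by positivity
            linarith)
      _ = _ := by
          rw [← Real.rpow_mul hn0.le]; congr 1
          have : 1 + θ ≠ 0 := by linarith
          field_simp
  have h5 : A ≤ A ^ (2 / (1 + θ)) := by
    nth_rw 1 [← Real.rpow_one A]
    exact Real.rpow_le_rpow_of_exponent_le hA (by rw [le_div_iff₀ (by linarith)]; linarith)
  have h6 : G.tail b o n ^ 2 ≤ bootConst θ ε b₀ * A ^ (2 / (1 + θ)) * (n : ℝ) ^ (-(2 * θ)) := by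
    refine h.trans ((add_le_add h3 (mul_le_mul_of_nonneg_left
      (mul_le_mul_of_nonneg_left h4 (by positivity)) (by norm_num))).trans ?_)
    unfold bootConst
    have : 2 * (1 / (1 / 2 - θ) + 2) / √(b₀ * ε) * A * (n : ℝ) ^ (-(2 * θ)) ≤
      2 * (1 / (1 / 2 - θ) + 2) / √(b₀ * ε) * A ^ (2 / (1 + θ)) * (n : ℝ) ^ (-(2 * θ)) := by
      gcongr
    linarith
  have hD : 0 ≤ bootConst θ ε b₀ := by linarith [bootConst_ge hθ ε b₀]
  have e1 : (A ^ (1 / (1 + θ))) ^ 2 = A ^ (2 / (1 + θ)) := by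
    rw [← Real.rpow_natCast, ← Real.rpow_mul (by linarith)]; congr 1; push_cast; ring
  have e2 : ((n : ℝ) ^ (-θ)) ^ 2 = (n : ℝ) ^ (-(2 * θ)) := by
    rw [← Real.rpow_natCast, ← Real.rpow_mul hn0.le]; congr 1; push_cast; ring
  refine le_of_sq_le_sq (h6.trans_eq ?_) (by positivity)
  rw [mul_pow, mul_pow, Real.sq_sqrt hD, e1, e2]

/-- A polynomial tail estimate with exponent `θ` and any finite constant improves itself to one
whose constant depends only on a lower bound for the inverse temperature. -/
lemma tail_le_of_exists (htrans : G.IsTransitive) (hunimod : G.IsUnimodular) {b₀ ε : ℝ}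
    (hb₀ : 0 < b₀) (hb : b₀ ≤ b) (hε : 0 < ε) {o : V} {θ : ℝ} (hθ0 : 0 < θ)
    (hθ : θ < 1 / 2)
    (hheavy : ∀ n : ℕ, 1 ≤ n → (n : ℝ) ^ (1 + θ) ≤ (G.nbr (ε * (n : ℝ) ^ (-(2 - θ))) o).card)
    (hq : ∃ A, ∀ m : ℕ, 1 ≤ m → G.tail b o m ≤ A * (m : ℝ) ^ (-θ)) {n : ℕ} (hn : 1 ≤ n) :
    G.tail b o n ≤ bootConst θ ε b₀ ^ ((1 + θ) / (2 * θ)) * (n : ℝ) ^ (-θ) := by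
  obtain ⟨A₀, hA₀⟩ := hq
  have hiff : ∀ {m : ℕ} {A : ℝ}, 1 ≤ m →
      (G.tail b o m ≤ A * (m : ℝ) ^ (-θ) ↔ (m : ℝ) ^ θ * G.tail b o m ≤ A) := fun {m A} hm => by
    have hm0 : (0 : ℝ) < (m : ℝ) ^ θ := Real.rpow_pos_of_pos (by exact_mod_cast hm) _
    rw [Real.rpow_neg (by positivity), ← div_eq_mul_inv, le_div_iff₀ hm0, mul_comm]
  -- the optimal constant
  set f : ℕ → ℝ := fun m => (m : ℝ) ^ θ * G.tail b o m with hf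
  have hbdd : BddAbove (Set.range f) := by
    refine ⟨max A₀ 0, ?_⟩
    rintro _ ⟨m, rfl⟩
    rcases Nat.eq_zero_or_pos m with rfl | hm
    · simp [hf, Real.zero_rpow hθ0.ne']
    · exact ((hiff hm).1 (hA₀ m hm)).trans (le_max_left _ _)
  set A : ℝ := ⨆ m, f m with hA
  have hfA : ∀ m, f m ≤ A := le_ciSup hbdd
  have hA1 : 1 ≤ A := by
    have h := hfA 1
    simpa [hf, tail_one] using h
  set D := bootConst θ ε b₀ with hD
  have hD1 : 1 ≤ D := by linarith [bootConst_ge hθ ε b₀]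
  have h1 : A ≤ √D * A ^ (1 / (1 + θ)) := by
    refine ciSup_le fun m => ?_
    rcases Nat.eq_zero_or_pos m with rfl | hm
    · simp only [hf, CharP.cast_eq_zero, Real.zero_rpow hθ0.ne', zero_mul]; positivity
    · exact (hiff hm).1 (G.tail_le_of_tail_le htrans hunimod hb₀ hb hε hA1 hθ0 hθ hheavy
        (fun k hk => (hiff hk).2 (hfA k)) hm)
  have hA0 : 0 < A := by linarith
  have h2 : A ^ (θ / (1 + θ)) ≤ √D := by
    have e : A = A ^ (θ / (1 + θ)) * A ^ (1 / (1 + θ)) := by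
      rw [← Real.rpow_add hA0]
      have : θ / (1 + θ) + 1 / (1 + θ) = 1 := by
        have : 1 + θ ≠ 0 := by linarith
        field_simp; ring
      rw [this, Real.rpow_one]
    have hpos : 0 < A ^ (1 / (1 + θ)) := by positivity
    refine le_of_mul_le_mul_right ?_ hpos
    rw [← e]; exact h1
  have h3 : A ≤ D ^ ((1 + θ) / (2 * θ)) := by
    have h := Real.rpow_le_rpow (by positivity) h2 (by positivity : 0 ≤ (1 + θ) / θ)
    rw [← Real.rpow_mul hA0.le, Real.sqrt_eq_rpow, ← Real.rpow_mul (by linarith)] at h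
    have e1 : θ / (1 + θ) * ((1 + θ) / θ) = 1 := by
      have : 1 + θ ≠ 0 := by linarith
      field_simp
    have e2 : 1 / 2 * ((1 + θ) / θ) = (1 + θ) / (2 * θ) := by field_simp
    rwa [e1, e2, Real.rpow_one] at h
  exact (hiff hn).2 ((hfA n).trans h3)

end SelfImprovement

end WeightedGraph

/-! ### Sharpness of the phase transition -/

namespace Percolation

lemma Ex_map {E E' : Type*} [DecidableEq E] [DecidableEq E'] (σ : E ↪ E') (F : Finset E) (p : E' → ℝ) (f : Finset E' → ℝ) :
    Ex (F.map σ) p f = Ex F (fun e => p (σ e)) (fun T => f (T.map σ)) := by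
  induction F using Finset.induction_on generalizing f with
  | empty => simp
  | insert e F he ih =>
    have he' : σ e ∉ F.map σ := by simpa using he
    rw [Finset.map_insert, Ex_insert he', Ex_insert he, ih, ih]
    simp only [Finset.map_insert]

lemma Conn.of_map {V : Type*} {φ : V ≃ V} {T : Finset (Sym2 V)} {x y : V}
    (h : Conn (T.map (Function.Embedding.sym2Map φ.toEmbedding) : Set (Sym2 V)) (φ x) (φ y)) :
    Conn (T : Set (Sym2 V)) x y := by
  have : ∀ z, Conn (T.map (Function.Embedding.sym2Map φ.toEmbedding) : Set (Sym2 V)) (φ x) z →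
      Conn (T : Set (Sym2 V)) x (φ.symm z) := by
    intro z hz
    induction hz with
    | refl => rw [Equiv.symm_apply_apply]; exact .refl
    | @tail c d _ hcd ih =>
      refine ih.trans (.edge ?_)
      obtain ⟨e, he, heq⟩ := Finset.mem_map.1 (Finset.mem_coe.1 hcd)
      have h2 : e = s(φ.symm c, φ.symm d) := by
        have h3 : (s(c, d) : Sym2 V) = Function.Embedding.sym2Map φ.toEmbedding
            s(φ.symm c, φ.symm d) := by simp [Function.Embedding.sym2Map]
        exact (Function.Embedding.sym2Map φ.toEmbedding).injective (heq.trans h3)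
      exact h2 ▸ he
  simpa using this _ h

end Percolation

namespace WeightedGraph

open Percolation Filter

section Sharpness

open scoped Classical

variable {V : Type*} (G : WeightedGraph V)

/-- The expected weight of the edges into `W` from the part of `S` joined to `o` inside `S`. The
full outgoing weight is the supremum over `W`. -/
noncomputable def outflow (b : ℝ) (S : Finset V) (o : V) (W : Finset V) : ℝ :=
  ∑ x ∈ S, ∑ y ∈ W \ S, G.wt s(x, y) *
    Pr S.sym2 (prob G.wt b) (fun T => Conn (T : Set (Sym2 V)) o x)

variable {G}

lemma outflow_mono {b : ℝ} (hb : 0 ≤ b) (S : Finset V) (o : V) : Monotone (G.outflow b S o) := by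
  intro W W' h
  refine Finset.sum_le_sum fun x _ => Finset.sum_le_sum_of_subset_of_nonneg
    (Finset.sdiff_subset_sdiff h subset_rfl) fun y _ _ => ?_
  exact mul_nonneg (G.wt_nonneg _) (Pr_nonneg fun e _ => prob_mem G.wt_nonneg hb e)

lemma Pr_conn_map_le {φ : G.graph ≃g G.graph} (hφ : G.IsAut φ) {b : ℝ} (hb : 0 ≤ b) (S : Finset V)
    (o x : V) :
    Pr (S.map φ.toEquiv.toEmbedding).sym2 (prob G.wt b) (fun T => Conn (T : Set (Sym2 V)) (φ o) (φ x)) ≤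
      Pr S.sym2 (prob G.wt b) (fun T => Conn (T : Set (Sym2 V)) o x) := by
  unfold Pr
  rw [Finset.sym2_map, Ex_map]
  have hp : ∀ e, prob G.wt b (Function.Embedding.sym2Map φ.toEquiv.toEmbedding e) = prob G.wt b e := by
    intro e
    have h : G.wt (Function.Embedding.sym2Map φ.toEquiv.toEmbedding e) = G.wt e := G.wt_map hφ e
    rw [prob, prob, h]
  simp only [hp]
  exact Pr_mono (fun e _ => prob_mem G.wt_nonneg hb e) fun T _ h => Conn.of_map (φ := φ.toEquiv) h

variable [Countable V]

/-- A finite set with small outgoing weight forces the expected cluster size to be finite. -/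
lemma tail_le_of_outflow_le (htrans : G.IsTransitive) {b : ℝ≥0} {o : V} {S : Finset V} (ho : o ∈ S)
    {r : ℝ} (hr : r < 1) (hr0 : 0 ≤ r) (hS : ∀ W, b * G.outflow b S o W ≤ r) {n : ℕ} (hn : 1 ≤ n) :
    G.tail b o n ≤ S.card / (1 - r) * (n : ℝ)⁻¹ := by
  have hp : ∀ e, 0 ≤ prob G.wt b e ∧ prob G.wt b e ≤ 1 := fun e => prob_mem G.wt_nonneg b.2 e
  choose φ hφ hφo using fun v => htrans o v
  have hflow : ∀ v W, ∑ x ∈ S.map (φ v).toEquiv.toEmbedding,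
      ∑ y ∈ W \ S.map (φ v).toEquiv.toEmbedding, prob G.wt b s(x, y) *
        Pr (S.map (φ v).toEquiv.toEmbedding).sym2 (prob G.wt b)
          (fun T => Conn (T : Set (Sym2 V)) v x) ≤ r := by
    intro v W
    obtain ⟨W, rfl⟩ : ∃ W' : Finset V, W'.map (φ v).toEquiv.toEmbedding = W :=
      ⟨W.map (φ v).symm.toEquiv.toEmbedding, by
        ext z
        simp only [Finset.mem_map]
        constructor
        · rintro ⟨_, ⟨y, hy, rfl⟩, rfl⟩
          exact ((φ v).apply_symm_apply y).symm ▸ hy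
        · exact fun hz => ⟨_, ⟨z, hz, rfl⟩, (φ v).apply_symm_apply z⟩⟩
    refine le_trans ?_ (hS W)
    rw [← Finset.map_sdiff, Finset.sum_map, outflow, Finset.mul_sum]
    refine Finset.sum_le_sum fun x _ => ?_
    rw [Finset.sum_map, Finset.mul_sum]
    refine Finset.sum_le_sum fun y _ => ?_
    have h1 : prob G.wt b s(φ v x, φ v y) ≤ b * G.wt s(x, y) := by
      refine (prob_le _).trans_eq ?_
      rw [← G.wt_map (hφ v) s(x, y)]
      rfl
    have h2 := Pr_conn_map_le (hφ v) b.2 S o x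
    rw [hφo v] at h2
    rw [← mul_assoc]
    exact mul_le_mul h1 h2 (Pr_nonneg fun e _ => hp e) (mul_nonneg b.2 (G.wt_nonneg _))
  have hEx : ∀ F : Finset (Sym2 V), Ex F (prob G.wt b)
      (fun T => ((K (T : Set (Sym2 V)) o).ncard : ℝ)) ≤ S.card / (1 - r) := fun F =>
    Ex_ncard_le hp (S := fun v => S.map (φ v).toEquiv.toEmbedding) hr hr0
      (fun v => Finset.mem_map.2 ⟨o, ho, hφo v⟩) (fun v => by rw [Finset.card_map]) hflow o
  have hn0 : (0 : ℝ) < n := by exact_mod_cast hn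
  refine le_of_tendsto (G.tendsto_tail b o n) (.of_forall fun k => ?_)
  rw [← div_eq_mul_inv, le_div_iff₀ hn0, mul_comm]
  refine le_trans ?_ (hEx (exh V k))
  rw [Pr_eq_Ex, ← Ex_const_mul]
  refine Ex_mono (fun e _ => hp e) fun T _ => ?_
  split_ifs with h
  · rw [mul_one]; exact_mod_cast h
  · rw [mul_zero]; exact Nat.cast_nonneg _

lemma Ex_outWeight_eq {b : ℝ} {S W L : Finset V} (o : V) (hS : S ⊆ L) (hW : W ⊆ L) :
    Ex L.sym2 (prob G.wt b) (fun T => outWeight L.sym2 G.wt W o S (T ∩ S.sym2)) =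
      G.outflow b S o W := by
  rw [Ex_inter (F := S.sym2) (F' := L.sym2) (f := outWeight L.sym2 G.wt W o S)
    (Finset.sym2_mono hS)]
  unfold outWeight
  rw [Ex_sum]
  have h1 : bdPairs L.sym2 S W = S ×ˢ (W \ S) := by
    refine Finset.filter_true_of_mem fun q hq => ?_
    obtain ⟨h1, h2⟩ := Finset.mem_product.1 hq
    rw [Finset.mk_mem_sym2_iff]
    exact ⟨hS h1, hW (Finset.mem_sdiff.1 h2).1⟩
  rw [h1, Finset.sum_product, outflow]
  refine Finset.sum_congr rfl fun x _ => Finset.sum_congr rfl fun y _ => ?_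
  rw [Pr_eq_Ex, ← Ex_const_mul]
  exact Ex_congr fun T _ => by split_ifs <;> simp

/-- Below a parameter without infinite clusters, some finite set has arbitrarily small outgoing
weight. Otherwise sprinkling makes the cluster of `o` leave all finite sets with probability
bounded below. -/
lemma exists_outflow_le {b b' : ℝ≥0} (hb : b < b') (hno : G.NoInfiniteCluster b') (o : V) {κ : ℝ}
    (hκ : 0 < κ) : ∃ S : Finset V, o ∈ S ∧ ∀ W, G.outflow b S o W ≤ κ := by
  by_contra! hcon
  choose! W hW using hcon
  set P := G.percolation b' with hP
  have ht : (0 : ℝ) < b' - b := sub_pos.2 (by exact_mod_cast hb)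
  -- the cluster of `o` leaves every finite set `L` with probability bounded below
  have h1 : ∀ L : Finset V, P.real {ω | K (G.opn ω) o ⊆ L} ≤ Real.exp (-((b' - b) * κ)) := by
    intro L
    set U := L.powerset.biUnion W with hU
    have h := Pr_subset_le_exp (F := (L ∪ U).sym2) (W := U) (o := o) (L := L) (b := (b : ℝ)) (t := b' - b)
      (κ := κ) G.wt_nonneg b.2 ht.le fun S hS hoS => by
        rw [Ex_outWeight_eq o (hS.trans Finset.subset_union_left) Finset.subset_union_right]
        refine (hW S hoS).le.trans (outflow_mono b.2 S o ?_)
        exact Finset.subset_biUnion_of_mem W (Finset.mem_powerset.2 hS)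
    rw [add_sub_cancel, ← G.percolation_comp_trace b'] at h
    refine le_trans (measureReal_mono (fun ω hω => ?_) (measure_ne_top _ _)) h
    exact (K_mono (G.coe_trace _ ω)).trans hω
  have hdir : Directed (· ⊆ ·) fun L : Finset V => {ω | K (G.opn ω) o ⊆ L} := by
    intro L L'
    exact ⟨L ∪ L', fun ω h => h.trans (Finset.coe_subset.2 Finset.subset_union_left),
      fun ω h => h.trans (Finset.coe_subset.2 Finset.subset_union_right)⟩
  have h2 : P (⋃ L : Finset V, {ω | K (G.opn ω) o ⊆ L}) = 1 := by
    refine le_antisymm prob_le_one ?_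
    rw [← measure_univ (μ := P)]
    refine measure_mono_ae ?_
    filter_upwards [hno] with ω hω _
    have hfin := hω o
    rw [cluster_eq] at hfin
    exact Set.mem_iUnion.2 ⟨hfin.toFinset, by simp⟩
  have h3 : (1 : ℝ≥0∞) ≤ ENNReal.ofReal (Real.exp (-((b' - b) * κ))) := by
    rw [← h2, hdir.measure_iUnion]
    refine iSup_le fun L => ?_
    rw [← ENNReal.ofReal_toReal (measure_ne_top P _)]
    exact ENNReal.ofReal_le_ofReal (h1 L)
  rw [ENNReal.one_le_ofReal, Real.one_le_exp_iff] at h3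
  nlinarith

end Sharpness

/-! ### Conclusion -/

section Conclusion

open scoped Classical

variable {V : Type*} [Countable V] {G : WeightedGraph V}

lemma tail_mono {b b' : ℝ≥0} (h : b ≤ b') (o : V) (n : ℕ) : G.tail b o n ≤ G.tail b' o n := by
  refine le_of_tendsto_of_tendsto (G.tendsto_tail b o n) (G.tendsto_tail b' o n)
    (.of_forall fun k => ?_)
  exact Ex_prob_mono G.wt_nonneg b.2 (by exact_mod_cast h) (monotone_ite fun S T h h' =>
    h'.trans (Set.ncard_le_ncard (K_mono (Finset.coe_subset.2 h)) (K_finite T.finite_toSet)))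

/-- The tail of the cluster size is left-continuous in the parameter, being a supremum of continuous
increasing functions. -/
lemma tail_le_of_forall_lt {b : ℝ≥0} (hb : 0 < b) {o : V} {n : ℕ} {X : ℝ}
    (h : ∀ b' < b, b / 2 ≤ b' → G.tail b' o n ≤ X) : G.tail b o n ≤ X := by
  refine le_of_tendsto (G.tendsto_tail b o n) (.of_forall fun k => ?_)
  have hcont : Continuous fun x : ℝ≥0 => Pr (exh V k) (prob G.wt x)
      (fun T => n ≤ (K (T : Set (Sym2 V)) o).ncard) :=
    continuous_Ex _ _ fun e => by unfold prob; fun_prop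
  have hne : (nhdsWithin b (Set.Iio b)).NeBot := nhdsLT_neBot_of_exists_lt ⟨0, hb⟩
  refine le_of_tendsto (hcont.continuousWithinAt (s := Set.Iio b)) ?_
  filter_upwards [self_mem_nhdsWithin, mem_nhdsWithin_of_mem_nhds
    (lt_mem_nhds (NNReal.half_lt_self hb.ne'))] with x hx hx2
  exact (G.Pr_le_tail x _ o n).trans (h x hx hx2.le)

lemma exists_tail_le_of_inv {b : ℝ≥0} {o : V} {C θ : ℝ} (hC : 0 ≤ C) (hθ : θ ≤ 1)
    (h : ∀ n : ℕ, 1 ≤ n → G.tail b o n ≤ C * (n : ℝ)⁻¹) :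
    ∃ A, ∀ m : ℕ, 1 ≤ m → G.tail b o m ≤ A * (m : ℝ) ^ (-θ) := by
  refine ⟨C, fun m hm => (h m hm).trans (mul_le_mul_of_nonneg_left ?_ hC)⟩
  rw [← Real.rpow_neg_one]
  exact Real.rpow_le_rpow_of_exponent_le (by exact_mod_cast hm) (by linarith)

lemma exists_tail_zero_le (htrans : G.IsTransitive) (o : V) {θ : ℝ} (hθ : θ ≤ 1) :
    ∃ A, ∀ m : ℕ, 1 ≤ m → G.tail 0 o m ≤ A * (m : ℝ) ^ (-θ) :=
  exists_tail_le_of_inv (by positivity) hθ fun n hn =>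
    tail_le_of_outflow_le htrans (S := {o}) (Finset.mem_singleton_self o) (r := 0) one_pos le_rfl
      (fun W => by simp) hn

/-- **Sharpness**: below a parameter without infinite clusters, cluster sizes have finite mean, and
in particular tails of every order `θ ≤ 1`. -/
lemma exists_tail_le_of_lt (htrans : G.IsTransitive) {b b' : ℝ≥0} (hb : 0 < b) (hbb : b < b')
    (hno : G.NoInfiniteCluster b') (o : V) {θ : ℝ} (hθ : θ ≤ 1) :
    ∃ A, ∀ m : ℕ, 1 ≤ m → G.tail b o m ≤ A * (m : ℝ) ^ (-θ) := by
  have hb' : (0 : ℝ) < b := by exact_mod_cast hb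
  obtain ⟨S, ho, hS⟩ := exists_outflow_le hbb hno o (κ := 1 / (2 * b)) (by positivity)
  refine exists_tail_le_of_inv (C := S.card / (1 - 1 / 2)) (by positivity) hθ fun n hn =>
    tail_le_of_outflow_le htrans ho (by norm_num) (by norm_num) (fun W => ?_) hn
  calc (b : ℝ) * G.outflow b S o W ≤ b * (1 / (2 * b)) := mul_le_mul_of_nonneg_left (hS W) hb'.le
    _ = 1 / 2 := by field_simp

/-- At a large parameter, the cluster of `o` is likely to contain any given finite set of
neighbours of `o`. -/
lemma exists_half_lt_tail {ε : ℝ} (hε : 0 < ε) (o : V) {n : ℕ} (hn : n ≤ (G.nbr ε o).card) :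
    ∃ b : ℝ≥0, 1 ≤ b ∧ 1 / 2 < G.tail b o n := by
  set F := (G.nbr ε o).image fun y => s(o, y) with hF
  have hlim : Tendsto (fun b : ℝ≥0 => ∏ e ∈ F, prob G.wt b e) atTop (nhds (∏ _e ∈ F, 1)) := by
    refine tendsto_finsetProd _ fun e he => ?_
    obtain ⟨y, hy, rfl⟩ := Finset.mem_image.1 he
    have hpos : 0 < G.wt s(o, y) := hε.trans_le ((G.mem_nbr hε).1 hy)
    have h1 : Tendsto (fun b : ℝ≥0 => (b : ℝ) * G.wt s(o, y)) atTop atTop :=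
      (NNReal.tendsto_coe_atTop.2 tendsto_id).atTop_mul_const hpos
    have h2 := (Real.tendsto_exp_neg_atTop_nhds_zero.comp h1).const_sub 1
    simpa [prob, Function.comp_def] using h2
  rw [Finset.prod_const_one] at hlim
  obtain ⟨b, hb, hb1⟩ := ((hlim.eventually (lt_mem_nhds (by norm_num : (1 / 2 : ℝ) < 1))).and
    (eventually_ge_atTop 1)).exists
  refine ⟨b, hb1, hb.trans_le (le_trans ?_ (G.Pr_le_tail b F o n))⟩
  have hp : ∀ e ∈ F, 0 ≤ prob G.wt b e ∧ prob G.wt b e ≤ 1 := fun e _ =>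
    prob_mem G.wt_nonneg b.2 e
  have h1 : ∏ e ∈ F, prob G.wt b e = Pr F (prob G.wt b) (fun T => T = F) := by
    unfold Pr Ex
    rw [Finset.sum_eq_single F (fun T _ hT => by simp [hT])
      (fun h => absurd (Finset.mem_powerset_self F) h)]
    simp
  rw [h1]
  refine Pr_mono hp fun T _ hT => hn.trans ?_
  subst hT
  rw [← Set.ncard_coe_finset]
  refine Set.ncard_le_ncard (fun y hy => ?_) (K_finite (Finset.finite_toSet _))
  exact .edge (Finset.mem_coe.2 (Finset.mem_image_of_mem _ hy))

/-- The scale `ε` is chosen so small that `c * ε ^ (-a) ≥ 1`; the exponents match because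
`a * (2 - θ) = 1 + θ` for `θ = (2 * a - 1) / (a + 1)`. -/
lemma exists_scale {a c ε₀ : ℝ} (ha : 1 / 2 < a) (hc : 0 < c) (hε₀ : 0 < ε₀) (o : V)
    (hJ : ∀ ε : ℝ, 0 < ε → ε ≤ ε₀ → c * ε ^ (-a) ≤ (G.nbr ε o).card) :
    ∃ ε > 0, ∀ n : ℕ, 1 ≤ n → (n : ℝ) ^ (1 + (2 * a - 1) / (a + 1)) ≤
      (G.nbr (ε * (n : ℝ) ^ (-(2 - (2 * a - 1) / (a + 1)))) o).card := by
  have ha0 : 0 < a := by linarith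
  refine ⟨min ε₀ (c ^ (1 / a)), lt_min hε₀ (by positivity), fun n hn => ?_⟩
  set ε := min ε₀ (c ^ (1 / a)) with hε
  have hεpos : 0 < ε := lt_min hε₀ (by positivity)
  have hn1 : (1 : ℝ) ≤ n := by exact_mod_cast hn
  have hn0 : (0 : ℝ) < n := by linarith
  have ha1 : a + 1 ≠ 0 := by linarith
  have h2 : 2 - (2 * a - 1) / (a + 1) = 3 / (a + 1) := by field_simp; ring
  have hle : (n : ℝ) ^ (-(2 - (2 * a - 1) / (a + 1))) ≤ 1 := by
    refine Real.rpow_le_one_of_one_le_of_nonpos hn1 ?_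
    rw [h2]
    have : 0 < 3 / (a + 1) := by positivity
    linarith
  refine le_trans ?_ (hJ (ε * (n : ℝ) ^ (-(2 - (2 * a - 1) / (a + 1)))) (by positivity) ?_)
  · have h1 : 1 ≤ c * ε ^ (-a) := by
      have h3 : ε ^ a ≤ c := by
        calc ε ^ a ≤ (c ^ (1 / a)) ^ a := Real.rpow_le_rpow hεpos.le (min_le_right _ _) ha0.le
          _ = c := by rw [← Real.rpow_mul hc.le, one_div_mul_cancel ha0.ne', Real.rpow_one]
      rw [Real.rpow_neg hεpos.le, ← div_eq_mul_inv, one_le_div (by positivity)]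
      exact h3
    have h3 : ((n : ℝ) ^ (-(2 - (2 * a - 1) / (a + 1)))) ^ (-a) =
        (n : ℝ) ^ (1 + (2 * a - 1) / (a + 1)) := by
      rw [← Real.rpow_mul hn0.le]; congr 1; field_simp; ring
    rw [Real.mul_rpow hεpos.le (by positivity), h3, ← mul_assoc]
    exact le_mul_of_one_le_left (by positivity) h1
  · exact (mul_le_of_le_one_right hεpos.le hle).trans (min_le_left _ _)

end Conclusion

end WeightedGraph

theorem theorem1p2 {V : Type*} [Countable V] [Infinite V] (G : WeightedGraph V)
    (htrans : G.IsTransitive) (hunimod : G.IsUnimodular) (o : V)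
    (a c ε₀ : ℝ) (ha : 1 / 2 < a) (ha' : a < 1) (hc : 0 < c) (hε₀ : 0 < ε₀)
    (hJ : ∀ ε : ℝ, 0 < ε → ε ≤ ε₀ →
      c * ε ^ (-a) ≤ ({e : G.graph.edgeSet | o ∈ (e : Sym2 V) ∧ ε ≤ G.J e}.ncard : ℝ)) :
    G.criticalParam < ⊤ ∧
    (∃ C : ℝ, ∀ β : ℝ≥0, (β : ℝ≥0∞) ≤ G.criticalParam → ∀ n : ℕ, 1 ≤ n →
      (G.percolation β).real {ω | (n : ℕ∞) ≤ (G.cluster ω o).encard}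
        ≤ C * (n : ℝ) ^ (-((2 * a - 1) / (a + 1)))) ∧
    G.NoInfiniteCluster G.criticalParam.toNNReal := by
  set θ := (2 * a - 1) / (a + 1) with hθ
  have hθ0 : 0 < θ := div_pos (by linarith) (by linarith)
  have hθ1 : θ < 1 / 2 := by rw [hθ, div_lt_iff₀ (by linarith)]; linarith
  obtain ⟨ε, hε, hheavy⟩ := WeightedGraph.exists_scale ha hc hε₀ o fun ε hε hε' => by
    rw [← G.card_nbr hε o]; exact hJ ε hε hε'
  rw [← hθ] at hheavy
  -- the estimate strictly below the critical parameter
  have hsub : ∀ b₀ : ℝ, 0 < b₀ → ∀ b : ℝ≥0, b₀ ≤ b → (b : ℝ≥0∞) < G.criticalParam →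
      ∀ n : ℕ, 1 ≤ n →
      G.tail b o n ≤ WeightedGraph.bootConst θ ε b₀ ^ ((1 + θ) / (2 * θ)) * (n : ℝ) ^ (-θ) := by
    intro b₀ hb₀ b hb hbc n hn
    obtain ⟨_, ⟨b', rfl, hno⟩, hbb⟩ := lt_sSup_iff.1 hbc
    have hb0 : 0 < b := by exact_mod_cast hb₀.trans_le hb
    exact G.tail_le_of_exists htrans hunimod hb₀ hb hε hθ0 hθ1 hheavy
      (WeightedGraph.exists_tail_le_of_lt htrans hb0 (by exact_mod_cast hbb) hno o (by linarith)) hn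
  have hlt : G.criticalParam < ⊤ := by
    by_contra htop
    rw [not_lt, top_le_iff] at htop
    -- the bound would hold uniformly for `b ≥ 1`, but tails tend to `1` as `b → ∞`
    set D := WeightedGraph.bootConst θ ε 1 ^ ((1 + θ) / (2 * θ)) with hD
    have hlim : Filter.Tendsto (fun m : ℕ => D * (m : ℝ) ^ (-θ)) Filter.atTop (nhds (D * 0)) :=
      ((tendsto_rpow_neg_atTop hθ0).comp tendsto_natCast_atTop_atTop).const_mul D
    rw [mul_zero] at hlim
    obtain ⟨n, hn, hn1⟩ := ((hlim.eventually (gt_mem_nhds (by norm_num : (0 : ℝ) < 1 / 2))).and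
      (Filter.eventually_ge_atTop 1)).exists
    have hn' : (1 : ℝ) ≤ n := by exact_mod_cast hn1
    have hcard : n ≤ (G.nbr (ε * (n : ℝ) ^ (-(2 - θ))) o).card := by
      have h1 : (n : ℝ) ≤ (n : ℝ) ^ (1 + θ) := by
        nth_rw 1 [← Real.rpow_one (n : ℝ)]
        exact Real.rpow_le_rpow_of_exponent_le hn' (by linarith)
      exact_mod_cast h1.trans (hheavy n hn1)
    obtain ⟨b, hb1, hb⟩ := WeightedGraph.exists_half_lt_tail (G := G) (by positivity) o hcard
    have := hsub 1 one_pos b (by exact_mod_cast hb1) (htop ▸ ENNReal.coe_lt_top) n hn1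
    linarith
  have hbc : (G.criticalParam.toNNReal : ℝ≥0∞) = G.criticalParam := ENNReal.coe_toNNReal hlt.ne
  set bc := G.criticalParam.toNNReal with hbcdef
  have hcrit : ∃ C : ℝ, ∀ n : ℕ, 1 ≤ n → G.tail bc o n ≤ C * (n : ℝ) ^ (-θ) := by
    rcases eq_or_ne bc 0 with h0 | h0
    · rw [h0]
      exact WeightedGraph.exists_tail_zero_le htrans o (by linarith)
    · have hpos : 0 < bc := pos_iff_ne_zero.2 h0
      refine ⟨WeightedGraph.bootConst θ ε (bc / 2 : ℝ≥0) ^ ((1 + θ) / (2 * θ)), fun n hn =>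
        WeightedGraph.tail_le_of_forall_lt hpos fun b hb hb2 => ?_⟩
      refine hsub (bc / 2 : ℝ≥0) (by exact_mod_cast half_pos hpos) b (by exact_mod_cast hb2) ?_ n hn
      rw [← hbc]
      exact_mod_cast hb
  obtain ⟨C, hC⟩ := hcrit
  refine ⟨hlt, ⟨C, fun b hb n hn => ?_⟩, G.noInfiniteCluster_of_tail_le htrans hθ0 hC⟩
  rw [← hbc] at hb
  exact (WeightedGraph.tail_mono (by exact_mod_cast hb) o n).trans (hC n hn)
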